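/- Let $\Sigma$ be a Riemann surface, with complex structure $j$, and let $(N^4,g)$ be an oriented smooth Riemannian 4-manifold with Levi-Civita connection $\nabla$. Let $\varphi:\Sigma\to N$ be a branched minimal immersion: a smooth map which is harmonic and weakly conformal, i.e. in a local holomorphic coordinate $z=x^1+ix^2$ $$g(\partial_1\varphi,\partial_1\varphi)=g(\partial_2\varphi,\partial_2\varphi),\qquad g(\partial_1\varphi,\partial_2\varphi)=0,\qquad \nabla_{\partial_1}\partial_1\varphi+\nabla_{\partial_2}\partial_2\varphi=0,$$ and for which the zeros of the conformal factor $|\partial_1\varphi|^2$ (the branch points) are isolated and of finite order. Let $\mathcal E\to\Sigma$ be the bundle whose fiber over $x$ is the set of oriented complex structures of $T_{\varphi(x)}N$, i.e. of the orthogonal $K$ with $K^2=-1$ that induce the given orientation. The total space $\mathcal E$ carries the almost complex structure $\mathcal J$ which on the horizontal space of $\nabla$ (identified with $T_x\Sigma$) is $j$, and on the vertical space $\{A \text{ skew}: AK+KA=0\}$ at $K$ is $A\mapsto AK$. A section of $\mathcal E$ over an open subset of $\Sigma$ is called holomorphic if it is of class $C^1$ and its differential intertwines $j$ and $\mathcal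 J$. 1. There is exactly one continuous section $J_\Sigma$ of $\mathcal E$ over $\Sigma$ such that at every unbranched point $J_\Sigma e_1=e_2$, $J_\Sigma e_2=-e_1$, $J_\Sigma e_3=e_4$, $J_\Sigma e_4=-e_3$ for an oriented orthonormal basis $(e_i)$ of $T_{\varphi(x)}N$ with $(e_1,e_2)$ an oriented basis of $d\varphi(T_x\Sigma)$. The map $J_\Sigma:\Sigma\to\mathcal E$ is holomorphic on all of $\Sigma$, including the branch points. 2. For a smooth oriented orthonormal frame $(e_i)$ of $\varphi^*TN$ over an open set $U\subset\Sigma$ put $E_1=e_1\wedge e_2+e_3\wedge e_4$, $E_2=e_1\wedge e_3-e_2\wedge e_4$, $E_3=e_1\wedge e_4+e_2\wedge e_3$, where $a\wedge b$ is the endomorphism $v\mapsto\langle b,v\rangle a-\langle a,v\rangle b$, and in a holomorphic coordinate let $\nabla_{\partial_\alpha}E_j=\sum_i\Gamma^i_{\alpha j}E_i$; the $\Gamma^i_{\alpha j}$ are smooth, and every $C^1$ section $J$ of $\mathcal E$ over an open $V\subset U$ is $J=\sum u_iE_i$ with $u_i=\frac12\langle J,E_i\rangle$, where $\langle A,B\rangle=-\frac12\operatorname{tr}(AB)$.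 There are smooth $2\times2$ matrix functions $A_1,A_2$ on the open unit disc $D\subset\mathbb R^2$ with $\det(\xi_1A_1(u)+\xi_2A_2(u))\neq0$ for all $u\in D$, $\xi\in\mathbb R^2\setminus\{0\}$, and a smooth family $B(u)$, $u\in D$, of linear maps, all independent of the frame and of the coordinate, such that a $C^1$ section with $u_1<0$ on $V$ is holomorphic on $V$ if and only if $u=(u_2,u_3)$ solves the first order elliptic system $$A_1(u)\,\partial_1u+A_2(u)\,\partial_2u+B(u)\Gamma=0 .$$ Every $p\in\Sigma$ has a neighborhood with such a frame for which $J_\Sigma(p)=-E_1(p)$, $u_1<0$, and $J_\Sigma$ solves the system. 3. Bounded isolated singularities are removable: let $V\subset\Sigma$ be open, $p\in V$, $(e_i)$ a smooth oriented orthonormal frame of $\varphi^*TN$ over $V$, and $J=\sum u_iE_i$ a holomorphic section of $\mathcal E$ over $V\setminus\{p\}$ whose affine fiber coordinate $(u_2+iu_3)/(1-u_1)$ is bounded, i.e. $u_1\le1-\delta$ on $V\setminus\{p\}$ for some $\delta>0$. Then $J$ extends to a holomorphic section of $\mathcal E$ over $V$. -/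

import Mathlib

open scoped Manifold ContDiff Topology

noncomputable section

namespace TwistorLift

/-- The model space of the four-dimensional target. -/
abbrev E4 := EuclideanSpace ℝ (Fin 4)

/-- The `i`-th standard basis vector of `ℝ⁴`. -/
abbrev bvec (i : Fin 4) : E4 := EuclideanSpace.single i (1 : ℝ)

section Target

variable {N : Type*} [TopologicalSpace N] [ChartedSpace E4 N]

/-- Endomorphisms of the tangent space `T_y N`. -/
abbrev EndT (y : N) := TangentSpace (𝓡 4) y →L[ℝ] TangentSpace (𝓡 4) y

/-- The determinant of four tangent vectors, in the coordinates of the preferred chart at `y`. -/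
def coordDet (y : N) (v : Fin 4 → TangentSpace (𝓡 4) y) : ℝ :=
  Matrix.det (Matrix.of fun i j : Fin 4 => (id (v j) : E4) i)

variable [IsManifold (𝓡 4) ∞ N]

/-- Smooth Riemannian metrics on `N`. -/
abbrev Metric (N : Type*) [TopologicalSpace N] [ChartedSpace E4 N] [IsManifold (𝓡 4) ∞ N] :=
  Bundle.ContMDiffRiemannianMetric (𝓡 4) ∞ E4 (fun y : N => TangentSpace (𝓡 4) y)

/-- The coordinate isomorphism `ℝ⁴ → T_y N` given by the chart of `N` centred at `y₀`
(meaningful for `y` in the source of this chart). -/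
def toFiber (y₀ y : N) : E4 →L[ℝ] TangentSpace (𝓡 4) y := tangentCoordChange (𝓡 4) y₀ y y

/-- The inverse coordinate isomorphism `T_y N → ℝ⁴`. -/
def ofFiber (y₀ y : N) : TangentSpace (𝓡 4) y →L[ℝ] E4 := tangentCoordChange (𝓡 4) y y₀ y

/-- The smooth atlas of charts `chartAt` of `N` is an oriented one: all the coordinate changes
have positive Jacobian.  A basis of `T_y N` is then positively oriented iff `0 < coordDet`. -/
def IsOrientedAtlas (N : Type*) [TopologicalSpace N] [ChartedSpace E4 N]
    [IsManifold (𝓡 4) ∞ N] : Prop :=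
  ∀ y₀ y₁ y : N, y ∈ (chartAt E4 y₀).source → y ∈ (chartAt E4 y₁).source →
    0 < (tangentCoordChange (𝓡 4) y₀ y₁ y).det

/-- The metric in the chart centred at `y₀`, as a bilinear form at the coordinate point `q`. -/
def metricCoord (g : Metric N) (y₀ : N) (q v w : E4) : ℝ :=
  g.inner ((chartAt E4 y₀).symm q) (toFiber y₀ ((chartAt E4 y₀).symm q) v)
    (toFiber y₀ ((chartAt E4 y₀).symm q) w)

/-- The matrix `(g_{ij})` of the metric in the chart centred at `y₀`. -/
def metricMatrix (g : Metric N) (y₀ : N) (q : E4) : Matrix (Fin 4) (Fin 4) ℝ :=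
  Matrix.of fun i j => metricCoord g y₀ q (bvec i) (bvec j)

/-- `∂_k g_{ij}`. -/
def metricDeriv (g : Metric N) (y₀ : N) (q : E4) (k i j : Fin 4) : ℝ :=
  fderiv ℝ (fun q' => metricMatrix g y₀ q' i j) q (bvec k)

/-- The Christoffel symbols `Γ^k_{ij}` of the Levi-Civita connection. -/
def christoffel (g : Metric N) (y₀ : N) (q : E4) (k i j : Fin 4) : ℝ :=
  (1 / 2) * ∑ l, (metricMatrix g y₀ q)⁻¹ k l *
    (metricDeriv g y₀ q i j l + metricDeriv g y₀ q j i l - metricDeriv g y₀ q l i j)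

/-- The connection form: `connForm g y₀ q v w` has the components `Γ^k_{ij} v^i w^j`. -/
def connForm (g : Metric N) (y₀ : N) (q v : E4) : E4 →L[ℝ] E4 :=
  Matrix.toEuclideanCLM (n := Fin 4) (𝕜 := ℝ)
    (Matrix.of fun k j => ∑ i, christoffel g y₀ q k i j * v i)

/-- The set of oriented complex structures of `(T_y N, g)`: the orthogonal `K` with `K² = -1` which
induce the given orientation. -/
def twistorFiber (g : Metric N) (y : N) : Set (EndT y) :=
  {K | (∀ v w, g.inner y (K v) (K w) = g.inner y v w) ∧ (∀ v, K (K v) = -v) ∧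
    ∀ v w, LinearIndependent ℝ ![v, K v, w, K w] → 0 < coordDet y ![v, K v, w, K w]}

/-- The skew endomorphism `a ∧ b : v ↦ ⟨b, v⟩ a - ⟨a, v⟩ b`; for an orthonormal basis `e` the matrix
of `∑ k < l, a_{kl} e_k ∧ e_l` is the skew matrix `(a_{kl})`. -/
def wedge (g : Metric N) (y : N) (a b : TangentSpace (𝓡 4) y) : EndT y :=
  (g.inner y b).smulRight a - (g.inner y a).smulRight b

/-- The inner product `⟨A, B⟩ = -½ tr (A B)` of skew endomorphisms. -/
def skewInner (y : N) (A B : EndT y) : ℝ :=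
  -(1 / 2) * LinearMap.trace ℝ (TangentSpace (𝓡 4) y) (A ∘L B).toLinearMap

/-- The basis `E₁ = e₁∧e₂ + e₃∧e₄`, `E₂ = e₁∧e₃ - e₂∧e₄`, `E₃ = e₁∧e₄ + e₂∧e₃` of the self-dual
2-vectors belonging to an oriented orthonormal basis `e` (indices start at `0` in the code). -/
def selfDual (g : Metric N) (y : N) (e : Fin 4 → TangentSpace (𝓡 4) y) : Fin 3 → EndT y :=
  ![wedge g y (e 0) (e 1) + wedge g y (e 2) (e 3),
    wedge g y (e 0) (e 2) - wedge g y (e 1) (e 3),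
    wedge g y (e 0) (e 3) + wedge g y (e 1) (e 2)]

/-- Oriented orthonormal bases of `T_y N`. -/
def IsOrientedOrthonormal (g : Metric N) (y : N) (e : Fin 4 → TangentSpace (𝓡 4) y) : Prop :=
  (∀ i j, g.inner y (e i) (e j) = if i = j then 1 else 0) ∧ 0 < coordDet y e

end Target

section Maps

variable {S : Type*} [TopologicalSpace S] [ChartedSpace ℂ S]
  {N : Type*} [TopologicalSpace N] [ChartedSpace E4 N] [IsManifold (𝓡 4) ∞ N]

/-- The point of the surface with coordinate `z` in the chart centred at `x₀`. -/
abbrev pt (x₀ : S) (z : ℂ) : S := (chartAt ℂ x₀).symm z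

/-- The coordinate domain of a map in the charts centred at `x₀` and `y₀`. -/
def patch (φ : S → N) (x₀ : S) (y₀ : N) : Set ℂ :=
  {z | z ∈ (chartAt ℂ x₀).target ∧ φ (pt x₀ z) ∈ (chartAt E4 y₀).source}

/-- The map in coordinates. -/
def localMap (φ : S → N) (x₀ : S) (y₀ : N) (z : ℂ) : E4 := chartAt E4 y₀ (φ (pt x₀ z))

/-- The differential of the map in coordinates. -/
def dMap (φ : S → N) (x₀ : S) (y₀ : N) (z ζ : ℂ) : E4 := fderiv ℝ (localMap φ x₀ y₀) z ζ

/-- The bilinear form `φ^* g` in the coordinate `z = x¹ + i x²`. -/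
def pullbackMetric (g : Metric N) (φ : S → N) (x₀ : S) (y₀ : N) (z ζ η : ℂ) : ℝ :=
  metricCoord g y₀ (localMap φ x₀ y₀ z) (dMap φ x₀ y₀ z ζ) (dMap φ x₀ y₀ z η)

/-- The conformal factor `|∂φ/∂x¹|²`. -/
def conformalFactor (g : Metric N) (φ : S → N) (x₀ : S) (y₀ : N) (z : ℂ) : ℝ :=
  pullbackMetric g φ x₀ y₀ z 1 1

/-- The tension field `∇_{∂₁} ∂₁φ + ∇_{∂₂} ∂₂φ` in the coordinate `z = x¹ + i x²`. -/
def tension (g : Metric N) (φ : S → N) (x₀ : S) (y₀ : N) (z : ℂ) : E4 :=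
  fderiv ℝ (fun w => dMap φ x₀ y₀ w 1) z 1
    + connForm g y₀ (localMap φ x₀ y₀ z) (dMap φ x₀ y₀ z 1) (dMap φ x₀ y₀ z 1)
    + fderiv ℝ (fun w => dMap φ x₀ y₀ w Complex.I) z Complex.I
    + connForm g y₀ (localMap φ x₀ y₀ z) (dMap φ x₀ y₀ z Complex.I) (dMap φ x₀ y₀ z Complex.I)

/-- Branched minimal immersions of a Riemann surface: smooth weakly conformal harmonic maps for
which the zeros of the conformal factor are isolated and of finite order. -/
structure IsBranchedMinimalImmersion (g : Metric N) (φ : S → N) : Prop where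
  smooth : ContMDiff 𝓘(ℝ, ℂ) (𝓡 4) ∞ φ
  conformal : ∀ x₀ y₀, ∀ z ∈ patch φ x₀ y₀,
    pullbackMetric g φ x₀ y₀ z Complex.I Complex.I = pullbackMetric g φ x₀ y₀ z 1 1 ∧
    pullbackMetric g φ x₀ y₀ z 1 Complex.I = 0
  branch : ∀ x₀ y₀, ∀ z ∈ patch φ x₀ y₀, conformalFactor g φ x₀ y₀ z = 0 →
    (∀ᶠ w in 𝓝[≠] z, conformalFactor g φ x₀ y₀ w ≠ 0) ∧
    ∃ k : ℕ, iteratedFDeriv ℝ k (conformalFactor g φ x₀ y₀) z ≠ 0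
  harmonic : ∀ x₀ y₀, ∀ z ∈ patch φ x₀ y₀, tension g φ x₀ y₀ z = 0

/-- Sections of the bundle of endomorphisms of `TN` along the map `φ`. -/
abbrev EndSection (φ : S → N) := ∀ x : S, EndT (φ x)

/-- A section of the endomorphism bundle in coordinates. -/
def localSection (φ : S → N) (J : EndSection φ) (x₀ : S) (y₀ : N) (z : ℂ) : E4 →L[ℝ] E4 :=
  ofFiber y₀ (φ (pt x₀ z)) ∘L J (pt x₀ z) ∘L toFiber y₀ (φ (pt x₀ z))

/-- `x` is a branch point iff `dφ_x = 0`. -/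
def IsBranchPoint (φ : S → N) (x : S) : Prop := mfderiv 𝓘(ℝ, ℂ) (𝓡 4) φ x = 0

/-- `e` is an oriented orthonormal basis of `T_{φ(x)} N` such that `(e₁, e₂)` is an oriented basis
of `dφ (T_x S)`: `e₁ = dφ(a)`, `e₂ = dφ(b)` for a positively oriented basis `(a, b)` of `T_x S`. -/
def IsAdaptedFrame (g : Metric N) (φ : S → N) (x : S)
    (e : Fin 4 → TangentSpace (𝓡 4) (φ x)) : Prop :=
  IsOrientedOrthonormal g (φ x) e ∧
  ∃ a b : ℂ, 0 < ((starRingEnd ℂ) a * b).im ∧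
    mfderiv 𝓘(ℝ, ℂ) (𝓡 4) φ x a = e 0 ∧ mfderiv 𝓘(ℝ, ℂ) (𝓡 4) φ x b = e 1

/-- `J` is the section `J_Σ`: a continuous section of the bundle of oriented complex structures
with `J e₁ = e₂`, `J e₂ = -e₁`, `J e₃ = e₄`, `J e₄ = -e₃` in adapted bases away from the branch
points. -/
structure IsTwistorLift (g : Metric N) (φ : S → N) (J : EndSection φ) : Prop where
  mem : ∀ x, J x ∈ twistorFiber g (φ x)
  continuousOn : ∀ x₀ y₀, ContinuousOn (localSection φ J x₀ y₀) (patch φ x₀ y₀)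
  adapted : ∀ x, ¬ IsBranchPoint φ x → ∃ e : Fin 4 → TangentSpace (𝓡 4) (φ x),
    IsAdaptedFrame g φ x e ∧
      J x (e 0) = e 1 ∧ J x (e 1) = -e 0 ∧ J x (e 2) = e 3 ∧ J x (e 3) = -e 2

/-! ### The almost complex structure on the total space `𝓔`

In coordinates, points of the total space of the endomorphism bundle along `φ` are pairs `(z, K)`
in `ℂ × End(ℝ⁴)`; the points of `𝓔` are those with `K` an oriented complex structure. Tangent
vectors are pairs `(ζ, L)`. -/

/-- Coordinates `(z, K)` on the total space. -/
abbrev Tot := ℂ × (E4 →L[ℝ] E4)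

/-- The connection form of `φ^* TN` in the direction `ζ`. -/
def pullConn (g : Metric N) (φ : S → N) (x₀ : S) (y₀ : N) (z ζ : ℂ) : E4 →L[ℝ] E4 :=
  connForm g y₀ (localMap φ x₀ y₀ z) (dMap φ x₀ y₀ z ζ)

/-- The vertical part of a tangent vector `(ζ, L)` at `(z, K)` for the Levi-Civita connection;
along a section it is the covariant derivative. -/
def verticalPart (g : Metric N) (φ : S → N) (x₀ : S) (y₀ : N) (P V : Tot) : E4 →L[ℝ] E4 :=
  V.2 + (pullConn g φ x₀ y₀ P.1 V.1 ∘L P.2 - P.2 ∘L pullConn g φ x₀ y₀ P.1 V.1)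

/-- The horizontal lift to `(z, K)` of a tangent vector `ζ` of the surface. -/
def horizontalLift (g : Metric N) (φ : S → N) (x₀ : S) (y₀ : N) (P : Tot) (ζ : ℂ) : Tot :=
  (ζ, -(pullConn g φ x₀ y₀ P.1 ζ ∘L P.2 - P.2 ∘L pullConn g φ x₀ y₀ P.1 ζ))

/-- The almost complex structure of `𝓔`: multiplication by `i` on the horizontal space (identified
with the tangent space of the surface) and `A ↦ A K` on the vertical space at `(z, K)`. -/
def twistorJ (g : Metric N) (φ : S → N) (x₀ : S) (y₀ : N) (P V : Tot) : Tot :=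
  horizontalLift g φ x₀ y₀ P (Complex.I * V.1) + (0, verticalPart g φ x₀ y₀ P V ∘L P.2)

/-- At the points of `𝓔` the operator `twistorJ` squares to `-1`. -/
theorem twistorJ_twistorJ (g : Metric N) (φ : S → N) (x₀ : S) (y₀ : N) (P V : Tot)
    (hP : P.2 ∘L P.2 = -ContinuousLinearMap.id ℝ E4) :
    twistorJ g φ x₀ y₀ P (twistorJ g φ x₀ y₀ P V) = -V := by
  have hI : Complex.I * (Complex.I * V.1) = -V.1 := by
    rw [← mul_assoc, Complex.I_mul_I]; simp
  have hneg : ∀ ζ : ℂ, pullConn g φ x₀ y₀ P.1 (-ζ) = -pullConn g φ x₀ y₀ P.1 ζ := by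
    intro ζ
    unfold pullConn connForm dMap
    rw [← map_neg (Matrix.toEuclideanCLM (n := Fin 4) (𝕜 := ℝ))]
    congr 1
    ext k j
    simp
  ext1
  · simp [twistorJ, horizontalLift, hI]
  · have h2 : (verticalPart g φ x₀ y₀ P V ∘L P.2) ∘L P.2 = -verticalPart g φ x₀ y₀ P V := by
      rw [ContinuousLinearMap.comp_assoc, hP]; ext v; simp
    have h3 : verticalPart g φ x₀ y₀ P (twistorJ g φ x₀ y₀ P V) =
        verticalPart g φ x₀ y₀ P V ∘L P.2 := by
      simp only [verticalPart, twistorJ, horizontalLift, Prod.fst_add, Prod.snd_add, add_zero]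
      abel
    rw [twistorJ, h3, h2]
    simp only [twistorJ, horizontalLift, Prod.fst_add, add_zero, hI, hneg, verticalPart,
      Prod.snd_add, Prod.snd_neg]
    ext v
    simp
    ring

/-- A section as a map into the total space. -/
def graphMap (φ : S → N) (J : EndSection φ) (x₀ : S) (y₀ : N) (z : ℂ) : Tot :=
  (z, localSection φ J x₀ y₀ z)

/-- The section `J` of `𝓔` is of class `C¹` over the open set `V`. -/
def IsC1SectionOn (g : Metric N) (φ : S → N) (J : EndSection φ) (V : Set S) : Prop :=
  (∀ x ∈ V, J x ∈ twistorFiber g (φ x)) ∧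
  ∀ x₀ y₀, ContDiffOn ℝ 1 (localSection φ J x₀ y₀) (patch φ x₀ y₀ ∩ pt x₀ ⁻¹' V)

/-- The section `J` is a holomorphic map from the open set `V` to `𝓔`: it is of class `C¹` and its
differential intertwines the complex structure of the surface and that of `𝓔`. -/
def IsHolomorphicOn (g : Metric N) (φ : S → N) (J : EndSection φ) (V : Set S) : Prop :=
  IsC1SectionOn g φ J V ∧
  ∀ x₀ y₀, ∀ z ∈ patch φ x₀ y₀ ∩ pt x₀ ⁻¹' V, ∀ ζ : ℂ,
    fderiv ℝ (graphMap φ J x₀ y₀) z (Complex.I * ζ) =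
      twistorJ g φ x₀ y₀ (graphMap φ J x₀ y₀ z) (fderiv ℝ (graphMap φ J x₀ y₀) z ζ)

/-! ### Local frames and the first order system -/

/-- `e` is a smooth oriented orthonormal frame of `TN` along `φ` over the open set `U`. -/
structure IsLocalFrame (g : Metric N) (φ : S → N) (U : Set S)
    (e : ∀ x : S, Fin 4 → TangentSpace (𝓡 4) (φ x)) : Prop where
  orthonormal : ∀ x ∈ U, IsOrientedOrthonormal g (φ x) (e x)
  smooth : ∀ x₀ y₀ i, ContDiffOn ℝ ∞
    (fun z => ofFiber y₀ (φ (pt x₀ z)) (e (pt x₀ z) i)) (patch φ x₀ y₀ ∩ pt x₀ ⁻¹' U)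

/-- The section `E_i` of self-dual 2-vectors belonging to a frame. -/
def frameSection (g : Metric N) (φ : S → N) (e : ∀ x : S, Fin 4 → TangentSpace (𝓡 4) (φ x))
    (i : Fin 3) : EndSection φ :=
  fun x => selfDual g (φ x) (e x) i

/-- The coefficients `u_i` in `J = ∑ u_i E_i`; note `⟨E_i, E_j⟩ = 2 δ_{ij}`. -/
def frameCoeff (g : Metric N) (φ : S → N) (e : ∀ x : S, Fin 4 → TangentSpace (𝓡 4) (φ x))
    (J : EndSection φ) (i : Fin 3) (x : S) : ℝ :=
  (1 / 2) * skewInner (φ x) (J x) (frameSection g φ e i x)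

/-- The coordinate directions `∂/∂x¹`, `∂/∂x²`. -/
def dir : Fin 2 → ℂ := ![1, Complex.I]

/-- The symbols `Γ^i_{αj}` with `∇_{∂_α} E_j = ∑ i, Γ^i_{αj} E_i`, as a function of `α, i, j`. -/
def frameChristoffel (g : Metric N) (φ : S → N)
    (e : ∀ x : S, Fin 4 → TangentSpace (𝓡 4) (φ x)) (x₀ : S) (y₀ : N) (z : ℂ) :
    Fin 2 → Fin 3 → Fin 3 → ℝ := fun α i j =>
  (1 / 2) * (-(1 / 2) * LinearMap.trace ℝ E4
    (verticalPart g φ x₀ y₀ (graphMap φ (frameSection g φ e j) x₀ y₀ z)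
        (fderiv ℝ (graphMap φ (frameSection g φ e j) x₀ y₀) z (dir α)) ∘L
      localSection φ (frameSection g φ e i) x₀ y₀ z).toLinearMap)

/-- The unknown `(u₂, u₃)` as a function of the coordinate `z = x¹ + i x²`. -/
def unknown (g : Metric N) (φ : S → N) (e : ∀ x : S, Fin 4 → TangentSpace (𝓡 4) (φ x))
    (J : EndSection φ) (x₀ : S) (z : ℂ) : Fin 2 → ℝ :=
  ![frameCoeff g φ e J 1 (pt x₀ z), frameCoeff g φ e J 2 (pt x₀ z)]

end Maps

/-- The open unit disc in `ℝ²`. -/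
def disc : Set (Fin 2 → ℝ) := {u | u 0 ^ 2 + u 1 ^ 2 < 1}

/-- Principal coefficients of a first order quasilinear system for two unknown functions of two
variables. -/
abbrev Principal := Fin 2 → (Fin 2 → ℝ) → ((Fin 2 → ℝ) →L[ℝ] (Fin 2 → ℝ))

/-- Lower order term: it depends on the unknown and, linearly, on the symbols `Γ^i_{αj}`. -/
abbrev LowerOrder := (Fin 2 → ℝ) → ((Fin 2 → Fin 3 → Fin 3 → ℝ) →L[ℝ] (Fin 2 → ℝ))

/-- The system is elliptic: its symbol is invertible at all nonzero covectors. -/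
def IsElliptic (A : Principal) : Prop :=
  ∀ u ∈ disc, ∀ ξ : Fin 2 → ℝ, ξ ≠ 0 → (ξ 0 • A 0 u + ξ 1 • A 1 u).det ≠ 0

/-- `u` solves `A₁(u) ∂₁u + A₂(u) ∂₂u + B(u) Γ = 0` at `z`. -/
def SolvesAt (A : Principal) (B : LowerOrder) (Γ : Fin 2 → Fin 3 → Fin 3 → ℝ)
    (u : ℂ → Fin 2 → ℝ) (z : ℂ) : Prop :=
  A 0 (u z) (fderiv ℝ u z (dir 0)) + A 1 (u z) (fderiv ℝ u z (dir 1)) + B (u z) Γ = 0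

end TwistorLift

end

/-! In an oriented orthonormal basis, the oriented complex structures of a Euclidean 4-space are the
unit imaginary quaternions K = ∑ u_i E_i, |u| = 1 (`sdMatrix_mul`, `exists_eq_sdMatrix`). Since (∑
a_i E_i)² = -|a|², a self-dual endomorphism that kills one nonzero vector is zero
(`eq_zero_of_sdEnd_apply_eq_zero`). The Levi-Civita connection is metric, so it acts on the
coefficients by infinitesimal rotations: ∇_α J has the coefficients D_α = ∂_α u + θ_α × u
(`covDeriv_sdEnd`). Holomorphy of J becomes D₂ = u × D₁ (`isHolomorphicOn_iff_covVec`). On the half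
sphere u₁ < 0, the relation u · ∂u = 0 eliminates the derivatives of u₁. What remains is a system
for (u₂, u₃) whose symbol has determinant |ξ|² (`solvesAt_iff`, `isElliptic_principalPart`).

The analytic tool is a local C¹ solution H, with H(p) = 1, of ∂̄H = HM for a C¹ coefficient M
(`exists_dbar_eq_mul`). It comes from a Neumann series for the Cauchy transform, after cutting off
and rescaling M. Such an H serves as an integrating factor in two places.

At a branch point, f = ∂₁φ - i∂₂φ satisfies ∂̄f = -Mf, because φ is harmonic and the connection has
no torsion. Then Hf is holomorphic, and f = (z - p)ⁿ ψ with ψ of class C¹ and ψ(p) ≠ 0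
(`exists_pow_smul_of_dbar`, `exists_factorization`). Weak conformality passes from f to ψ. The
self-dual structure that maps Re ψ to -Im ψ is therefore C¹ across the branch point, and it
satisfies J dφ = dφ i (`exists_local_lift`). Off the isolated branch points this relation determines
J, and continuity determines J at them, so the local lifts agree and define one section.
Differentiating J∂₁φ = ∂₂φ and J∂₂φ = -∂₁φ shows that the Cauchy–Riemann defect kills ∂₁φ
(`covDeriv_apply_dMap`). This defect is self-dual, so it vanishes off the branch points, and by
continuity everywhere (`IsLiftAt.cauchyRiemann`).

For removable singularities, an affine coordinate of the sphere turns D₂ = u × D₁ into a Riccati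
equation ∂̄w = a + bw + cw² (`dbar_affineCoord`). This is a projectivised linear system. Applying H
to (w, 1) and taking the quotient of the components gives a bounded holomorphic function, which
extends by Riemann's theorem (`riccati_removable`). -/

noncomputable section

namespace TwistorLift

/-! ### The Cauchy transform as a right inverse of ∂̄. -/

section CauchyTransform

open MeasureTheory Set Filter

variable {E : Type*} [NormedAddCommGroup E] [NormedSpace ℂ E]

/-- The Cauchy–Riemann operator `∂/∂x¹ + i ∂/∂x²`. -/
def dbar (f : ℂ → E) (z : ℂ) : E := fderiv ℝ f z 1 + Complex.I • fderiv ℝ f z Complex.I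

/-- The fundamental solution of `dbar`. -/
def cauchyKernel (w : ℂ) : ℂ := (2 * Real.pi * w)⁻¹

/-- The Cauchy transform. -/
def cauchyTransform (f : ℂ → E) : ℂ → E :=
  convolution cauchyKernel f (ContinuousLinearMap.lsmul ℝ ℂ) volume

theorem cauchyTransform_apply (f : ℂ → E) (z : ℂ) :
    cauchyTransform f z = ∫ w, cauchyKernel w • f (z - w) := rfl

/-- The singularity |w|⁻¹ is integrable because its order 1 is below the real dimension 2. -/
theorem locallyIntegrable_cauchyKernel : LocallyIntegrable cauchyKernel := by
  refine locallyIntegrable_of_norm_le_rpow (C := (2 * Real.pi)⁻¹) (α := 1) ?_ ?_ ?_ ?_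
  · simp
  · simp
  · refine Eventually.of_forall fun w => ?_
    simp [cauchyKernel, Real.rpow_neg_one, abs_of_pos Real.pi_pos, mul_comm]
  · unfold cauchyKernel
    exact (by fun_prop : Measurable fun w : ℂ => (2 * Real.pi * w)⁻¹).aestronglyMeasurable

/-- A bound for the `L¹` norm of the kernel over discs of radius two. -/
theorem exists_norm_cauchyTransform_le :
    ∃ C : ℝ, 0 < C ∧ ∀ (F : Type*) [NormedAddCommGroup F] [NormedSpace ℂ F] (f : ℂ → F) (B : ℝ),
      (∀ z, ‖f z‖ ≤ B) → (∀ z, 2 < ‖z‖ → f z = 0) → ∀ z, ‖cauchyTransform f z‖ ≤ C * B := by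
  set k1 : ℂ → ℝ := fun w => (Metric.closedBall (0 : ℂ) 1).indicator (fun w => ‖cauchyKernel w‖) w
    with hk1
  have hint : Integrable k1 := by
    rw [hk1]
    refine (integrable_indicator_iff measurableSet_closedBall).2 ?_
    exact (locallyIntegrable_cauchyKernel.integrableOn_isCompact
      (isCompact_closedBall 0 1)).norm
  have hk1n : 0 ≤ ∫ w, k1 w := integral_nonneg fun w =>
    indicator_nonneg (fun _ _ => norm_nonneg _) _
  set V : ℝ := (volume (Metric.closedBall (0 : ℂ) 2)).toReal with hV
  -- On the unit disc the L¹ norm of the kernel is used. Outside, the kernel is at most 1 and `f (z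
  -- - w)` vanishes unless |z - w| ≤ 2, which contributes the area `V`. The summand 1 only makes the
  -- constant positive. The constant does not depend on the value space, so the same one bounds a
  -- transform and its derivative.
  refine ⟨(∫ w, k1 w) + V + 1, by positivity, ?_⟩
  intro F _ _ f B hB h0 z
  have hB0 : 0 ≤ B := (norm_nonneg _).trans (hB 0)
  set k2 : ℂ → ℝ := fun w => (Metric.closedBall z 2).indicator (fun _ => (1 : ℝ)) w with hk2
  have hint2 : Integrable k2 := by
    refine (integrable_indicator_iff measurableSet_closedBall).2 ?_
    exact integrableOn_const (by exact (isCompact_closedBall z 2).measure_lt_top.ne)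
  have hI2 : ∫ w, k2 w = V := by
    rw [hk2, integral_indicator measurableSet_closedBall]
    simp [hV, Measure.real, Complex.volume_closedBall]
  have hle : ∀ w, ‖cauchyKernel w • f (z - w)‖ ≤ (k1 w + k2 w) * B := by
    intro w
    have hk1' : 0 ≤ k1 w := indicator_nonneg (fun _ _ => norm_nonneg _) _
    have hk2' : 0 ≤ k2 w := indicator_nonneg (fun _ _ => zero_le_one) _
    by_cases hz : 2 < ‖z - w‖
    · rw [h0 _ hz]; simp only [smul_zero, norm_zero]; positivity
    · rw [norm_smul]
      refine mul_le_mul ?_ (hB _) (norm_nonneg _) (by positivity)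
      have h2 : k2 w = 1 := by
        refine indicator_of_mem ?_ _
        rw [Metric.mem_closedBall, dist_comm, dist_eq_norm]; exact not_lt.1 hz
      by_cases hw : ‖w‖ ≤ 1
      · have h1 : k1 w = ‖cauchyKernel w‖ := indicator_of_mem (by simpa using hw) _
        rw [h1, h2]; linarith
      · rw [h2]
        have : ‖cauchyKernel w‖ ≤ 1 := by
          unfold cauchyKernel
          rw [norm_inv]
          refine inv_le_one_of_one_le₀ ?_
          simp only [norm_mul, Complex.norm_ofNat, Complex.norm_real, Real.norm_eq_abs,
            abs_of_pos Real.pi_pos]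
          have := Real.pi_gt_three
          push Not at hw
          nlinarith
        linarith
  rw [cauchyTransform_apply]
  calc ‖∫ w, cauchyKernel w • f (z - w)‖ ≤ ∫ w, (k1 w + k2 w) * B :=
        norm_integral_le_of_norm_le ((hint.add hint2).mul_const B) (Eventually.of_forall hle)
    _ = ((∫ w, k1 w) + V) * B := by
        rw [integral_mul_const, integral_add hint hint2, hI2]
    _ ≤ _ := by nlinarith

variable {f : ℂ → E}

/-- The derivative falls on the compactly supported factor of the convolution, so the sup bound for
transforms also controls derivatives of transforms. -/
theorem hasFDerivAt_cauchyTransform (hc : HasCompactSupport f) (hf : ContDiff ℝ 1 f) (z : ℂ) :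
    HasFDerivAt (cauchyTransform f) (cauchyTransform (fderiv ℝ f) z) z := by
  have h := hc.hasFDerivAt_convolution_right (ContinuousLinearMap.lsmul ℝ ℂ)
    locallyIntegrable_cauchyKernel hf z
  exact h

theorem contDiff_cauchyTransform (hc : HasCompactSupport f) (hf : ContDiff ℝ 1 f) :
    ContDiff ℝ 1 (cauchyTransform f) :=
  hc.contDiff_convolution_right (n := 1) (ContinuousLinearMap.lsmul ℝ ℂ)
    locallyIntegrable_cauchyKernel hf


/-- The Cauchy transform is a right inverse of `dbar`. -/
theorem dbar_cauchyTransform [CompleteSpace E] (hc : HasCompactSupport f) (hf : ContDiff ℝ 1 f)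
    (z : ℂ) : dbar (cauchyTransform f) z = f z := by
  have hcf := hc.fderiv ℝ
  have hcont : Continuous (fderiv ℝ f) := hf.continuous_fderiv one_ne_zero
  -- the unit vectors of polar coordinates
  set u : ℝ → ℂ := fun θ => Real.cos θ + Real.sin θ * Complex.I with hu
  have hu_cont : Continuous u := by fun_prop
  have hu_norm : ∀ θ, ‖u θ‖ = 1 := fun θ => by
    simp only [hu, Complex.ofReal_cos, Complex.ofReal_sin]; exact Complex.norm_cos_add_sin_mul_I θ
  have hu_ne : ∀ θ, u θ ≠ 0 := fun θ h => by simpa [h] using hu_norm θ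
  have hu_deriv : ∀ θ, HasDerivAt u (Complex.I * u θ) θ := by
    intro θ
    have h1 := (Real.hasDerivAt_cos θ).ofReal_comp
    have h2 := ((Real.hasDerivAt_sin θ).ofReal_comp).mul_const Complex.I
    refine (h1.add h2).congr_deriv ?_
    simp only [hu]
    push_cast
    linear_combination -Complex.sin θ * Complex.I_mul_I
  -- `P` and `Q` are the derivatives of `f` in the radial and the angular unit direction. In polar
  -- coordinates the Jacobian r cancels the singularity of the kernel, and only these two terms
  -- remain to be integrated.
  set P : ℝ × ℝ → E := fun p => fderiv ℝ f (z - p.1 * u p.2) (u p.2) with hP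
  set Q : ℝ × ℝ → E := fun p => fderiv ℝ f (z - p.1 * u p.2) (Complex.I * u p.2) with hQ
  have hpt_cont : Continuous fun p : ℝ × ℝ => z - p.1 * u p.2 := by fun_prop
  have hP_cont : Continuous P := (hcont.comp hpt_cont).clm_apply (by fun_prop)
  have hQ_cont : Continuous Q := (hcont.comp hpt_cont).clm_apply (by fun_prop)
  obtain ⟨R, hR0, hR⟩ : ∃ R : ℝ, 0 < R ∧ ∀ r θ : ℝ, R ≤ r → z - r * u θ ∉ tsupport f := by
    obtain ⟨R, hR⟩ := hc.isCompact.isBounded.subset_closedBall z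
    refine ⟨max R 0 + 1, by positivity, fun r θ hr hmem => ?_⟩
    have := hR hmem
    rw [Metric.mem_closedBall, dist_eq_norm] at this
    have h1 : ‖z - r * u θ - z‖ = |r| := by
      rw [sub_sub_cancel_left, norm_neg, norm_mul, hu_norm]; simp
    rw [h1] at this
    have := (le_abs_self r).trans this
    have := le_max_left R 0
    linarith
  have hf0 : ∀ r θ : ℝ, R ≤ r → f (z - r * u θ) = 0 := fun r θ hr =>
    image_eq_zero_of_notMem_tsupport (hR r θ hr)
  have hDf0 : ∀ r θ : ℝ, R ≤ r → fderiv ℝ f (z - r * u θ) = 0 := fun r θ hr =>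
    image_eq_zero_of_notMem_tsupport fun h => hR r θ hr (tsupport_fderiv_subset ℝ h)
  have hint : ∀ G : ℝ × ℝ → E, Continuous G → (∀ r θ, R ≤ r → G (r, θ) = 0) →
      Integrable G ((volume.restrict (Ioi 0)).prod (volume.restrict (Ioo (-Real.pi) Real.pi))) := by
    intro G hG hG0
    rw [Measure.prod_restrict]
    have h1 : IntegrableOn G (Icc 0 R ×ˢ Icc (-Real.pi) Real.pi) (volume.prod volume) :=
      hG.continuousOn.integrableOn_compact (isCompact_Icc.prod isCompact_Icc)
    refine (integrableOn_iff_integrable_of_support_subset (s := Icc 0 R ×ˢ Icc (-Real.pi) Real.pi)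
      (f := (Ioi (0 : ℝ) ×ˢ Ioo (-Real.pi) Real.pi).indicator G) ?_).1 ?_ |> fun h =>
        (integrable_indicator_iff (measurableSet_Ioi.prod measurableSet_Ioo)).1 h
    · intro p hp
      have hp1 : p ∈ Ioi (0 : ℝ) ×ˢ Ioo (-Real.pi) Real.pi := by
        by_contra hcon; exact hp (indicator_of_notMem hcon _)
      have hp2 : G p ≠ 0 := by
        intro h; exact hp (by rw [indicator_of_mem hp1, h])
      refine ⟨⟨hp1.1.le, ?_⟩, hp1.2.1.le, hp1.2.2.le⟩
      by_contra hcon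
      exact hp2 (hG0 _ _ (not_le.1 hcon).le)
    · exact h1.indicator (measurableSet_Ioi.prod measurableSet_Ioo)
  -- On each ray the radial derivative integrates to the value at r = 0, since `f` vanishes far out.
  have hPi : ∀ θ, ∫ r in Ioi (0 : ℝ), P (r, θ) = f z := by
    intro θ
    have hd : ∀ r : ℝ, HasDerivAt (fun r : ℝ => -f (z - r * u θ)) (P (r, θ)) r := by
      intro r
      have h1 : HasDerivAt (fun r : ℝ => z - r * u θ) (-(1 * u θ)) r := by
        simpa using ((Complex.ofRealCLM.hasDerivAt (x := r)).mul_const (u θ)).const_sub z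
      have h2 := ((hf.differentiable one_ne_zero (z - r * u θ)).hasFDerivAt.comp_hasDerivAt r h1).neg
      refine h2.congr_deriv ?_
      simp [hP]
    have h1 := integral_Ioi_of_hasDerivAt_of_tendsto (a := (0 : ℝ))
      (f := fun r : ℝ => -f (z - r * u θ)) (m := 0)
      (f' := fun r => P (r, θ)) ((hd 0).continuousAt.continuousWithinAt) (fun r _ => hd r) ?_ ?_
    · simpa using h1
    · have h2 : IntegrableOn (fun r => P (r, θ)) (Icc 0 R) :=
        (hP_cont.comp (by fun_prop : Continuous fun r : ℝ => (r, θ))).continuousOn.integrableOn_compact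
          isCompact_Icc
      refine h2.of_forall_sdiff_eq_zero measurableSet_Ioi fun r hr => ?_
      have : R ≤ r := by
        by_contra hcon
        exact hr.2 ⟨(mem_Ioi.1 hr.1).le, (not_le.1 hcon).le⟩
      simp [hP, hDf0 r θ this]
    · refine tendsto_const_nhds.congr' ?_
      filter_upwards [eventually_ge_atTop R] with r hr
      simp [hf0 r θ hr]
  -- For fixed r > 0 the integrand is the θ-derivative of a 2π-periodic function.
  have hQi : ∀ r ∈ Ioi (0 : ℝ), ∫ θ in Ioo (-Real.pi) Real.pi, Q (r, θ) = 0 := by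
    intro r hr
    have hr0 : r ≠ 0 := (mem_Ioi.1 hr).ne'
    have hd : ∀ θ : ℝ, HasDerivAt (fun θ : ℝ => -(r⁻¹ • f (z - r * u θ))) (Q (r, θ)) θ := by
      intro θ
      have h1 : HasDerivAt (fun θ : ℝ => z - r * u θ) (-(r * (Complex.I * u θ))) θ := by
        simpa using ((hu_deriv θ).const_mul (r : ℂ)).const_sub z
      have h2 := (((hf.differentiable one_ne_zero (z - r * u θ)).hasFDerivAt.comp_hasDerivAt θ
        h1).const_smul r⁻¹).neg
      refine h2.congr_deriv ?_
      have : (r : ℂ) * (Complex.I * u θ) = r • (Complex.I * u θ) := by simp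
      rw [this, map_neg, map_smul, smul_neg, neg_neg, smul_smul, inv_mul_cancel₀ hr0, one_smul]
    rw [← integral_Ioc_eq_integral_Ioo, ← intervalIntegral.integral_of_le (by linarith [Real.pi_pos]),
      intervalIntegral.integral_eq_sub_of_hasDerivAt (fun θ _ => hd θ)
        ((hQ_cont.comp (by fun_prop : Continuous fun θ : ℝ => (r, θ))).intervalIntegrable _ _)]
    simp [hu]
  have hker : dbar (cauchyTransform f) z = ∫ w, cauchyKernel w • dbar f (z - w) := by
    have h := (hasFDerivAt_cauchyTransform hc hf z).fderiv
    have hI : Integrable fun w => cauchyKernel w • fderiv ℝ f (z - w) :=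
      hcf.convolutionExists_right (ContinuousLinearMap.lsmul ℝ ℂ) locallyIntegrable_cauchyKernel
        hcont z
    rw [dbar, h, cauchyTransform_apply, ContinuousLinearMap.integral_apply hI,
      ContinuousLinearMap.integral_apply hI, ← integral_smul, ← integral_add]
    · refine integral_congr_ae (Eventually.of_forall fun w => ?_)
      simp [dbar, smul_add, smul_smul, mul_comm]
    · exact hI.apply_continuousLinearMap 1
    · exact (hI.apply_continuousLinearMap Complex.I).smul Complex.I
  rw [hker, ← Complex.integral_comp_polarCoord_symm, polarCoord_target]
  have hfun : ∀ p ∈ Ioi (0 : ℝ) ×ˢ Ioo (-Real.pi) Real.pi,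
      p.1 • (cauchyKernel (Complex.polarCoord.symm p) • dbar f (z - Complex.polarCoord.symm p)) =
        (2 * Real.pi : ℂ)⁻¹ • (P p + Complex.I • Q p) := by
    rintro ⟨r, θ⟩ ⟨hr, -⟩
    have hr0 : (r : ℂ) ≠ 0 := by exact_mod_cast (mem_Ioi.1 hr).ne'
    have hsym : Complex.polarCoord.symm (r, θ) = r * u θ := by simp [hu]
    -- Writing ∂̄ in the rotated orthonormal frame produces the phase u(θ), which cancels the phase
    -- of the kernel.
    have hrot : dbar f (z - r * u θ) = u θ • (P (r, θ) + Complex.I • Q (r, θ)) := by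
      have hsc := Complex.cos_sq_add_sin_sq θ
      have hP' : P (r, θ) = (Real.cos θ : ℂ) • fderiv ℝ f (z - r * u θ) 1 +
          (Real.sin θ : ℂ) • fderiv ℝ f (z - r * u θ) Complex.I := by
        have : u θ = Real.cos θ • (1 : ℂ) + Real.sin θ • Complex.I := by simp [hu]
        simp only [hP]
        conv_lhs => arg 2; rw [this]
        rw [map_add, map_smul, map_smul, Complex.coe_smul, Complex.coe_smul]
      have hQ' : Q (r, θ) = (Real.cos θ : ℂ) • fderiv ℝ f (z - r * u θ) Complex.I -
          (Real.sin θ : ℂ) • fderiv ℝ f (z - r * u θ) 1 := by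
        have : Complex.I * u θ = Real.cos θ • Complex.I - Real.sin θ • (1 : ℂ) := by
          simp only [hu, Complex.real_smul, mul_add]
          linear_combination (Real.sin θ : ℂ) * Complex.I_mul_I
        simp only [hQ]
        rw [this, map_sub, map_smul, map_smul, Complex.coe_smul, Complex.coe_smul]
      rw [hP', hQ', dbar]
      simp only [hu, Complex.ofReal_cos, Complex.ofReal_sin]
      match_scalars
      · linear_combination -hsc + Complex.sin θ ^ 2 * Complex.I_mul_I
      · linear_combination -Complex.I * hsc - Complex.cos θ * Complex.sin θ * Complex.I_mul_I
    rw [hsym, hrot]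
    simp only [cauchyKernel]
    rw [smul_smul, ← Complex.coe_smul, smul_smul]
    congr 1
    have := hu_ne θ
    have hpi : (Real.pi : ℂ) ≠ 0 := by exact_mod_cast Real.pi_ne_zero
    field_simp
  rw [setIntegral_congr_fun (measurableSet_Ioi.prod measurableSet_Ioo) hfun, integral_smul,
    Measure.volume_eq_prod, ← Measure.prod_restrict]
  have hPint := hint P hP_cont fun r θ hr => by simp [hP, hDf0 r θ hr]
  have hQint := hint Q hQ_cont fun r θ hr => by simp [hQ, hDf0 r θ hr]
  rw [integral_add hPint (g := fun p => Complex.I • Q p) (hQint.smul Complex.I), integral_smul, integral_prod_symm P hPint,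
    integral_prod Q hQint]
  rw [setIntegral_congr_fun (g := fun _ => (0 : E)) measurableSet_Ioi hQi]
  simp only [hPi, integral_zero, smul_zero, add_zero, setIntegral_const]
  have hvol : (volume : Measure ℝ).real (Ioo (-Real.pi) Real.pi) = 2 * Real.pi := by
    rw [Real.volume_real_Ioo_of_le (by linarith [Real.pi_pos])]; ring
  rw [hvol, ← Complex.coe_smul, smul_smul]
  have hpi : (Real.pi : ℂ) ≠ 0 := by exact_mod_cast Real.pi_ne_zero
  push_cast
  rw [inv_mul_cancel₀ (by simp), one_smul]

end CauchyTransform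

/-! ### Solving ∂̄H = HA near a point. -/

section CauchyRiemannSystems

open MeasureTheory Set Filter

variable {𝔸 : Type*} [NormedRing 𝔸] [NormedAlgebra ℂ 𝔸] [CompleteSpace 𝔸] [NormOneClass 𝔸]

/-- The iterates in the Neumann series solving `dbar H = H * a`. -/
def neumannTerm (a : ℂ → 𝔸) : ℕ → ℂ → 𝔸
  | 0 => 1
  | n + 1 => cauchyTransform (neumannTerm a n * a)

variable (𝔸) in
/-- The system `dbar H = H * a` has a solution close to `1` if `a` is `C¹`-small. -/
theorem exists_dbar_eq_mul_of_small :
    ∃ ε : ℝ, 0 < ε ∧ ∀ a : ℂ → 𝔸, ContDiff ℝ 1 a → (∀ z, 2 < ‖z‖ → a z = 0) → (∀ z, ‖a z‖ ≤ ε) →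
      (∀ z, ‖fderiv ℝ a z‖ ≤ ε) →
      ∃ H : ℂ → 𝔸, ContDiff ℝ 1 H ∧ (∀ z, ‖H z - 1‖ < 1) ∧ ∀ z, dbar H z = H z * a z := by
  obtain ⟨C, hC, hCle⟩ := exists_norm_cauchyTransform_le
  -- Each iteration multiplies the bounds by C times the bound for `a`. The Leibniz rule doubles
  -- this for derivatives, and 2C · 1/(8C) = 1/4 is the ratio of the geometric bounds below.
  refine ⟨1 / (8 * C), by positivity, fun a ha ha0 hab hab' => ?_⟩
  set ε := 1 / (8 * C) with hε
  have hε0 : 0 < ε := by positivity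
  have hac : HasCompactSupport a := HasCompactSupport.intro (isCompact_closedBall (0 : ℂ) 2)
    fun z hz => ha0 z (by simpa using hz)
  set h : ℕ → ℂ → 𝔸 := neumannTerm a with hh
  have hmulc : ∀ n, HasCompactSupport (h n * a) := fun n => hac.mul_left
  have hcd : ∀ n, ContDiff ℝ 1 (h n) := by
    intro n
    induction n with
    | zero => exact contDiff_const (c := (1 : 𝔸))
    | succ n ih => exact contDiff_cauchyTransform (hmulc n) (ih.mul ha)
  have hb : ∀ n, (∀ z, ‖h n z‖ ≤ (1 / 4) ^ n) ∧ ∀ z, ‖fderiv ℝ (h n) z‖ ≤ (1 / 4) ^ n := by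
    intro n
    induction n with
    | zero =>
      have h0 : h 0 = fun _ => 1 := rfl
      constructor
      · intro z; simp [h0]
      · intro z; simp [h0]
    | succ n ih =>
      have hmul : ContDiff ℝ 1 (h n * a) := (hcd n).mul ha
      have h0 : ∀ z, 2 < ‖z‖ → (h n * a) z = 0 := fun z hz => by simp [ha0 z hz]
      constructor
      · intro z
        have h1 := hCle 𝔸 (h n * a) ((1 / 4) ^ n * ε) (fun z =>
          (norm_mul_le _ _).trans (mul_le_mul (ih.1 z) (hab z) (norm_nonneg _) (by positivity))) h0 z
        refine h1.trans ?_
        rw [pow_succ, hε]; field_simp; norm_num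
      · intro z
        have hd : fderiv ℝ (h (n + 1)) z = _ := (hasFDerivAt_cauchyTransform (hmulc n) hmul z).fderiv
        rw [hd]
        have h1 := hCle (ℂ →L[ℝ] 𝔸) (fderiv ℝ (h n * a)) (2 * ((1 / 4) ^ n * ε)) ?_ ?_ z
        · refine h1.trans ?_
          rw [pow_succ, hε]; field_simp; norm_num
        · intro w
          refine ContinuousLinearMap.opNorm_le_bound _ (by positivity) fun v => ?_
          rw [fderiv_mul' ((hcd n).differentiable one_ne_zero w) (ha.differentiable one_ne_zero w)]
          simp only [add_apply, smul_apply, smul_eq_mul,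
            MulOpposite.smul_eq_mul_unop, MulOpposite.unop_op]
          refine (norm_add_le _ _).trans ?_
          have e1 : ‖h n w * fderiv ℝ a w v‖ ≤ (1 / 4) ^ n * (ε * ‖v‖) :=
            (norm_mul_le _ _).trans (mul_le_mul (ih.1 w) ((fderiv ℝ a w).le_of_opNorm_le (hab' w) v)
              (norm_nonneg _) (by positivity))
          have e2 : ‖fderiv ℝ (h n) w v * a w‖ ≤ ((1 / 4) ^ n * ‖v‖) * ε :=
            (norm_mul_le _ _).trans (mul_le_mul ((fderiv ℝ (h n) w).le_of_opNorm_le (ih.2 w) v)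
              (hab w) (norm_nonneg _) (by positivity))
          linarith
        · intro w hw
          have : (h n * a) =ᶠ[𝓝 w] fun _ => 0 := by
            filter_upwards [(isOpen_lt continuous_const continuous_norm).mem_nhds hw] with v hv
            exact h0 v hv
          rw [this.fderiv_eq]; simp
  have hsum : Summable fun n : ℕ => ((1 : ℝ) / 4) ^ n :=
    summable_geometric_of_lt_one (by norm_num) (by norm_num)
  have hsz : ∀ z, Summable fun n => h n z := fun z =>
    Summable.of_norm_bounded hsum fun n => (hb n).1 z
  have hsd : ∀ z, Summable fun n => fderiv ℝ (h n) z := fun z =>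
    Summable.of_norm_bounded hsum fun n => (hb n).2 z
  refine ⟨fun z => ∑' n, h n z, ?_, ?_, ?_⟩
  · refine contDiff_tsum (N := 1) (v := fun _ n => (1 / 4) ^ n) hcd (fun _ _ => hsum) ?_
    intro k n x hk
    have hk' : k ≤ 1 := by exact_mod_cast hk
    interval_cases k
    · rw [norm_iteratedFDeriv_zero]; exact (hb n).1 x
    · rw [norm_iteratedFDeriv_one]; exact (hb n).2 x
  · intro z
    beta_reduce
    rw [(hsz z).tsum_eq_zero_add]
    have h0 : h 0 z = 1 := rfl
    rw [h0, add_sub_cancel_left]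
    have hsum' := (summable_nat_add_iff 1).2 hsum
    -- Without the constant first term, the bounds sum to 1/4 + 1/16 + ... = 1/3.
    refine (tsum_of_norm_bounded hsum'.hasSum fun n => (hb (n + 1)).1 z).trans_lt ?_
    simp_rw [pow_succ]
    rw [tsum_mul_right, tsum_geometric_of_lt_one (by norm_num) (by norm_num)]
    norm_num
  · intro z
    -- Since the Cauchy transform inverts ∂̄, applying ∂̄ shifts the series by one index. The
    -- constant first term contributes nothing.
    have hdb : ∀ n, dbar (h (n + 1)) z = h n z * a z := fun n =>
      dbar_cauchyTransform (hmulc n) ((hcd n).mul ha) z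
    have hfd : fderiv ℝ (fun z => ∑' n, h n z) z = ∑' n, fderiv ℝ (h n) z :=
      fderiv_tsum_apply hsum (fun n => (hcd n).differentiable one_ne_zero) (fun n => (hb n).2)
        (hsz 0) z
    have happ : ∀ v, HasSum (fun n => fderiv ℝ (h n) z v) ((∑' n, fderiv ℝ (h n) z) v) := fun v =>
      (hsd z).hasSum.mapL (ContinuousLinearMap.apply ℝ 𝔸 v)
    have hs : HasSum (fun n => dbar (h n) z) (dbar (fun z => ∑' n, h n z) z) := by
      unfold dbar
      rw [hfd]
      exact (happ 1).add ((happ Complex.I).const_smul Complex.I)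
    have hs0 : dbar (h 0) z = 0 := by
      have h0 : h 0 = fun _ => 1 := rfl
      simp [dbar, h0]
    rw [← hs.tsum_eq, hs.summable.tsum_eq_zero_add, hs0, zero_add]
    simp_rw [hdb]
    rw [(hsz z).tsum_mul_right]

/-- The system `dbar H = H * A` has a local solution with prescribed value `1` at a point. -/
theorem exists_dbar_eq_mul {A : ℂ → 𝔸} {p : ℂ} (hA : ContDiffAt ℝ 1 A p) :
    ∃ H : ℂ → 𝔸, ContDiff ℝ 1 H ∧ H p = 1 ∧ ∀ᶠ z in 𝓝 p, dbar H z = H z * A z := by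
  obtain ⟨ε, hε, hsol⟩ := exists_dbar_eq_mul_of_small 𝔸
  -- a cutoff function and its bounds
  let χ : ContDiffBump (0 : ℂ) := ⟨1, 2, one_pos, one_lt_two⟩
  have hχ : ContDiff ℝ 1 χ := χ.contDiff
  obtain ⟨K, hK⟩ : ∃ K, ∀ z, ‖fderiv ℝ χ z‖ ≤ K :=
    (χ.hasCompactSupport.fderiv ℝ).exists_bound_of_continuous (hχ.continuous_fderiv one_ne_zero)
  have hK0 : 0 ≤ K := (norm_nonneg _).trans (hK 0)
  -- bounds for the coefficient near `p`
  obtain ⟨ρ, hρ, hAρ⟩ : ∃ ρ > 0, ∀ z ∈ Metric.ball p ρ, ContDiffAt ℝ 1 A z := by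
    have := hA.eventually (by simp)
    exact Metric.eventually_nhds_iff_ball.1 this
  obtain ⟨M, hM⟩ : ∃ M, ∀ᶠ z in 𝓝 p, ‖A z‖ ≤ M ∧ ‖fderiv ℝ A z‖ ≤ M := by
    refine ⟨max (‖A p‖ + 1) (‖fderiv ℝ A p‖ + 1), ?_⟩
    have h1 : ∀ᶠ z in 𝓝 p, ‖A z‖ < ‖A p‖ + 1 :=
      hA.continuousAt.norm.eventually (gt_mem_nhds (lt_add_one _))
    have h2 : ∀ᶠ z in 𝓝 p, ‖fderiv ℝ A z‖ < ‖fderiv ℝ A p‖ + 1 :=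
      (hA.continuousAt_fderiv one_ne_zero).norm.eventually (gt_mem_nhds (lt_add_one _))
    filter_upwards [h1, h2] with z h1 h2
    exact ⟨h1.le.trans (le_max_left _ _), h2.le.trans (le_max_right _ _)⟩
  obtain ⟨ρ', hρ', hMρ⟩ := Metric.eventually_nhds_iff_ball.1 hM
  have hM0 : 0 ≤ M := (norm_nonneg _).trans (hMρ p (Metric.mem_ball_self hρ')).1
  -- In the variable z ↦ p + rz the coefficient gains a factor r, so it becomes small in C¹. Points
  -- with |z| < 3 land in the ball of radius 4r, where the bounds for `A` hold. The last condition
  -- accounts for the derivative `K` of the cutoff.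
  obtain ⟨r, hr0, hr1, hrρ, hrρ', hrM⟩ : ∃ r : ℝ, 0 < r ∧ r ≤ 1 ∧ 4 * r ≤ ρ ∧ 4 * r ≤ ρ' ∧
      r * (M + K * M) ≤ ε := by
    refine ⟨min (min 1 (min (ρ / 4) (ρ' / 4))) (ε / (M + K * M + 1)), by positivity, ?_, ?_, ?_, ?_⟩
    · exact (min_le_left _ _).trans (min_le_left _ _)
    · have := (min_le_left (min 1 (min (ρ / 4) (ρ' / 4))) (ε / (M + K * M + 1))).trans
        ((min_le_right _ _).trans (min_le_left _ _))
      linarith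
    · have := (min_le_left (min 1 (min (ρ / 4) (ρ' / 4))) (ε / (M + K * M + 1))).trans
        ((min_le_right _ _).trans (min_le_right _ _))
      linarith
    · have := min_le_right (min 1 (min (ρ / 4) (ρ' / 4))) (ε / (M + K * M + 1))
      calc _ ≤ (ε / (M + K * M + 1)) * (M + K * M) := by gcongr
        _ ≤ (ε / (M + K * M + 1)) * (M + K * M + 1) := mul_le_mul_of_nonneg_left (by linarith) (by positivity)
        _ = ε := by field_simp
  have hmem : ∀ z : ℂ, ‖z‖ < 3 → p + r * z ∈ Metric.ball p (4 * r) := by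
    intro z hz
    rw [Metric.mem_ball, dist_eq_norm, add_sub_cancel_left, norm_mul, Complex.norm_real,
      Real.norm_eq_abs, abs_of_pos hr0]
    nlinarith
  set B : ℂ → 𝔸 := fun z => (r : ℂ) • A (p + r * z) with hB
  have haff : ∀ z : ℂ, HasFDerivAt (fun z : ℂ => p + r * z) ((r : ℂ) • ContinuousLinearMap.id ℝ ℂ) z := by
    intro z
    exact ((hasFDerivAt_id z).const_mul (r : ℂ)).const_add p
  have hBd : ∀ z : ℂ, ‖z‖ < 3 → ContDiffAt ℝ 1 B z := by
    intro z hz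
    refine ContDiffAt.const_smul _ (ContDiffAt.comp z (g := A) ?_ (by fun_prop))
    exact hAρ _ (Metric.ball_subset_ball hrρ (hmem z hz))
  have hBb : ∀ z : ℂ, ‖z‖ < 3 → ‖B z‖ ≤ r * M ∧ ‖fderiv ℝ B z‖ ≤ r * M := by
    intro z hz
    have hz' := hMρ _ (Metric.ball_subset_ball hrρ' (hmem z hz))
    have hrn : ‖(r : ℂ)‖ = r := by simp [abs_of_pos hr0]
    constructor
    · rw [hB, norm_smul, hrn]
      exact mul_le_mul_of_nonneg_left hz'.1 hr0.le
    · have hd : HasFDerivAt B ((r : ℂ) • (fderiv ℝ A (p + r * z) ∘L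
          ((r : ℂ) • ContinuousLinearMap.id ℝ ℂ))) z := by
        refine HasFDerivAt.const_smul (HasFDerivAt.comp z (g := A) ?_ (haff z)) (r : ℂ)
        exact ((hAρ _ (Metric.ball_subset_ball hrρ (hmem z hz))).differentiableAt
          one_ne_zero).hasFDerivAt
      rw [hd.fderiv, norm_smul, hrn]
      refine mul_le_mul_of_nonneg_left ?_ hr0.le
      refine (ContinuousLinearMap.opNorm_comp_le _ _).trans ?_
      have : ‖(r : ℂ) • ContinuousLinearMap.id ℝ ℂ‖ ≤ 1 := by
        rw [norm_smul, hrn]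
        exact mul_le_one₀ hr1 (norm_nonneg _) ContinuousLinearMap.norm_id_le
      calc _ ≤ M * 1 := mul_le_mul hz'.2 this (norm_nonneg _) hM0
        _ = M := mul_one M
  set a : ℂ → 𝔸 := fun z => χ z • B z with ha
  have ha0 : ∀ z, 2 < ‖z‖ → a z = 0 := by
    intro z hz
    have : χ z = 0 := χ.zero_of_le_dist (by simpa using hz.le)
    simp [ha, this]
  have ha0' : ∀ z, 2 < ‖z‖ → a =ᶠ[𝓝 z] fun _ => 0 := by
    intro z hz
    filter_upwards [(isOpen_lt continuous_const continuous_norm).mem_nhds hz] with v hv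
    exact ha0 v hv
  have hrM' : r * M ≤ ε := by nlinarith [mul_nonneg hr0.le (mul_nonneg hK0 hM0)]
  have ha1 : ContDiff ℝ 1 a := by
    refine contDiff_iff_contDiffAt.2 fun z => ?_
    by_cases hz : ‖z‖ < 3
    · exact hχ.contDiffAt.smul (hBd z hz)
    · exact contDiffAt_const.congr_of_eventuallyEq (ha0' z (by push Not at hz; linarith))
  have hab : ∀ z, ‖a z‖ ≤ ε := by
    intro z
    by_cases hz : ‖z‖ < 3
    · rw [ha, norm_smul]
      calc _ ≤ 1 * (r * M) := by
            refine mul_le_mul ?_ (hBb z hz).1 (norm_nonneg _) zero_le_one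
            rw [Real.norm_eq_abs, abs_of_nonneg χ.nonneg]; exact χ.le_one
        _ ≤ ε := by linarith
    · rw [ha0 z (by push Not at hz; linarith)]; simpa using hε.le
  have hab' : ∀ z, ‖fderiv ℝ a z‖ ≤ ε := by
    intro z
    by_cases hz : ‖z‖ < 3
    · rw [ha]
      have hd := (hχ.differentiable one_ne_zero z).hasFDerivAt.smul
        ((hBd z hz).differentiableAt one_ne_zero).hasFDerivAt
      have : fderiv ℝ (fun z => χ z • B z) z = _ := hd.fderiv
      rw [this]
      have hχn : ‖χ z‖ ≤ 1 := by
        rw [Real.norm_eq_abs, abs_of_nonneg χ.nonneg]; exact χ.le_one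
      calc _ ≤ ‖χ z • fderiv ℝ B z‖ + ‖(fderiv ℝ χ z).smulRight (B z)‖ := norm_add_le _ _
        _ ≤ 1 * (r * M) + K * (r * M) := by
          rw [norm_smul, ContinuousLinearMap.norm_smulRight_apply]
          exact add_le_add (mul_le_mul hχn (hBb z hz).2 (norm_nonneg _) zero_le_one)
            (mul_le_mul (hK z) (hBb z hz).1 (norm_nonneg _) hK0)
        _ ≤ ε := by linarith
    · rw [(ha0' z (by push Not at hz; linarith)).fderiv_eq]; simpa using hε.le
  obtain ⟨H, hH, hH1, hHd⟩ := hsol a ha1 ha0 hab hab'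
  -- undo the rescaling
  set G : ℂ → 𝔸 := fun z => H ((z - p) / r) with hG
  have hrC : (r : ℂ) ≠ 0 := by exact_mod_cast hr0.ne'
  have hGd : ContDiff ℝ 1 G := hH.comp (by fun_prop)
  -- `H 0` is at distance less than 1 from the identity. Left multiplication by its inverse respects
  -- the equation and normalises the value at p.
  have hu : IsUnit (H 0) := by
    have h1 := isUnit_one_sub_of_norm_lt_one (x := 1 - H 0) (by
      rw [norm_sub_rev]; exact hH1 0)
    simpa using h1
  obtain ⟨q, hq⟩ := hu
  refine ⟨fun z => (↑q⁻¹ : 𝔸) * G z, contDiff_const.mul hGd, ?_, ?_⟩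
  · simp [hG, ← hq]
  · filter_upwards [Metric.ball_mem_nhds p hr0] with z hz
    have hz1 : ‖(z - p) / r‖ ≤ 1 := by
      rw [norm_div, Complex.norm_real, Real.norm_eq_abs, abs_of_pos hr0]
      rw [Metric.mem_ball, dist_eq_norm] at hz
      exact (div_le_one hr0).2 hz.le
    have hχ1 : χ ((z - p) / r) = 1 := χ.one_of_mem_closedBall (by simpa using hz1)
    have hdG : HasFDerivAt G (fderiv ℝ H ((z - p) / r) ∘L
        ((r : ℂ)⁻¹ • ContinuousLinearMap.id ℝ ℂ)) z := by
      refine HasFDerivAt.comp z (g := H) (hH.differentiable one_ne_zero _).hasFDerivAt ?_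
      have := ((hasFDerivAt_id (𝕜 := ℝ) z).sub_const p).const_mul ((r : ℂ)⁻¹)
      refine this.congr_of_eventuallyEq (Eventually.of_forall fun w => ?_)
      simp [div_eq_inv_mul]
    have hdG' : ∀ v, fderiv ℝ (fun z => (↑q⁻¹ : 𝔸) * G z) z v =
        (r⁻¹ : ℂ) • ((↑q⁻¹ : 𝔸) * fderiv ℝ H ((z - p) / r) v) := by
      intro v
      rw [(hdG.const_mul (↑q⁻¹ : 𝔸)).fderiv]
      simp only [smul_apply, ContinuousLinearMap.comp_apply,
        ContinuousLinearMap.id_apply, smul_eq_mul]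
      have : (r : ℂ)⁻¹ * v = r⁻¹ • v := by simp
      rw [this, map_smul, mul_smul_comm, ← Complex.coe_smul]
      simp
    have hdb : dbar (fun z => (↑q⁻¹ : 𝔸) * G z) z =
        (r⁻¹ : ℂ) • ((↑q⁻¹ : 𝔸) * dbar H ((z - p) / r)) := by
      simp only [dbar, hdG', mul_add, smul_add, mul_smul_comm]
      rw [smul_comm]
    rw [hdb, hHd, ha]
    simp only [hχ1, one_smul, hB, hG]
    rw [mul_div_cancel₀ _ hrC, add_sub_cancel, mul_smul_comm, mul_smul_comm, smul_smul,
      inv_mul_cancel₀ hrC, one_smul, mul_assoc]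

end CauchyRiemannSystems

/-! ### Zeros of solutions and removable singularities of Riccati equations. -/

section Singularities

open Set Filter

variable {V : Type*} [NormedAddCommGroup V] [NormedSpace ℂ V]

/-- Leibniz rule. It holds for ∂̄ because the values of `H` are complex linear, so the factor i
passes through them. -/
theorem dbar_clm_apply {H : ℂ → V →L[ℂ] V} {f : ℂ → V} {z : ℂ} (hH : DifferentiableAt ℝ H z)
    (hf : DifferentiableAt ℝ f z) :
    dbar (fun z => H z (f z)) z = dbar H z (f z) + H z (dbar f z) := by
  have h1 : HasFDerivAt (fun z => (ContinuousLinearMap.restrictScalarsL ℂ V V ℝ ℝ) (H z))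
      (((ContinuousLinearMap.restrictScalarsL ℂ V V ℝ ℝ)) ∘L fderiv ℝ H z) z :=
    (ContinuousLinearMap.restrictScalarsL ℂ V V ℝ ℝ).hasFDerivAt.comp z hH.hasFDerivAt
  have h2 : HasFDerivAt (fun z => H z (f z)) _ z := h1.clm_apply hf.hasFDerivAt
  simp only [dbar, h2.fderiv]
  simp
  abel

theorem differentiableAt_of_dbar_eq_zero {f : ℂ → V} {z : ℂ} (hf : DifferentiableAt ℝ f z)
    (h : dbar f z = 0) : DifferentiableAt ℂ f z := by
  refine differentiableAt_complex_iff_differentiableAt_real.2 ⟨hf, ?_⟩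
  have h1 := congrArg (fun v => Complex.I • v) h
  simp only [dbar, smul_add, smul_smul, Complex.I_mul_I, neg_smul, one_smul, smul_zero] at h1
  rw [add_neg_eq_zero] at h1
  exact h1.symm

theorem contDiffAt_inverse_apply [CompleteSpace V] {H : ℂ → V →L[ℂ] V} {f : ℂ → V} {p : ℂ}
    (hH : ContDiffAt ℝ 1 H p) (hp : H p = 1) (hf : ContDiffAt ℝ 1 f p) :
    ContDiffAt ℝ 1 (fun z => Ring.inverse (H z) (f z)) p := by
  have h1 : ContDiffAt ℝ 1 (fun z => Ring.inverse (H z)) p := by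
    have h0 : ContDiffAt ℝ 1 (Ring.inverse : (V →L[ℂ] V) → V →L[ℂ] V) (H p) := by
      rw [hp]
      exact contDiffAt_ringInverse ℝ (1 : (V →L[ℂ] V)ˣ)
    exact h0.comp p hH
  have h2 : ContDiffAt ℝ 1 (fun z =>
      (ContinuousLinearMap.restrictScalarsL ℂ V V ℝ ℝ) (Ring.inverse (H z))) p :=
    ContDiffAt.comp p (ContinuousLinearMap.restrictScalarsL ℂ V V ℝ ℝ).contDiff.contDiffAt h1
  exact h2.clm_apply hf

theorem eventually_isUnit [CompleteSpace V] {H : ℂ → V →L[ℂ] V} {p : ℂ}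
    (hH : ContinuousAt H p) (hp : H p = 1) : ∀ᶠ z in 𝓝 p, IsUnit (H z) := by
  refine hH.eventually ?_
  rw [hp]
  exact Units.isOpen.mem_nhds isUnit_one

/-- Solutions of a Cauchy–Riemann system are powers of the coordinate times a nonvanishing `C¹`
function. -/
theorem exists_pow_smul_of_dbar [CompleteSpace V] [Nontrivial V] {M : ℂ → V →L[ℂ] V} {f : ℂ → V}
    {p : ℂ} (hM : ContDiffAt ℝ 1 M p)
    (hf : ∀ᶠ z in 𝓝 p, DifferentiableAt ℝ f z ∧ dbar f z = -M z (f z))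
    (hf0 : ∀ᶠ z in 𝓝[≠] p, f z ≠ 0) :
    ∃ (n : ℕ) (ψ : ℂ → V), ContDiffAt ℝ 1 ψ p ∧ ψ p ≠ 0 ∧ ∀ᶠ z in 𝓝 p, f z = (z - p) ^ n • ψ z := by
  obtain ⟨H, hH, hHp, hHd⟩ := exists_dbar_eq_mul hM
  have hHu := eventually_isUnit hH.continuous.continuousAt hHp
  -- The integrating factor: ∂̄(Hf) = HMf - HMf = 0. The order of vanishing of this holomorphic
  -- function is carried back to `f` by H⁻¹.
  set h : ℂ → V := fun z => H z (f z) with hh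
  have hhol : ∀ᶠ z in 𝓝 p, DifferentiableAt ℂ h z := by
    filter_upwards [hf, hHd] with z hz hz'
    refine differentiableAt_of_dbar_eq_zero ?_ ?_
    · have h1 : DifferentiableAt ℝ (fun z =>
          (ContinuousLinearMap.restrictScalarsL ℂ V V ℝ ℝ) (H z)) z :=
        (ContinuousLinearMap.restrictScalarsL ℂ V V ℝ ℝ).differentiableAt.comp z
          (hH.differentiable one_ne_zero z)
      exact h1.clm_apply hz.1
    · rw [hh, dbar_clm_apply (hH.differentiable one_ne_zero z) hz.1, hz', hz.2]
      simp
  have han : AnalyticAt ℂ h p := Complex.analyticAt_iff_eventually_differentiableAt.2 hhol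
  have hinv : ∀ᶠ z in 𝓝 p, f z = Ring.inverse (H z) (h z) := by
    filter_upwards [hHu] with z hz
    have : Ring.inverse (H z) * H z = 1 := Ring.inverse_mul_cancel _ hz
    rw [hh]
    exact (DFunLike.congr_fun this (f z)).symm
  have hne : ¬ ∀ᶠ z in 𝓝 p, h z = 0 := by
    intro h0
    have : ∀ᶠ z in 𝓝[≠] p, False := by
      filter_upwards [hf0, (h0.and hinv).filter_mono nhdsWithin_le_nhds] with z hz hz'
      rw [hz'.1, map_zero] at hz'
      exact hz hz'.2
    exact this.exists.elim fun _ h => h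
  obtain ⟨n, k, hk, hkp, hkf⟩ := han.exists_eventuallyEq_pow_smul_nonzero_iff.2 hne
  refine ⟨n, fun z => Ring.inverse (H z) (k z), ?_, ?_, ?_⟩
  · exact contDiffAt_inverse_apply hH.contDiffAt hHp (hk.contDiffAt.restrict_scalars ℝ)
  · simpa [hHp] using hkp
  · filter_upwards [hinv, hkf] with z h1 h2
    rw [h1, h2, map_smul]

/-- Bounded isolated singularities of solutions of a Riccati equation are removable. -/
theorem riccati_removable {a b c w : ℂ → ℂ} {p : ℂ} {R : ℝ} (ha : ContDiffAt ℝ 1 a p)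
    (hb : ContDiffAt ℝ 1 b p) (hc : ContDiffAt ℝ 1 c p)
    (hw : ∀ᶠ z in 𝓝[≠] p, DifferentiableAt ℝ w z ∧ dbar w z = a z + b z * w z + c z * w z ^ 2 ∧
      ‖w z‖ ≤ R) :
    ∃ w' : ℂ → ℂ, ContDiffAt ℝ 1 w' p ∧ ∀ᶠ z in 𝓝[≠] p, w z = w' z := by
  -- the projectivised linear system
  let e : Fin 2 → Fin 2 → ((Fin 2 → ℂ) →L[ℂ] (Fin 2 → ℂ)) := fun i j =>
    (ContinuousLinearMap.proj (R := ℂ) (φ := fun _ : Fin 2 => ℂ) j).smulRight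
      (Pi.single i 1 : Fin 2 → ℂ)
  -- The entries are chosen so that s = (w, 1) satisfies ∂̄s + Ms = (cw)s: the Riccati equation says
  -- that s solves the linear system up to a scalar factor.
  set M : ℂ → (Fin 2 → ℂ) →L[ℂ] (Fin 2 → ℂ) := fun z => -(b z • e 0 0 + a z • e 0 1 - c z • e 1 0) with hM
  have hMd : ContDiffAt ℝ 1 M p :=
    (((hb.smul contDiffAt_const).add (ha.smul contDiffAt_const)).sub
      (hc.smul contDiffAt_const)).neg
  obtain ⟨H, hH, hHp, hHd⟩ := exists_dbar_eq_mul hMd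
  have hHu := eventually_isUnit hH.continuous.continuousAt hHp
  set s : ℂ → Fin 2 → ℂ := fun z => ![w z, 1] with hs
  set h : ℂ → Fin 2 → ℂ := fun z => H z (s z) with hh
  have hR0 : 0 ≤ R := by
    obtain ⟨z, hz⟩ := hw.exists
    exact (norm_nonneg _).trans hz.2.2
  have hsn : ∀ z, ‖w z‖ ≤ R → ‖s z‖ ≤ R + 1 := by
    intro z hz
    refine (pi_norm_le_iff_of_nonneg (by positivity)).2 fun i => ?_
    fin_cases i
    · simpa [hs] using hz.trans (by linarith)
    · simpa [hs] using hR0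
  -- Boundedness of w enters here. Near p, `H` moves s by less than 1/2, so the second component of
  -- Hs stays away from zero and the quotient of the components stays bounded.
  have hsmall : ∀ᶠ z in 𝓝 p, ‖H z - 1‖ * (R + 1) < 1 / 2 := by
    have : ContinuousAt (fun z => ‖H z - 1‖ * (R + 1)) p :=
      ((hH.continuous.continuousAt.sub continuousAt_const).norm.mul continuousAt_const)
    refine this.eventually (gt_mem_nhds ?_)
    simp [hHp]
  have hgood : ∀ᶠ z in 𝓝[≠] p, DifferentiableAt ℂ (fun z => h z 0 / h z 1) z ∧ h z 1 ≠ 0 ∧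
      ‖h z 0 / h z 1‖ ≤ (R + 2) / (1 / 2) := by
    filter_upwards [hw, (hsmall.and hHd).filter_mono nhdsWithin_le_nhds] with z hz hz'
    have hdiff : ∀ i, ‖h z i - s z i‖ ≤ 1 / 2 := by
      intro i
      have h1 : h z - s z = (H z - 1) (s z) := rfl
      calc _ = ‖(h z - s z) i‖ := by simp
        _ ≤ ‖h z - s z‖ := norm_le_pi_norm _ i
        _ ≤ ‖H z - 1‖ * ‖s z‖ := by rw [h1]; exact (H z - 1).le_opNorm _
        _ ≤ ‖H z - 1‖ * (R + 1) := by gcongr; exact hsn z hz.2.2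
        _ ≤ _ := hz'.1.le
    have h1n : 1 / 2 ≤ ‖h z 1‖ := by
      have := hdiff 1
      have h2 : ‖(1 : ℂ)‖ - ‖h z 1‖ ≤ ‖h z 1 - 1‖ := by
        rw [norm_sub_rev]; exact norm_sub_norm_le _ _
      have h3 : s z 1 = 1 := by simp [hs]
      rw [h3] at this
      rw [norm_one] at h2
      linarith
    have h0n : ‖h z 0‖ ≤ R + 2 := by
      have := hdiff 0
      have h2 := norm_sub_norm_le (h z 0) (s z 0)
      have h3 : ‖s z 0‖ ≤ R := by simpa [hs] using hz.2.2
      linarith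
    have h1ne : h z 1 ≠ 0 := by
      intro h0; rw [h0, norm_zero] at h1n; linarith
    have hsd : HasFDerivAt s (ContinuousLinearMap.pi ![fderiv ℝ w z, 0]) z := by
      rw [hasFDerivAt_pi']
      intro i
      fin_cases i
      · exact hz.1.hasFDerivAt
      · exact hasFDerivAt_const (1 : ℂ) z
    have hdbs : dbar s z = ![dbar w z, 0] := by
      rw [dbar, hsd.fderiv]
      ext i
      fin_cases i
      · rfl
      · exact add_eq_left.2 (mul_zero Complex.I)
    have hhd : DifferentiableAt ℝ h z := by
      have h1 : DifferentiableAt ℝ (fun z =>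
          (ContinuousLinearMap.restrictScalarsL ℂ (Fin 2 → ℂ) (Fin 2 → ℂ) ℝ ℝ) (H z)) z :=
        (ContinuousLinearMap.restrictScalarsL ℂ (Fin 2 → ℂ) (Fin 2 → ℂ) ℝ ℝ).differentiableAt.comp z
          (hH.differentiable one_ne_zero z)
      exact h1.clm_apply hsd.differentiableAt
    have hMs : M z (s z) + ![dbar w z, 0] = (c z * w z) • s z := by
      ext i
      fin_cases i
      · simp [hM, hs, e, hz.2.1]; ring
      · simp [hM, hs, e]
    have hdbh : dbar h z = (c z * w z) • h z := by
      rw [hh, dbar_clm_apply (hH.differentiable one_ne_zero z) hsd.differentiableAt, hz'.2, hdbs]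
      rw [show (H z * M z) (s z) = H z (M z (s z)) from rfl, ← map_add, hMs, map_smul]
    -- Both components acquire the same factor cw under ∂̄, so it drops out of their quotient.
    have hcomp : ∀ i, DifferentiableAt ℝ (fun z => h z i) z ∧
        dbar (fun z => h z i) z = c z * w z * h z i := by
      intro i
      have h1 := hasFDerivAt_pi'.1 hhd.hasFDerivAt i
      refine ⟨h1.differentiableAt, ?_⟩
      have := congrFun hdbh i
      simp only [dbar, h1.fderiv]
      simpa [dbar] using this
    refine ⟨?_, h1ne, ?_⟩
    · have hq : DifferentiableAt ℝ (fun z => h z 0 / h z 1) z := by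
        have hi : DifferentiableAt ℝ (fun z => (h z 1)⁻¹) z :=
          DifferentiableAt.comp z (g := fun v : ℂ => v⁻¹)
            ((differentiableAt_inv (𝕜 := ℂ) h1ne).restrictScalars ℝ) (hcomp 1).1
        simpa only [div_eq_mul_inv] using (hcomp 0).1.fun_mul hi
      refine differentiableAt_of_dbar_eq_zero hq ?_
      have hN : (fun z => h z 0) =ᶠ[𝓝 z] fun z => h z 0 / h z 1 * h z 1 := by
        filter_upwards [(hcomp 1).1.continuousAt.eventually_ne h1ne] with v hv
        rw [div_mul_cancel₀ _ hv]
      have h2 := (hcomp 0).2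
      have h3 := (hcomp 1).2
      simp only [dbar, hN.fderiv_eq, fderiv_fun_mul hq (hcomp 1).1] at h2
      simp only [dbar, smul_eq_mul, add_apply, smul_apply] at h2 h3 ⊢
      have hc : h z 0 / h z 1 * h z 1 = h z 0 := div_mul_cancel₀ _ h1ne
      refine mul_right_cancel₀ h1ne ?_
      linear_combination h2 - h z 0 / h z 1 * h3 - c z * w z * hc
    · rw [norm_div]
      gcongr
  -- extend the quotient
  set q : ℂ → ℂ := fun z => h z 0 / h z 1 with hq
  obtain ⟨ρ, hρ, hgρ⟩ := Metric.eventually_nhds_iff_ball.1 (eventually_nhdsWithin_iff.1 hgood)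
  have hext := Complex.differentiableOn_update_limUnder_of_bddAbove
    (f := q) (c := p) (s := Metric.ball p ρ) (Metric.ball_mem_nhds p hρ)
    (fun z hz => (hgρ z hz.1 hz.2).1.differentiableWithinAt)
    ⟨(R + 2) / (1 / 2), by rintro _ ⟨z, hz, rfl⟩; exact (hgρ z hz.1 hz.2).2.2⟩
  set q' := Function.update q p (limUnder (𝓝[≠] p) q) with hq'
  have hq'c : ContDiffAt ℝ 1 q' p :=
    ((hext.contDiffOn (n := 1) Metric.isOpen_ball).contDiffAt
      (Metric.ball_mem_nhds p hρ)).restrict_scalars ℝ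
  -- Undoing `H` on the extended projective point. Its second component is 1 at p because H p = 1,
  -- so the affine quotient is C¹ there.
  set t : ℂ → Fin 2 → ℂ := fun z => Ring.inverse (H z) ![q' z, 1] with ht
  have htc : ContDiffAt ℝ 1 t p := by
    refine contDiffAt_inverse_apply hH.contDiffAt hHp ?_
    refine contDiffAt_pi.2 fun i => ?_
    fin_cases i
    · exact hq'c
    · exact contDiffAt_const
  have htp : t p 1 ≠ 0 := by simp [ht, hHp]
  have hti : ContDiffAt ℝ 1 (fun z => (t z 1)⁻¹) p :=
    ContDiffAt.comp p (g := fun v : ℂ => v⁻¹) (contDiffAt_inv ℝ htp) (contDiffAt_pi.1 htc 1)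
  refine ⟨fun z => t z 0 * (t z 1)⁻¹, (contDiffAt_pi.1 htc 0).mul hti, ?_⟩
  filter_upwards [hgood, (hHu).filter_mono nhdsWithin_le_nhds, self_mem_nhdsWithin] with z hz hu hzp
  have hqz : q' z = q z := Function.update_of_ne hzp _ _
  have hst : h z 1 • t z = s z := by
    have h1 : h z 1 • (![q' z, 1] : Fin 2 → ℂ) = h z := by
      ext i
      fin_cases i
      · simp [hqz, hq, mul_div_cancel₀ _ hz.2.1]
      · simp
    rw [ht]
    beta_reduce
    rw [← map_smul, h1]
    have : Ring.inverse (H z) * H z = 1 := Ring.inverse_mul_cancel _ hu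
    exact DFunLike.congr_fun this (s z)
  have e0 : h z 1 * t z 0 = w z := congrFun hst 0
  have e1 : h z 1 * t z 1 = 1 := congrFun hst 1
  have ht1 : t z 1 ≠ 0 := right_ne_zero_of_mul (e1 ▸ one_ne_zero)
  rw [← div_eq_mul_inv, eq_div_iff ht1]
  linear_combination -t z 1 * e0 + t z 0 * e1

end Singularities

/-! ### Linear algebra of self-dual matrices and complex structures of ℝ⁴. -/

section SelfDualMatrices

/-- The self-dual skew matrix with the coefficients `u` with respect to the standard basis. -/
def sdMatrix (u : Fin 3 → ℝ) : Matrix (Fin 4) (Fin 4) ℝ :=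
  !![0, u 0, u 1, u 2; -u 0, 0, u 2, -u 1; -u 1, -u 2, 0, u 0; -u 2, u 1, -u 0, 0]

/-- The Euclidean inner product of coefficient vectors. -/
def dot3 (a b : Fin 3 → ℝ) : ℝ := a 0 * b 0 + a 1 * b 1 + a 2 * b 2

/-- The cross product of coefficient vectors. -/
def cross3 (a b : Fin 3 → ℝ) : Fin 3 → ℝ :=
  ![a 1 * b 2 - a 2 * b 1, a 2 * b 0 - a 0 * b 2, a 0 * b 1 - a 1 * b 0]

theorem sdMatrix_add (a b : Fin 3 → ℝ) : sdMatrix (a + b) = sdMatrix a + sdMatrix b := by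
  ext i j; fin_cases i <;> fin_cases j <;> simp [sdMatrix] <;> ring

theorem sdMatrix_smul (c : ℝ) (a : Fin 3 → ℝ) : sdMatrix (c • a) = c • sdMatrix a := by
  ext i j; fin_cases i <;> fin_cases j <;> simp [sdMatrix]

theorem sdMatrix_sub (a b : Fin 3 → ℝ) : sdMatrix (a - b) = sdMatrix a - sdMatrix b := by
  ext i j; fin_cases i <;> fin_cases j <;> simp [sdMatrix] <;> ring

/-- The matrices of E₁, E₂, E₃ multiply like imaginary quaternions of the opposite orientation,
hence the reversed cross product. This order is what produces D₂ = u × D₁ as the form of the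
Cauchy–Riemann equation. -/
theorem sdMatrix_mul (a u : Fin 3 → ℝ) :
    sdMatrix a * sdMatrix u = -(dot3 a u) • (1 : Matrix (Fin 4) (Fin 4) ℝ) +
      sdMatrix (cross3 u a) := by
  ext i j
  fin_cases i <;> fin_cases j <;>
    simp [sdMatrix, dot3, cross3, Matrix.mul_apply, Fin.sum_univ_four] <;> ring

theorem trace_sdMatrix_mul (a u : Fin 3 → ℝ) :
    (sdMatrix a * sdMatrix u).trace = -4 * dot3 a u := by
  simp [sdMatrix, dot3, Matrix.trace, Fin.sum_univ_four]
  ring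

/-- The vector describing the action of a skew matrix on self-dual matrices. -/
def sdRotation (W : Matrix (Fin 4) (Fin 4) ℝ) : Fin 3 → ℝ :=
  ![-(W 0 1 + W 2 3), -(W 0 2 - W 1 3), -(W 0 3 + W 1 2)]

/-- so(4) is the sum of the commuting ideals of self-dual and anti-self-dual matrices. Only the
self-dual part of `W` acts, and it acts as an infinitesimal rotation. -/
theorem commutator_sdMatrix {W : Matrix (Fin 4) (Fin 4) ℝ} (hW : ∀ i j, W i j = -W j i)
    (u : Fin 3 → ℝ) :
    W * sdMatrix u - sdMatrix u * W = sdMatrix (cross3 (sdRotation W) u) := by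
  have h0 : ∀ i, W i i = 0 := fun i => by linarith [hW i i]
  have hk : W = !![0, W 0 1, W 0 2, W 0 3; -W 0 1, 0, W 1 2, W 1 3; -W 0 2, -W 1 2, 0, W 2 3;
      -W 0 3, -W 1 3, -W 2 3, 0] := by
    ext i j
    fin_cases i <;> fin_cases j <;> simp [h0, hW 1 0, hW 2 0, hW 3 0, hW 2 1, hW 3 1, hW 3 2]
  have hr : sdRotation W = ![-(W 0 1 + W 2 3), -(W 0 2 - W 1 3), -(W 0 3 + W 1 2)] := rfl
  rw [hr]
  generalize W 0 1 = a at *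
  generalize W 0 2 = b at *
  generalize W 0 3 = c at *
  generalize W 1 2 = d at *
  generalize W 1 3 = f at *
  generalize W 2 3 = h at *
  rw [hk]
  ext i j
  fin_cases i <;> fin_cases j <;>
    simp [sdMatrix, cross3] <;> ring

theorem sdMatrix_mulVec (u : Fin 3 → ℝ) (x : Fin 4 → ℝ) :
    (sdMatrix u).mulVec x = ![u 0 * x 1 + u 1 * x 2 + u 2 * x 3, -u 0 * x 0 + u 2 * x 2 - u 1 * x 3,
      -u 1 * x 0 - u 2 * x 1 + u 0 * x 3, -u 2 * x 0 + u 1 * x 1 - u 0 * x 2] := by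
  ext i
  fin_cases i <;> simp [sdMatrix, Matrix.mulVec, dotProduct, Fin.sum_univ_four] <;> ring

/-- The self-dual part of `x ∧ y`. -/
def sdWedge (x y : Fin 4 → ℝ) : Fin 3 → ℝ :=
  ![x 0 * y 1 - x 1 * y 0 + x 2 * y 3 - x 3 * y 2, x 0 * y 2 - x 2 * y 0 - x 1 * y 3 + x 3 * y 1,
    x 0 * y 3 - x 3 * y 0 + x 1 * y 2 - x 2 * y 1]

/-- The determinant is the squared length of the cross product of the self-dual part of x ∧ w with
u. -/
theorem det_sdMatrix_nonneg (u : Fin 3 → ℝ) (x w : Fin 4 → ℝ) :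
    0 ≤ (Matrix.of fun i j => (![x, (sdMatrix u).mulVec x, w, (sdMatrix u).mulVec w] :
      Fin 4 → Fin 4 → ℝ) j i).det := by
  have : (Matrix.of fun i j => (![x, (sdMatrix u).mulVec x, w, (sdMatrix u).mulVec w] :
      Fin 4 → Fin 4 → ℝ) j i).det = dot3 (cross3 (sdWedge x w) u) (cross3 (sdWedge x w) u) := by
    rw [sdMatrix_mulVec, sdMatrix_mulVec]
    simp [Matrix.det_succ_row_zero, Fin.sum_univ_succ, Fin.succAbove, dot3, cross3, sdWedge]
    ring
  rw [this]
  simp only [dot3]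
  nlinarith [mul_self_nonneg (cross3 (sdWedge x w) u 0), mul_self_nonneg (cross3 (sdWedge x w) u 1),
    mul_self_nonneg (cross3 (sdWedge x w) u 2)]

/-- For orthogonal vectors of equal length, the self-dual part of x ∧ y acts on their plane as a
scaled quarter turn. The minus sign is due to the convention by which x ∧ y sends x to a negative
multiple of y. -/
theorem sdMatrix_mulVec_of_orthogonal {x y : Fin 4 → ℝ}
    (h1 : x 0 * x 0 + x 1 * x 1 + x 2 * x 2 + x 3 * x 3 = y 0 * y 0 + y 1 * y 1 + y 2 * y 2 + y 3 * y 3)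
    (h2 : x 0 * y 0 + x 1 * y 1 + x 2 * y 2 + x 3 * y 3 = 0) :
    (sdMatrix (-sdWedge x y)).mulVec x = (x 0 * x 0 + x 1 * x 1 + x 2 * x 2 + x 3 * x 3) • y ∧
    (sdMatrix (-sdWedge x y)).mulVec y = -(x 0 * x 0 + x 1 * x 1 + x 2 * x 2 + x 3 * x 3) • x ∧
    dot3 (sdWedge x y) (sdWedge x y) = (x 0 * x 0 + x 1 * x 1 + x 2 * x 2 + x 3 * x 3) ^ 2 := by
  refine ⟨?_, ?_, ?_⟩
  · rw [sdMatrix_mulVec]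
    ext i
    fin_cases i <;> simp [sdWedge]
    · linear_combination -x 0 * h2
    · linear_combination -x 1 * h2
    · linear_combination -x 2 * h2
    · linear_combination -x 3 * h2
  · rw [sdMatrix_mulVec]
    ext i
    fin_cases i <;> simp [sdWedge]
    · linear_combination y 0 * h2 + x 0 * h1
    · linear_combination y 1 * h2 + x 1 * h1
    · linear_combination y 2 * h2 + x 2 * h1
    · linear_combination y 3 * h2 + x 3 * h1
  · simp [sdWedge, dot3]
    linear_combination (-(x 0 * y 0 + x 1 * y 1 + x 2 * y 2 + x 3 * y 3)) * h2 -
      (x 0 * x 0 + x 1 * x 1 + x 2 * x 2 + x 3 * x 3) * h1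

/-- Orthogonal complex structures of the standard orientation are self-dual. -/
theorem exists_eq_sdMatrix {k : Matrix (Fin 4) (Fin 4) ℝ} (h1 : k.transpose * k = 1)
    (h2 : k * k = -1)
    (h3 : ∀ x w : Fin 4 → ℝ, (Matrix.of fun i j => (![x, k.mulVec x, w, k.mulVec w] :
      Fin 4 → Fin 4 → ℝ) j i).det ≠ 0 → 0 < (Matrix.of fun i j =>
        (![x, k.mulVec x, w, k.mulVec w] : Fin 4 → Fin 4 → ℝ) j i).det) :
    ∃ u : Fin 3 → ℝ, dot3 u u = 1 ∧ k = sdMatrix u := by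
  have hskew : k.transpose = -k := by
    calc k.transpose = -(k.transpose * (k * k)) := by rw [h2]; simp
      _ = -k := by rw [← mul_assoc, h1, one_mul]
  have hs : ∀ i j, k i j = -k j i := fun i j => by
    have := congrFun (congrFun hskew j) i
    simpa using this
  have h0 : ∀ i, k i i = 0 := fun i => by linarith [hs i i]
  have e : ∀ i j, k i 0 * k 0 j + k i 1 * k 1 j + k i 2 * k 2 j + k i 3 * k 3 j =
      (-1 : Matrix (Fin 4) (Fin 4) ℝ) i j := fun i j => by
    have := congrFun (congrFun h2 i) j
    simpa [Matrix.mul_apply, Fin.sum_univ_four] using this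
  have e00 := e 0 0
  have e11 := e 1 1
  have e22 := e 2 2
  have e33 := e 3 3
  have e01 := e 0 1
  have e02 := e 0 2
  have e03 := e 0 3
  simp [h0, hs 1 0, hs 2 0, hs 3 0, hs 2 1, hs 3 1, hs 3 2] at e00 e11 e22 e33 e01 e02 e03
  have hk : k = !![0, k 0 1, k 0 2, k 0 3; -k 0 1, 0, k 1 2, k 1 3; -k 0 2, -k 1 2, 0, k 2 3;
      -k 0 3, -k 1 3, -k 2 3, 0] := by
    ext i j
    fin_cases i <;> fin_cases j <;> simp [h0, hs 1 0, hs 2 0, hs 3 0, hs 2 1, hs 3 1, hs 3 2]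
  generalize k 0 1 = a at *
  generalize k 0 2 = b at *
  generalize k 0 3 = c at *
  generalize k 1 2 = d at *
  generalize k 1 3 = f at *
  generalize k 2 3 = h at *
  -- The diagonal of k² = -1 shows that entries with complementary index pairs agree up to sign. The
  -- off-diagonal entries tie the three signs together, leaving the self-dual and the anti-self-dual
  -- case.
  have haf : a ^ 2 = h ^ 2 := by linarith
  have hbe : b ^ 2 = f ^ 2 := by linarith
  have hcd : c ^ 2 = d ^ 2 := by linarith
  have hcases : (a = h ∧ b = -f ∧ c = d) ∨ (a = -h ∧ b = f ∧ c = -d) := by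
    by_cases ha : h = 0
    · have ha' : a = 0 := by rw [ha] at haf; simpa using haf
      by_cases hb : f = 0
      · have hb' : b = 0 := by rw [hb] at hbe; simpa using hbe
        rcases sq_eq_sq_iff_eq_or_eq_neg.1 hcd with h | h
        · left; simp [ha, ha', hb, hb', h]
        · right; simp [ha, ha', hb, hb', h]
      · rcases sq_eq_sq_iff_eq_or_eq_neg.1 hbe with h | h
        · right
          refine ⟨by simp [ha, ha'], h, mul_right_cancel₀ hb ?_⟩
          subst h; linarith
        · left
          refine ⟨by simp [ha, ha'], h, mul_right_cancel₀ hb ?_⟩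
          subst h; linarith
    · rcases sq_eq_sq_iff_eq_or_eq_neg.1 haf with h' | h'
      · left
        refine ⟨h', mul_right_cancel₀ ha ?_, mul_right_cancel₀ ha ?_⟩ <;> subst h' <;> linarith
      · right
        refine ⟨h', mul_right_cancel₀ ha ?_, mul_right_cancel₀ ha ?_⟩ <;> subst h' <;> linarith
  rcases hcases with ⟨rfl, rfl, rfl⟩ | ⟨rfl, rfl, rfl⟩
  · refine ⟨![a, -f, c], by simp [dot3]; linarith, ?_⟩
    rw [hk]
    simp [sdMatrix]
  -- An anti-self-dual structure gives determinants that are minus sums of squares. The orientation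
  -- condition then forces all entries to vanish, against the diagonal of k² = -1.
  · exfalso
    have g1 : (Matrix.of fun i j => (![Pi.single 0 1, k.mulVec (Pi.single 0 1), Pi.single 1 1,
        k.mulVec (Pi.single 1 1)] : Fin 4 → Fin 4 → ℝ) j i).det = -(b ^ 2 + d ^ 2) := by
      rw [hk]
      simp [Matrix.det_succ_row_zero, Fin.sum_univ_succ, Fin.succAbove]
      ring
    have g2 : (Matrix.of fun i j => (![Pi.single 0 1, k.mulVec (Pi.single 0 1), Pi.single 2 1,
        k.mulVec (Pi.single 2 1)] : Fin 4 → Fin 4 → ℝ) j i).det = -(d ^ 2 + h ^ 2) := by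
      rw [hk]
      simp [Matrix.det_succ_row_zero, Fin.sum_univ_succ, Fin.succAbove]
      ring
    have p1 := h3 (Pi.single 0 1) (Pi.single 1 1)
    have p2 := h3 (Pi.single 0 1) (Pi.single 2 1)
    rw [g1] at p1
    rw [g2] at p2
    have z1 : b ^ 2 + d ^ 2 = 0 := by
      by_contra hz
      nlinarith [p1 (neg_ne_zero.2 hz), sq_nonneg b, sq_nonneg d]
    have z2 : d ^ 2 + h ^ 2 = 0 := by
      by_contra hz
      nlinarith [p2 (neg_ne_zero.2 hz), sq_nonneg d, sq_nonneg h]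
    nlinarith [sq_nonneg b, sq_nonneg d, sq_nonneg h]

end SelfDualMatrices

/-! ### Frames of a bilinear form and self-dual endomorphisms in a frame. -/

section Frames

/-- The operator on `ℝ⁴` of a matrix. -/
def matEnd (A : Matrix (Fin 4) (Fin 4) ℝ) : E4 →L[ℝ] E4 :=
  Matrix.toEuclideanCLM (n := Fin 4) (𝕜 := ℝ) A

theorem matEnd_apply (A : Matrix (Fin 4) (Fin 4) ℝ) (v : E4) (i : Fin 4) :
    matEnd A v i = A.mulVec v i := by
  simp [matEnd, Matrix.ofLp_toEuclideanCLM]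

theorem matEnd_mul (A B : Matrix (Fin 4) (Fin 4) ℝ) : matEnd (A * B) = matEnd A * matEnd B :=
  map_mul _ A B

theorem matEnd_add (A B : Matrix (Fin 4) (Fin 4) ℝ) : matEnd (A + B) = matEnd A + matEnd B :=
  map_add _ A B

theorem matEnd_sub (A B : Matrix (Fin 4) (Fin 4) ℝ) : matEnd (A - B) = matEnd A - matEnd B :=
  map_sub _ A B

theorem matEnd_smul (c : ℝ) (A : Matrix (Fin 4) (Fin 4) ℝ) : matEnd (c • A) = c • matEnd A :=
  map_smul (Matrix.toEuclideanCLM (n := Fin 4) (𝕜 := ℝ)) c A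

theorem matEnd_one : matEnd 1 = 1 := map_one _

theorem exists_matEnd (K : E4 →L[ℝ] E4) : ∃ A, K = matEnd A :=
  ⟨(Matrix.toEuclideanCLM (n := Fin 4) (𝕜 := ℝ)).symm K, by simp [matEnd]⟩

theorem matEnd_injective : Function.Injective matEnd :=
  (Matrix.toEuclideanCLM (n := Fin 4) (𝕜 := ℝ)).injective

theorem trace_matEnd (A : Matrix (Fin 4) (Fin 4) ℝ) :
    LinearMap.trace ℝ E4 (matEnd A).toLinearMap = A.trace := by
  rw [LinearMap.trace_eq_matrix_trace ℝ (EuclideanSpace.basisFun (Fin 4) ℝ).toBasis]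
  congr 1
  ext i j
  simp [LinearMap.toMatrix_apply, matEnd_apply]

theorem clm_mul_smul (A B : E4 →L[ℝ] E4) (c : ℝ) : A * c • B = c • (A * B) := by
  ext; simp

theorem clm_smul_mul (A B : E4 →L[ℝ] E4) (c : ℝ) : (c • A) * B = c • (A * B) := by
  ext; simp

/-- Bilinear forms on `ℝ⁴`. -/
abbrev Bilin := E4 →L[ℝ] E4 →L[ℝ] ℝ

/-- The determinant of four vectors. -/
def det4 (v : Fin 4 → E4) : ℝ := Matrix.det (Matrix.of fun i j : Fin 4 => v j i)

/-- Orthonormal bases of a bilinear form. -/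
def IsON (b : Bilin) (e : Fin 4 → E4) : Prop := ∀ i j, b (e i) (e j) = if i = j then 1 else 0

/-- The linear map with the columns `e`. -/
def frameMap (e : Fin 4 → E4) : E4 →L[ℝ] E4 :=
  ∑ i, (EuclideanSpace.proj (𝕜 := ℝ) i : E4 →L[ℝ] ℝ).smulRight (e i)

/-- The dual frame. -/
def coframe (b : Bilin) (e : Fin 4 → E4) : E4 →L[ℝ] E4 :=
  ∑ i, (b (e i)).smulRight (bvec i)

theorem frameMap_apply (e : Fin 4 → E4) (x : E4) : frameMap e x = ∑ i, x i • e i := by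
  simp [frameMap]

theorem coframe_apply (b : Bilin) (e : Fin 4 → E4) (v : E4) (i : Fin 4) :
    coframe b e v i = b (e i) v := by
  simp [coframe, Finset.sum_apply, Pi.single_apply]

variable {b : Bilin} {e : Fin 4 → E4}

theorem coframe_mul_frameMap (h : IsON b e) : coframe b e * frameMap e = 1 := by
  ext v i
  have : (coframe b e * frameMap e) v i = coframe b e (frameMap e v) i := rfl
  rw [this, coframe_apply, frameMap_apply, map_sum]
  simp [h i]

/-- In finite dimension a one-sided inverse is two-sided. -/
theorem frameMap_mul_coframe (h : IsON b e) : frameMap e * coframe b e = 1 := by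
  have h1 : (coframe b e).toLinearMap * (frameMap e).toLinearMap = 1 := by
    ext v : 1
    exact DFunLike.congr_fun (coframe_mul_frameMap h) v
  have h2 := mul_eq_one_comm.1 h1
  ext v : 1
  exact DFunLike.congr_fun h2 v

theorem coframe_frameMap (h : IsON b e) (v : E4) : coframe b e (frameMap e v) = v :=
  DFunLike.congr_fun (coframe_mul_frameMap h) v

theorem frameMap_coframe (h : IsON b e) (v : E4) : frameMap e (coframe b e v) = v :=
  DFunLike.congr_fun (frameMap_mul_coframe h) v

theorem IsON.apply_eq_sum (h : IsON b e) (v w : E4) :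
    b v w = ∑ i, coframe b e v i * coframe b e w i := by
  conv_lhs => rw [← frameMap_coframe h v, frameMap_apply]
  simp [coframe_apply]

theorem IsON.frameMap_frameMap (h : IsON b e) (v w : E4) :
    b (frameMap e v) (frameMap e w) = ∑ i, v i * w i := by
  rw [h.apply_eq_sum, coframe_frameMap h, coframe_frameMap h]

theorem det4_frameMap (e x : Fin 4 → E4) :
    det4 (fun j => frameMap e (x j)) = det4 e * det4 x := by
  rw [det4, det4, det4, ← Matrix.det_mul]
  congr 1
  ext i j
  simp [frameMap_apply, Matrix.mul_apply, mul_comm]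

theorem linearIndependent_iff_det4 (v : Fin 4 → E4) : LinearIndependent ℝ v ↔ det4 v ≠ 0 := by
  have h1 := (LinearMap.linearIndependent_iff_of_injOn (WithLp.linearEquiv 2 ℝ (Fin 4 → ℝ)).toLinearMap
    (v := v) (WithLp.linearEquiv 2 ℝ (Fin 4 → ℝ)).injective.injOn)
  rw [det4, ← isUnit_iff_ne_zero, ← Matrix.isUnit_iff_isUnit_det,
    ← Matrix.linearIndependent_cols_iff_isUnit, ← h1]
  rfl

/-- Orthogonal complex structures of a bilinear form, of the standard orientation. -/
def twistorSet (b : Bilin) : Set (E4 →L[ℝ] E4) :=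
  {K | (∀ v w, b (K v) (K w) = b v w) ∧ (∀ v, K (K v) = -v) ∧
    ∀ v w, LinearIndependent ℝ ![v, K v, w, K w] → 0 < det4 ![v, K v, w, K w]}

/-- The self-dual endomorphism with given coefficients in a frame. -/
def sdEnd (b : Bilin) (e : Fin 4 → E4) (u : Fin 3 → ℝ) : E4 →L[ℝ] E4 :=
  frameMap e * matEnd (sdMatrix u) * coframe b e

theorem sdEnd_add (u v : Fin 3 → ℝ) : sdEnd b e (u + v) = sdEnd b e u + sdEnd b e v := by
  simp only [sdEnd, sdMatrix_add, matEnd_add]; noncomm_ring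

theorem sdEnd_sub (u v : Fin 3 → ℝ) : sdEnd b e (u - v) = sdEnd b e u - sdEnd b e v := by
  simp only [sdEnd, sdMatrix_sub, matEnd_sub, mul_sub, sub_mul]

theorem sdEnd_smul (c : ℝ) (u : Fin 3 → ℝ) : sdEnd b e (c • u) = c • sdEnd b e u := by
  simp only [sdEnd, sdMatrix_smul, matEnd_smul, clm_mul_smul, clm_smul_mul]

theorem sdEnd_eq_sum (u : Fin 3 → ℝ) :
    sdEnd b e u = ∑ i, u i • sdEnd b e (Pi.single i 1) := by
  conv_lhs => rw [pi_eq_sum_univ' u]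
  simp only [Fin.sum_univ_three, sdEnd_add, sdEnd_smul]

theorem conj_mul_conj (h : IsON b e) (A B : E4 →L[ℝ] E4) :
    (frameMap e * A * coframe b e) * (frameMap e * B * coframe b e) =
      frameMap e * (A * B) * coframe b e := by
  calc _ = frameMap e * A * (coframe b e * frameMap e) * B * coframe b e := by noncomm_ring
    _ = _ := by rw [coframe_mul_frameMap h]; noncomm_ring

theorem sdEnd_mul (h : IsON b e) (a u : Fin 3 → ℝ) :
    sdEnd b e a * sdEnd b e u = -(dot3 a u) • (1 : E4 →L[ℝ] E4) + sdEnd b e (cross3 u a) := by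
  simp only [sdEnd]
  rw [conj_mul_conj h, ← matEnd_mul, sdMatrix_mul, matEnd_add, matEnd_smul, matEnd_one, mul_add,
    add_mul, clm_mul_smul, clm_smul_mul, mul_one, frameMap_mul_coframe h]

theorem cross3_self (u : Fin 3 → ℝ) : cross3 u u = 0 := by
  ext i; fin_cases i <;> simp [cross3] <;> ring

theorem sdEnd_zero : sdEnd b e 0 = 0 := by
  have := sdEnd_sub (b := b) (e := e) 0 0
  rwa [sub_self, sub_self] at this

theorem dot3_self_eq_zero {u : Fin 3 → ℝ} (h : dot3 u u = 0) : u = 0 := by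
  simp only [dot3] at h
  have h0 := mul_self_nonneg (u 0)
  have h1 := mul_self_nonneg (u 1)
  have h2 := mul_self_nonneg (u 2)
  ext i
  fin_cases i
  · exact mul_self_eq_zero.1 (show u 0 * u 0 = 0 by linarith)
  · exact mul_self_eq_zero.1 (show u 1 * u 1 = 0 by linarith)
  · exact mul_self_eq_zero.1 (show u 2 * u 2 = 0 by linarith)

/-- The square is -|u|² times the identity. This rigidity gives the uniqueness of the lift, and it
turns an equation tested on one tangent vector into an equation of endomorphisms. -/
theorem eq_zero_of_sdEnd_apply_eq_zero (h : IsON b e) {u : Fin 3 → ℝ} {v : E4} (hv : v ≠ 0)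
    (huv : sdEnd b e u v = 0) : u = 0 := by
  have h1 := DFunLike.congr_fun (sdEnd_mul h u u) v
  rw [cross3_self, sdEnd_zero, add_zero] at h1
  have h2 : (sdEnd b e u * sdEnd b e u) v = 0 := by
    rw [ContinuousLinearMap.mul_def, ContinuousLinearMap.comp_apply, huv, map_zero]
  rw [h2] at h1
  have h3 : dot3 u u • v = 0 := by
    have : (-(dot3 u u) • (1 : E4 →L[ℝ] E4)) v = -(dot3 u u • v) := by simp
    rw [this] at h1
    exact neg_eq_zero.1 h1.symm
  exact dot3_self_eq_zero ((smul_eq_zero.1 h3).resolve_right hv)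

theorem trace_conj (h : IsON b e) (A : E4 →L[ℝ] E4) :
    LinearMap.trace ℝ E4 (frameMap e * A * coframe b e).toLinearMap =
      LinearMap.trace ℝ E4 A.toLinearMap := by
  have h1 : (frameMap e * A * coframe b e).toLinearMap =
    (frameMap e * A).toLinearMap * (coframe b e).toLinearMap := rfl
  have h2 : (coframe b e).toLinearMap * (frameMap e * A).toLinearMap = A.toLinearMap := by
    ext v : 1
    exact coframe_frameMap h (A v)
  rw [h1, LinearMap.trace_mul_comm, h2]

theorem trace_sdEnd_mul (h : IsON b e) (a u : Fin 3 → ℝ) :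
    LinearMap.trace ℝ E4 (sdEnd b e a * sdEnd b e u).toLinearMap = -4 * dot3 a u := by
  simp only [sdEnd]
  rw [conj_mul_conj h, trace_conj h, ← matEnd_mul, trace_matEnd, trace_sdMatrix_mul]

theorem sdEnd_mem_twistorSet (h : IsON b e) (hd : 0 < det4 e) {u : Fin 3 → ℝ}
    (hu : dot3 u u = 1) : sdEnd b e u ∈ twistorSet b := by
  have hsq : ∀ v, sdEnd b e u (sdEnd b e u v) = -v := fun v => by
    have h1 := DFunLike.congr_fun (sdEnd_mul h u u) v
    rw [cross3_self, sdEnd_zero, add_zero, hu] at h1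
    simpa using h1
  refine ⟨fun v w => ?_, hsq, fun v w hli => ?_⟩
  · simp only [sdEnd, ContinuousLinearMap.mul_def, ContinuousLinearMap.comp_apply]
    rw [h.frameMap_frameMap, h.apply_eq_sum]
    simp only [matEnd_apply, sdMatrix_mulVec, Fin.sum_univ_four, Matrix.cons_val]
    simp only [dot3] at hu
    generalize coframe b e v = x
    generalize coframe b e w = y
    linear_combination (x 0 * y 0 + x 1 * y 1 + x 2 * y 2 + x 3 * y 3) * hu
  · refine lt_of_le_of_ne ?_ ((linearIndependent_iff_det4 _).1 hli).symm
    have : (![v, sdEnd b e u v, w, sdEnd b e u w] : Fin 4 → E4) = fun j => frameMap e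
        ((![coframe b e v, matEnd (sdMatrix u) (coframe b e v), coframe b e w,
          matEnd (sdMatrix u) (coframe b e w)] : Fin 4 → E4) j) := by
      ext1 j
      fin_cases j
      · exact (frameMap_coframe h v).symm
      · rfl
      · exact (frameMap_coframe h w).symm
      · rfl
    rw [this, det4_frameMap]
    refine mul_nonneg hd.le ?_
    have h2 := det_sdMatrix_nonneg u (coframe b e v) (coframe b e w)
    refine h2.trans_eq (congrArg Matrix.det ?_)
    ext i j
    fin_cases j
    · rfl
    · exact (matEnd_apply _ _ _).symm
    · rfl
    · exact (matEnd_apply _ _ _).symm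

/-- Conjugating by the frame reduces this to `exists_eq_sdMatrix`. The orientation condition
survives because determinants are multiplicative and the frame is positive. -/
theorem exists_sdEnd_of_mem_twistorSet (h : IsON b e) (hd : 0 < det4 e) {K : E4 →L[ℝ] E4}
    (hK : K ∈ twistorSet b) : ∃ u : Fin 3 → ℝ, dot3 u u = 1 ∧ K = sdEnd b e u := by
  obtain ⟨k, hk⟩ := exists_matEnd (coframe b e * K * frameMap e)
  have hKk : K = frameMap e * matEnd k * coframe b e := by
    rw [← hk]
    calc K = 1 * K * 1 := by simp
      _ = _ := by rw [← frameMap_mul_coframe h]; noncomm_ring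
  have hKf : ∀ x, K (frameMap e x) = frameMap e (matEnd k x) := fun x => by
    rw [hKk]
    simp only [ContinuousLinearMap.mul_def, ContinuousLinearMap.comp_apply, coframe_frameMap h]
  obtain ⟨h1, h2, h3⟩ := hK
  have horth : ∀ x y : Fin 4 → ℝ, k.mulVec x ⬝ᵥ k.mulVec y = x ⬝ᵥ y := fun x y => by
    have := h1 (frameMap e (WithLp.toLp 2 x)) (frameMap e (WithLp.toLp 2 y))
    rw [hKf, hKf, h.frameMap_frameMap, h.frameMap_frameMap] at this
    simpa [matEnd_apply, dotProduct] using this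
  have g1 : k.transpose * k = 1 := by
    ext i j
    have := horth (Pi.single i 1) (Pi.single j 1)
    simp only [Matrix.mulVec_single_one, single_one_dotProduct] at this
    rw [Matrix.mul_apply, Matrix.one_apply]
    simpa [dotProduct, Matrix.col, Pi.single_apply, eq_comm] using this
  have g2 : k * k = -1 := by
    apply matEnd_injective
    have : K * K = -1 := by ext v : 1; exact h2 v
    rw [hKk, conj_mul_conj h, ← matEnd_mul] at this
    calc matEnd (k * k) = coframe b e * frameMap e * matEnd (k * k) * (coframe b e * frameMap e) := by
          rw [coframe_mul_frameMap h]; simp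
      _ = coframe b e * (frameMap e * matEnd (k * k) * coframe b e) * frameMap e := by noncomm_ring
      _ = matEnd (-1) := by
          rw [this, ← neg_one_smul ℝ (1 : Matrix (Fin 4) (Fin 4) ℝ), matEnd_smul, matEnd_one]
          ext v : 1
          change coframe b e (-(frameMap e v)) = _
          rw [map_neg, coframe_frameMap h]
          simp
  have g3 : ∀ x w : Fin 4 → ℝ, (Matrix.of fun i j => (![x, k.mulVec x, w, k.mulVec w] :
      Fin 4 → Fin 4 → ℝ) j i).det ≠ 0 → 0 < (Matrix.of fun i j =>
        (![x, k.mulVec x, w, k.mulVec w] : Fin 4 → Fin 4 → ℝ) j i).det := by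
    intro x w hxw
    have h4 := h3 (frameMap e (WithLp.toLp 2 x)) (frameMap e (WithLp.toLp 2 w))
    have : (![frameMap e (WithLp.toLp 2 x), K (frameMap e (WithLp.toLp 2 x)),
        frameMap e (WithLp.toLp 2 w), K (frameMap e (WithLp.toLp 2 w))] : Fin 4 → E4) = fun j =>
        frameMap e ((![WithLp.toLp 2 x, matEnd k (WithLp.toLp 2 x), WithLp.toLp 2 w,
          matEnd k (WithLp.toLp 2 w)] : Fin 4 → E4) j) := by
      ext1 j
      fin_cases j
      · rfl
      · exact hKf _
      · rfl
      · exact hKf _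
    have h5 : det4 (![WithLp.toLp 2 x, matEnd k (WithLp.toLp 2 x), WithLp.toLp 2 w,
          matEnd k (WithLp.toLp 2 w)] : Fin 4 → E4) =
        (Matrix.of fun i j => (![x, k.mulVec x, w, k.mulVec w] : Fin 4 → Fin 4 → ℝ) j i).det := by
      refine congrArg Matrix.det ?_
      ext i j
      fin_cases j
      · rfl
      · exact matEnd_apply _ _ _
      · rfl
      · exact matEnd_apply _ _ _
    rw [linearIndependent_iff_det4, this, det4_frameMap, h5] at h4
    exact (mul_pos_iff_of_pos_left hd).1 (h4 (mul_ne_zero hd.ne' hxw))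
  obtain ⟨u, hu, hku⟩ := exists_eq_sdMatrix g1 g2 g3
  exact ⟨u, hu, by rw [hKk, hku]; rfl⟩

end Frames

/-! ### The metric and its Levi-Civita connection in charts of the target. -/

section TargetCharts

variable {N : Type*} [TopologicalSpace N] [ChartedSpace E4 N] [IsManifold (𝓡 4) ∞ N]

theorem toFiber_ofFiber {y₀ y : N} (hy : y ∈ (chartAt E4 y₀).source) (v : TangentSpace (𝓡 4) y) :
    toFiber y₀ y (ofFiber y₀ y v) = v := by
  exact (tangentCoordChange_comp (I := 𝓡 4) (w := y) (x := y₀) (y := y) (z := y) (v := v)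
    (by simpa using hy)).trans (tangentCoordChange_self (by simp))

theorem ofFiber_toFiber {y₀ y : N} (hy : y ∈ (chartAt E4 y₀).source) (v : E4) :
    ofFiber y₀ y (toFiber y₀ y v) = v := by
  exact (tangentCoordChange_comp (I := 𝓡 4) (w := y₀) (x := y) (y := y₀) (z := y) (v := v)
    (by simpa using hy)).trans (tangentCoordChange_self (by simpa using hy))

theorem toFiber_self (y : N) (v : E4) : toFiber y y v = v :=
  tangentCoordChange_self (I := 𝓡 4) (x := y) (z := y) (by simp)

theorem ofFiber_self (y : N) (v : TangentSpace (𝓡 4) y) : ofFiber y y v = v :=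
  tangentCoordChange_self (I := 𝓡 4) (x := y) (z := y) (v := v) (by simp)

/-- The metric at a point as a bilinear form on `ℝ⁴`. -/
def fiberForm (g : Metric N) (y : N) : Bilin := g.inner y

/-- The metric in a chart as a bilinear form on `ℝ⁴`. -/
def chartForm (g : Metric N) (y₀ : N) (q : E4) : Bilin :=
  (fiberForm g ((chartAt E4 y₀).symm q)).bilinearComp
    (toFiber y₀ ((chartAt E4 y₀).symm q)) (toFiber y₀ ((chartAt E4 y₀).symm q))

theorem chartForm_apply (g : Metric N) (y₀ : N) (q v w : E4) :
    chartForm g y₀ q v w = metricCoord g y₀ q v w := rfl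

theorem chartForm_symm (g : Metric N) (y₀ : N) (q v w : E4) :
    chartForm g y₀ q v w = chartForm g y₀ q w v := g.symm _ _ _

theorem chartForm_pos (g : Metric N) {y₀ : N} {q : E4} (hq : q ∈ (chartAt E4 y₀).target) {v : E4}
    (hv : v ≠ 0) : 0 < chartForm g y₀ q v v := by
  refine g.pos _ _ fun h => hv ?_
  have h1 := ofFiber_toFiber ((chartAt E4 y₀).map_target hq) v
  exact h1.symm.trans ((congrArg (ofFiber y₀ _) h).trans (map_zero _))

-- A constant coordinate vector is a smooth section of the tangent bundle over the chart, being
-- constant in the trivialization. The smooth metric is evaluated on two such sections.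
open scoped Bundle in
theorem contDiffOn_chartForm_apply (g : Metric N) (y₀ : N) (v w : E4) :
    ContDiffOn ℝ ∞ (fun q => chartForm g y₀ q v w) (chartAt E4 y₀).target := by
  let _ : Bundle.RiemannianBundle (fun y : N => TangentSpace (𝓡 4) y) := ⟨g.toRiemannianMetric⟩
  have : IsManifold (𝓡 4) (∞ + 1) N := by simpa
  have : ContMDiffVectorBundle ∞ E4 (TangentSpace (𝓡 4) : N → Type _) (𝓡 4) := inferInstance
  have hsym : ContMDiffOn 𝓘(ℝ, E4) (𝓡 4) ∞ (chartAt E4 y₀).symm (chartAt E4 y₀).target :=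
    contMDiffOn_chart_symm
  have hsec : ∀ v : E4, ContMDiffOn 𝓘(ℝ, E4) ((𝓡 4).prod 𝓘(ℝ, E4)) ∞
      (fun q => (⟨(chartAt E4 y₀).symm q, toFiber y₀ ((chartAt E4 y₀).symm q) v⟩ :
        TangentBundle (𝓡 4) N)) (chartAt E4 y₀).target := by
    intro v
    have h1 := (trivializationAt E4 (TangentSpace (𝓡 4)) y₀).contMDiffOn_symm (n := ∞) (IB := 𝓡 4)
    have h2 : ContMDiffOn 𝓘(ℝ, E4) ((𝓡 4).prod 𝓘(ℝ, E4)) ∞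
        (fun q => ((chartAt E4 y₀).symm q, v)) (chartAt E4 y₀).target :=
      hsym.prodMk contMDiffOn_const
    have hm : ∀ q ∈ (chartAt E4 y₀).target, ((chartAt E4 y₀).symm q, v) ∈
        (trivializationAt E4 (TangentSpace (𝓡 4)) y₀).target := by
      intro q hq
      rw [Bundle.Trivialization.mem_target]
      exact (chartAt E4 y₀).map_target hq
    refine (h1.comp h2 hm).congr fun q hq => ?_
    rfl
  have := ContMDiffOn.inner_bundle (hsec v) (hsec w)
  exact contMDiffOn_iff_contDiffOn.1 this

theorem contDiffOn_chartForm (g : Metric N) (y₀ : N) :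
    ContDiffOn ℝ ∞ (chartForm g y₀) (chartAt E4 y₀).target :=
  contDiffOn_clm_apply.2 fun v => contDiffOn_clm_apply.2 fun w =>
    contDiffOn_chartForm_apply g y₀ v w

theorem chartForm_eq_sum (g : Metric N) (y₀ : N) (q v w : E4) :
    chartForm g y₀ q v w = ∑ i, ∑ j, metricMatrix g y₀ q i j * v i * w j := by
  have hv : ∀ v : E4, v = ∑ i, v i • bvec i := fun v => by
    ext j; simp [Pi.single_apply]
  conv_lhs => rw [hv v, hv w]
  simp only [map_sum, map_smul, FunLike.coe_sum, Finset.sum_apply, smul_apply]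
  simp only [smul_eq_mul, Finset.mul_sum]
  rw [Finset.sum_comm]
  refine Finset.sum_congr rfl fun i _ => Finset.sum_congr rfl fun j _ => ?_
  rw [chartForm_apply]
  simp only [metricMatrix, Matrix.of_apply]
  ring

theorem contDiffOn_metricMatrix (g : Metric N) (y₀ : N) (i j : Fin 4) :
    ContDiffOn ℝ ∞ (fun q => metricMatrix g y₀ q i j) (chartAt E4 y₀).target :=
  contDiffOn_chartForm_apply g y₀ (bvec i) (bvec j)

theorem metricMatrix_symm (g : Metric N) (y₀ : N) (q : E4) (i j : Fin 4) :
    metricMatrix g y₀ q i j = metricMatrix g y₀ q j i :=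
  chartForm_symm g y₀ q (bvec i) (bvec j)

/-- A kernel vector would have length zero. -/
theorem isUnit_det_metricMatrix (g : Metric N) {y₀ : N} {q : E4}
    (hq : q ∈ (chartAt E4 y₀).target) : IsUnit (metricMatrix g y₀ q).det := by
  rw [isUnit_iff_ne_zero]
  intro h
  obtain ⟨v, hv, hv0⟩ := Matrix.exists_mulVec_eq_zero_iff.2 h
  have h1 := chartForm_pos g hq (v := WithLp.toLp 2 v) (by simpa using hv)
  rw [chartForm_eq_sum] at h1
  have h2 : ∑ i, ∑ j, metricMatrix g y₀ q i j * v i * v j = v ⬝ᵥ (metricMatrix g y₀ q).mulVec v := by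
    simp only [dotProduct, Matrix.mulVec, Finset.mul_sum]
    refine Finset.sum_congr rfl fun i _ => Finset.sum_congr rfl fun j _ => by ring
  rw [hv0, dotProduct_zero] at h2
  exact h1.ne' h2

theorem metricDeriv_symm (g : Metric N) (y₀ : N) (q : E4) (k i j : Fin 4) :
    metricDeriv g y₀ q k i j = metricDeriv g y₀ q k j i := by
  unfold metricDeriv
  congr 2
  ext q'
  exact metricMatrix_symm g y₀ q' i j

theorem christoffel_symm (g : Metric N) (y₀ : N) (q : E4) (k i j : Fin 4) :
    christoffel g y₀ q k i j = christoffel g y₀ q k j i := by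
  unfold christoffel
  congr 1
  refine Finset.sum_congr rfl fun l _ => ?_
  rw [metricDeriv_symm g y₀ q l i j]
  ring

/-- Lowering the upper index cancels the inverse matrix and leaves the Koszul expression. The
contraction is over the row index, so the symmetry of the inverse is needed. -/
theorem sum_christoffel_mul (g : Metric N) {y₀ : N} {q : E4} (hq : q ∈ (chartAt E4 y₀).target)
    (i j m : Fin 4) :
    ∑ l, christoffel g y₀ q l i j * metricMatrix g y₀ q l m =
      (1 / 2) * (metricDeriv g y₀ q i j m + metricDeriv g y₀ q j i m - metricDeriv g y₀ q m i j) := by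
  have h := Matrix.nonsing_inv_mul _ (isUnit_det_metricMatrix g hq)
  set D : Fin 4 → ℝ := fun l =>
    metricDeriv g y₀ q i j l + metricDeriv g y₀ q j i l - metricDeriv g y₀ q l i j with hD
  have h1 : ∀ n, ∑ l, (metricMatrix g y₀ q)⁻¹ l n * metricMatrix g y₀ q l m =
      if n = m then 1 else 0 := by
    intro n
    have hs : (metricMatrix g y₀ q)⁻¹.transpose = (metricMatrix g y₀ q)⁻¹ := by
      rw [Matrix.transpose_nonsing_inv]
      congr 1
      ext a b
      exact metricMatrix_symm g y₀ q b a
    have := congrFun (congrFun h n) m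
    rw [Matrix.mul_apply, Matrix.one_apply] at this
    rw [← this]
    refine Finset.sum_congr rfl fun l _ => ?_
    rw [← congrFun (congrFun hs n) l, Matrix.transpose_apply]
  calc ∑ l, christoffel g y₀ q l i j * metricMatrix g y₀ q l m
      = ∑ l, ∑ n, (1 / 2) * D n * ((metricMatrix g y₀ q)⁻¹ l n * metricMatrix g y₀ q l m) := by
        refine Finset.sum_congr rfl fun l _ => ?_
        simp only [christoffel, Finset.mul_sum, Finset.sum_mul]
        refine Finset.sum_congr rfl fun n _ => ?_
        simp only [hD]; ring
    _ = ∑ n, (1 / 2) * D n * ∑ l, (metricMatrix g y₀ q)⁻¹ l n * metricMatrix g y₀ q l m := by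
        rw [Finset.sum_comm]
        simp only [Finset.mul_sum]
    _ = (1 / 2) * D m := by simp [h1]

theorem connForm_apply (g : Metric N) (y₀ : N) (q d v : E4) (k : Fin 4) :
    connForm g y₀ q d v k = ∑ j, ∑ i, christoffel g y₀ q k i j * d i * v j := by
  have : connForm g y₀ q d v k = _ := matEnd_apply _ v k
  rw [this]
  simp [Matrix.mulVec, dotProduct, Finset.sum_mul]

/-- The connection is torsion free. Along the map this identifies the mixed terms of ∇₁∂₂φ and
∇₂∂₁φ. -/
theorem connForm_comm (g : Metric N) (y₀ : N) (q d v : E4) :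
    connForm g y₀ q d v = connForm g y₀ q v d := by
  ext k
  rw [connForm_apply, connForm_apply, Finset.sum_comm]
  refine Finset.sum_congr rfl fun i _ => Finset.sum_congr rfl fun j _ => ?_
  rw [christoffel_symm]; ring

theorem chartForm_connForm (g : Metric N) {y₀ : N} {q : E4} (hq : q ∈ (chartAt E4 y₀).target)
    (d v w : E4) :
    chartForm g y₀ q (connForm g y₀ q d v) w = ∑ i, ∑ j, ∑ m, d i * v j * w m * ((1 / 2) *
      (metricDeriv g y₀ q i j m + metricDeriv g y₀ q j i m - metricDeriv g y₀ q m i j)) := by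
  rw [chartForm_eq_sum]
  calc _ = ∑ l, ∑ m, ∑ j, ∑ i, d i * v j * w m *
        (christoffel g y₀ q l i j * metricMatrix g y₀ q l m) := by
        refine Finset.sum_congr rfl fun l _ => Finset.sum_congr rfl fun m _ => ?_
        rw [connForm_apply, Finset.mul_sum, Finset.sum_mul]
        refine Finset.sum_congr rfl fun j _ => ?_
        rw [Finset.mul_sum, Finset.sum_mul]
        refine Finset.sum_congr rfl fun i _ => by ring
    _ = ∑ i, ∑ j, ∑ m, ∑ l, d i * v j * w m *
        (christoffel g y₀ q l i j * metricMatrix g y₀ q l m) := by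
        simp only [Fin.sum_univ_four]
        ring
    _ = _ := by
        refine Finset.sum_congr rfl fun i _ => Finset.sum_congr rfl fun j _ =>
          Finset.sum_congr rfl fun m _ => ?_
        rw [← Finset.mul_sum, sum_christoffel_mul g hq]

/-- The Levi-Civita connection is metric. -/
theorem fderiv_chartForm (g : Metric N) {y₀ : N} {q : E4} (hq : q ∈ (chartAt E4 y₀).target)
    (d v w : E4) :
    fderiv ℝ (chartForm g y₀) q d v w =
      chartForm g y₀ q (connForm g y₀ q d v) w + chartForm g y₀ q v (connForm g y₀ q d w) := by
  have hnhds := (chartAt E4 y₀).open_target.mem_nhds hq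
  have hd : ∀ v w, HasFDerivAt (fun q => chartForm g y₀ q v w)
      (((ContinuousLinearMap.apply ℝ ℝ w) ∘L (ContinuousLinearMap.apply ℝ (E4 →L[ℝ] ℝ) v)) ∘L
        fderiv ℝ (chartForm g y₀) q) q := by
    intro v w
    have h1 := (((contDiffOn_chartForm g y₀).contDiffAt hnhds).differentiableAt
      (by simp)).hasFDerivAt
    exact (((ContinuousLinearMap.apply ℝ ℝ w) ∘L
      (ContinuousLinearMap.apply ℝ (E4 →L[ℝ] ℝ) v)).hasFDerivAt).comp q h1
  have hmd : ∀ k i j, metricDeriv g y₀ q k i j =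
      fderiv ℝ (chartForm g y₀) q (bvec k) (bvec i) (bvec j) := by
    intro k i j
    exact DFunLike.congr_fun (hd (bvec i) (bvec j)).fderiv (bvec k)
  have hv : ∀ v : E4, v = ∑ i, v i • bvec i := fun v => by
    ext j; simp [Pi.single_apply]
  have hL : fderiv ℝ (chartForm g y₀) q d v w =
      ∑ i, ∑ j, ∑ m, d i * v j * w m * metricDeriv g y₀ q i j m := by
    conv_lhs => rw [hv d, hv v, hv w]
    simp only [hmd, map_sum, map_smul, FunLike.coe_sum, Finset.sum_apply, smul_apply, smul_eq_mul,
      Finset.mul_sum]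
    simp only [Fin.sum_univ_four]
    ring
  rw [hL, chartForm_symm g y₀ q v, chartForm_connForm g hq, chartForm_connForm g hq]
  -- After j and m are exchanged in the second Koszul sum, the terms antisymmetric in them cancel
  -- and the two halves of ∂_i g_{jm} add up.
  have : ∑ i, ∑ j, ∑ m, d i * w j * v m * ((1 / 2) *
      (metricDeriv g y₀ q i j m + metricDeriv g y₀ q j i m - metricDeriv g y₀ q m i j)) =
    ∑ i, ∑ j, ∑ m, d i * v j * w m * ((1 / 2) *
      (metricDeriv g y₀ q i m j + metricDeriv g y₀ q m i j - metricDeriv g y₀ q j i m)) := by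
    refine Finset.sum_congr rfl fun i _ => ?_
    rw [Finset.sum_comm]
    refine Finset.sum_congr rfl fun j _ => Finset.sum_congr rfl fun m _ => by ring
  rw [this, ← Finset.sum_add_distrib]
  refine Finset.sum_congr rfl fun i _ => ?_
  rw [← Finset.sum_add_distrib]
  refine Finset.sum_congr rfl fun j _ => ?_
  rw [← Finset.sum_add_distrib]
  refine Finset.sum_congr rfl fun m _ => ?_
  rw [metricDeriv_symm g y₀ q i m j]
  ring

end TargetCharts

/-! ### Smooth dependence of the connection and of the coordinate changes; orientation. -/

section TargetSmoothness

variable {N : Type*} [TopologicalSpace N] [ChartedSpace E4 N] [IsManifold (𝓡 4) ∞ N]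

theorem contDiffOn_det {X : Type*} [NormedAddCommGroup X] [NormedSpace ℝ X] {n : ℕ} {s : Set X}
    {A : X → Matrix (Fin n) (Fin n) ℝ} (hA : ∀ i j, ContDiffOn ℝ ∞ (fun x => A x i j) s) :
    ContDiffOn ℝ ∞ (fun x => (A x).det) s := by
  simp only [Matrix.det_apply']
  exact ContDiffOn.sum fun σ _ => contDiffOn_const.mul (contDiffOn_prod fun i _ => hA _ _)

/-- Cramer's rule writes the entries as quotients of determinants with nonvanishing denominator. -/
theorem contDiffOn_metricMatrix_inv (g : Metric N) (y₀ : N) (i j : Fin 4) :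
    ContDiffOn ℝ ∞ (fun q => (metricMatrix g y₀ q)⁻¹ i j) (chartAt E4 y₀).target := by
  have h1 : ∀ q, (metricMatrix g y₀ q)⁻¹ i j =
      ((metricMatrix g y₀ q).det)⁻¹ * ((metricMatrix g y₀ q).updateRow j (Pi.single i 1)).det := by
    intro q
    rw [Matrix.inv_def, Matrix.smul_apply, Matrix.adjugate_apply, Ring.inverse_eq_inv', smul_eq_mul]
  simp only [h1]
  refine ContDiffOn.mul (ContDiffOn.inv (contDiffOn_det fun i j => contDiffOn_metricMatrix g y₀ i j)
    fun q hq => (isUnit_det_metricMatrix g hq).ne_zero) (contDiffOn_det fun a b => ?_)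
  by_cases ha : a = j
  · subst ha
    simp only [Matrix.updateRow_self]
    exact contDiffOn_const
  · simp only [Matrix.updateRow_ne ha]
    exact contDiffOn_metricMatrix g y₀ a b

theorem contDiffOn_metricDeriv (g : Metric N) (y₀ : N) (k i j : Fin 4) :
    ContDiffOn ℝ ∞ (fun q => metricDeriv g y₀ q k i j) (chartAt E4 y₀).target :=
  ((contDiffOn_metricMatrix g y₀ i j).fderiv_of_isOpen (m := ∞) (chartAt E4 y₀).open_target
    (by simp)).clm_apply contDiffOn_const

theorem contDiffOn_christoffel (g : Metric N) (y₀ : N) (k i j : Fin 4) :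
    ContDiffOn ℝ ∞ (fun q => christoffel g y₀ q k i j) (chartAt E4 y₀).target := by
  unfold christoffel
  exact contDiffOn_const.mul (ContDiffOn.sum fun l _ => (contDiffOn_metricMatrix_inv g y₀ k l).mul
    (((contDiffOn_metricDeriv g y₀ i j l).add (contDiffOn_metricDeriv g y₀ j i l)).sub
      (contDiffOn_metricDeriv g y₀ l i j)))

theorem contDiffOn_connForm (g : Metric N) {y₀ : N} {X : Type*} [NormedAddCommGroup X]
    [NormedSpace ℝ X] {s : Set X} {f d : X → E4} (hf : ContDiffOn ℝ ∞ f s)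
    (hd : ContDiffOn ℝ ∞ d s) (hs : ∀ x ∈ s, f x ∈ (chartAt E4 y₀).target) :
    ContDiffOn ℝ ∞ (fun x => connForm g y₀ (f x) (d x)) s := by
  refine contDiffOn_clm_apply.2 fun v => contDiffOn_euclidean.2 fun k => ?_
  simp only [connForm_apply]
  refine ContDiffOn.sum fun j _ => ContDiffOn.sum fun i _ => ?_
  exact (((contDiffOn_christoffel g y₀ k i j).comp hf hs).mul
    (contDiffOn_euclidean.1 hd i)).mul contDiffOn_const

theorem contDiffOn_tangentCoordChange (y₀ y₁ : N) :
    ContDiffOn ℝ ∞ (fun q => tangentCoordChange (𝓡 4) y₀ y₁ ((chartAt E4 y₀).symm q))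
      ((chartAt E4 y₀).target ∩ (chartAt E4 y₀).symm ⁻¹' (chartAt E4 y₁).source) := by
  have : IsManifold (𝓡 4) (∞ + 1) N := by simpa
  have h := contDiffOn_fderiv_coord_change (I := 𝓡 4) (n := ∞) (achart E4 y₀) (achart E4 y₁)
  refine ContDiffOn.congr (h.mono ?_) ?_
  · rintro q ⟨h1, h2⟩
    simpa using ⟨h1, h2⟩
  · rintro q ⟨h1, h2⟩
    rw [tangentCoordChange_def]
    congr 1
    simpa using (chartAt E4 y₀).right_inv h1

theorem ofFiber_toFiber_change {y₀ y₁ y : N} (h0 : y ∈ (chartAt E4 y₀).source)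
    (h1 : y ∈ (chartAt E4 y₁).source) (v : E4) :
    ofFiber y₁ y (toFiber y₀ y v) = tangentCoordChange (𝓡 4) y₀ y₁ y v :=
  tangentCoordChange_comp (I := 𝓡 4) (w := y₀) (x := y) (y := y₁) (z := y) (v := v)
    (by simpa using ⟨h0, h1⟩)

theorem det4_clm (T : E4 →L[ℝ] E4) (x : Fin 4 → E4) :
    det4 (fun j => T (x j)) = T.det * det4 x := by
  obtain ⟨A, rfl⟩ := exists_matEnd T
  have h1 : (matEnd A).det = A.det := by
    rw [ContinuousLinearMap.det, ← LinearMap.det_toMatrix (EuclideanSpace.basisFun (Fin 4) ℝ).toBasis]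
    refine congrArg Matrix.det (Matrix.ext fun i j => ?_)
    simp [LinearMap.toMatrix_apply, matEnd_apply]
  rw [h1, det4, det4, ← Matrix.det_mul]
  exact congrArg Matrix.det (Matrix.ext fun i j => matEnd_apply A (x j) i)

theorem det4_toFiber_pos (hN : IsOrientedAtlas N) {y₀ y : N} (hy : y ∈ (chartAt E4 y₀).source)
    {x : Fin 4 → E4} (hx : 0 < det4 x) : 0 < det4 (fun j => (toFiber y₀ y (x j) : E4)) := by
  have h1 := det4_clm (tangentCoordChange (𝓡 4) y₀ y y) x
  have h2 := hN y₀ y y hy (mem_chart_source E4 y)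
  have h3 : det4 (fun j => (toFiber y₀ y (x j) : E4)) = _ := h1
  rw [h3]
  exact mul_pos h2 hx

end TargetSmoothness

/-! ### Holomorphic coordinate changes of the surface. -/

section SurfaceCharts

variable {S : Type*} [TopologicalSpace S] [ChartedSpace ℂ S]

variable (S) in
theorem isManifold_real [IsManifold 𝓘(ℂ) ω S] : IsManifold 𝓘(ℝ, ℂ) ∞ S := by
  refine isManifold_of_contDiffOn _ _ _ fun e e' he he' => ?_
  have h := (contDiffGroupoid ω 𝓘(ℂ)).compatible he he'
  rw [contDiffGroupoid, mem_groupoid_of_pregroupoid] at h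
  exact (ContDiffOn.restrict_scalars ℝ h.1).of_le (by simp)

/-- The coordinate change from the chart at `x₀` to the chart at `x₁`. -/
def transition (x₀ x₁ : S) (z : ℂ) : ℂ := chartAt ℂ x₁ (pt x₀ z)

/-- The domain of the coordinate change. -/
def overlap (x₀ x₁ : S) : Set ℂ := (chartAt ℂ x₀).target ∩ pt x₀ ⁻¹' (chartAt ℂ x₁).source

theorem isOpen_overlap (x₀ x₁ : S) : IsOpen (overlap x₀ x₁) :=
  (chartAt ℂ x₀).isOpen_inter_preimage_symm (chartAt ℂ x₁).open_source

theorem transition_mem_overlap {x₀ x₁ : S} {z : ℂ} (hz : z ∈ overlap x₀ x₁) :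
    transition x₀ x₁ z ∈ overlap x₁ x₀ := by
  refine ⟨(chartAt ℂ x₁).map_source hz.2, ?_⟩
  show pt x₁ (chartAt ℂ x₁ (pt x₀ z)) ∈ (chartAt ℂ x₀).source
  rw [pt, (chartAt ℂ x₁).left_inv hz.2]
  exact (chartAt ℂ x₀).map_target hz.1

theorem pt_transition {x₀ x₁ : S} {z : ℂ} (hz : z ∈ overlap x₀ x₁) :
    pt x₁ (transition x₀ x₁ z) = pt x₀ z :=
  (chartAt ℂ x₁).left_inv hz.2

theorem transition_transition {x₀ x₁ : S} {z : ℂ} (hz : z ∈ overlap x₀ x₁) :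
    transition x₁ x₀ (transition x₀ x₁ z) = z := by
  rw [transition, pt_transition hz, pt, (chartAt ℂ x₀).right_inv hz.1]

variable [IsManifold 𝓘(ℂ) ω S]

theorem contDiffOn_transition (x₀ x₁ : S) : ContDiffOn ℂ ω (transition x₀ x₁) (overlap x₀ x₁) := by
  have h1 : ContMDiffOn 𝓘(ℂ) 𝓘(ℂ) ω (chartAt ℂ x₁) (chartAt ℂ x₁).source := contMDiffOn_chart
  have h2 : ContMDiffOn 𝓘(ℂ) 𝓘(ℂ) ω (chartAt ℂ x₀).symm (chartAt ℂ x₀).target :=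
    contMDiffOn_chart_symm
  exact contMDiffOn_iff_contDiffOn.1 (h1.comp (h2.mono Set.inter_subset_left) fun z hz => hz.2)

theorem differentiableAt_transition {x₀ x₁ : S} {z : ℂ} (hz : z ∈ overlap x₀ x₁) :
    DifferentiableAt ℂ (transition x₀ x₁) z :=
  ((contDiffOn_transition x₀ x₁).contDiffAt ((isOpen_overlap x₀ x₁).mem_nhds hz)).differentiableAt
    (by simp)

/-- Chain rule for the composition with the reverse coordinate change, which is the identity near z.
-/
theorem deriv_transition_ne_zero {x₀ x₁ : S} {z : ℂ} (hz : z ∈ overlap x₀ x₁) :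
    deriv (transition x₀ x₁) z ≠ 0 := by
  intro h
  have h1 := (differentiableAt_transition (transition_mem_overlap hz)).hasDerivAt.comp z
    (differentiableAt_transition hz).hasDerivAt
  have h2 : HasDerivAt (fun z => z) 0 z := by
    refine HasDerivAt.congr_of_eventuallyEq ?_ (f := transition x₁ x₀ ∘ transition x₀ x₁) ?_
    · simpa [h] using h1
    · filter_upwards [(isOpen_overlap x₀ x₁).mem_nhds hz] with w hw
      exact (transition_transition hw).symm
  exact one_ne_zero ((hasDerivAt_id z).unique h2)

end SurfaceCharts

/-! ### Frames, metric and connection along the map, in coordinates. -/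

section MapCharts

variable {S : Type*} [TopologicalSpace S] [ChartedSpace ℂ S]
  {N : Type*} [TopologicalSpace N] [ChartedSpace E4 N]
  {φ : S → N} {x₀ : S} {y₀ : N} {z : ℂ}

theorem isOpen_patch_inter (hφ : Continuous φ) (x₀ : S) (y₀ : N) {V : Set S} (hV : IsOpen V) :
    IsOpen (patch φ x₀ y₀ ∩ pt x₀ ⁻¹' V) := by
  have h := (chartAt ℂ x₀).isOpen_inter_preimage_symm
    (((chartAt E4 y₀).open_source.preimage hφ).inter hV)
  convert h using 1
  ext z
  exact and_assoc

theorem isOpen_patch (hφ : Continuous φ) (x₀ : S) (y₀ : N) : IsOpen (patch φ x₀ y₀) := by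
  simpa using isOpen_patch_inter hφ x₀ y₀ isOpen_univ

theorem eventually_mem_patch {V : Set S} (hφ : Continuous φ) (hV : IsOpen V)
    (hz : z ∈ patch φ x₀ y₀ ∩ pt x₀ ⁻¹' V) : ∀ᶠ w in 𝓝 z, w ∈ patch φ x₀ y₀ ∩ pt x₀ ⁻¹' V :=
  (isOpen_patch_inter hφ x₀ y₀ hV).mem_nhds hz

theorem localMap_mem_target (hz : z ∈ patch φ x₀ y₀) :
    localMap φ x₀ y₀ z ∈ (chartAt E4 y₀).target :=
  (chartAt E4 y₀).map_source hz.2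

theorem continuousAt_pt (hz : z ∈ (chartAt ℂ x₀).target) : ContinuousAt (pt x₀) z :=
  (chartAt ℂ x₀).continuousAt_symm hz

theorem mem_patch (hx : z ∈ (chartAt ℂ x₀).target) : z ∈ patch φ x₀ (φ (pt x₀ z)) :=
  ⟨hx, mem_chart_source E4 _⟩

/-- A point with coordinate `z` is near `p` punctured if `z` is near the coordinate of `p`. -/
theorem tendsto_pt_punctured (hz : z ∈ (chartAt ℂ x₀).target) :
    Filter.Tendsto (pt x₀) (𝓝[≠] z) (𝓝[≠] (pt x₀ z)) := by
  refine tendsto_nhdsWithin_iff.2 ⟨(continuousAt_pt hz).tendsto.mono_left nhdsWithin_le_nhds, ?_⟩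
  filter_upwards [nhdsWithin_le_nhds ((chartAt ℂ x₀).open_target.mem_nhds hz),
    self_mem_nhdsWithin] with w hw hwz h
  exact hwz ((chartAt ℂ x₀).symm.injOn hw hz h)

variable [IsManifold (𝓡 4) ∞ N]

theorem pullConn_add_smul (g : Metric N) (z : ℂ) (a b : ℝ) (ζ η : ℂ) :
    pullConn g φ x₀ y₀ z (a • ζ + b • η) =
      a • pullConn g φ x₀ y₀ z ζ + b • pullConn g φ x₀ y₀ z η := by
  ext v k
  simp only [pullConn, dMap, map_add, map_smul, add_apply, smul_apply, PiLp.add_apply,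
    PiLp.smul_apply, connForm_apply, smul_eq_mul, Finset.mul_sum, ← Finset.sum_add_distrib]
  refine Finset.sum_congr rfl fun j _ => Finset.sum_congr rfl fun i _ => by ring

/-- The metric along the map, in coordinates. -/
def pullForm (g : Metric N) (φ : S → N) (x₀ : S) (y₀ : N) (z : ℂ) : Bilin :=
  chartForm g y₀ (localMap φ x₀ y₀ z)

/-! ### Frames in coordinates -/

theorem chartForm_ofFiber (g : Metric N) {y : N} (hy : y ∈ (chartAt E4 y₀).source)
    (v w : TangentSpace (𝓡 4) y) :
    chartForm g y₀ (chartAt E4 y₀ y) (ofFiber y₀ y v) (ofFiber y₀ y w) = fiberForm g y v w := by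
  have : ∀ y', y' = y → fiberForm g y' (toFiber y₀ y' (ofFiber y₀ y v))
      (toFiber y₀ y' (ofFiber y₀ y w)) = fiberForm g y v w := by
    rintro y' rfl
    exact congrArg₂ (fun a b => fiberForm g y' a b) (toFiber_ofFiber hy v) (toFiber_ofFiber hy w)
  exact this _ ((chartAt E4 y₀).left_inv hy)

/-- The coordinates of a frame along the map. -/
def chartFrame (φ : S → N) (e : ∀ x : S, Fin 4 → TangentSpace (𝓡 4) (φ x)) (x₀ : S) (y₀ : N)
    (z : ℂ) (i : Fin 4) : E4 :=
  ofFiber y₀ (φ (pt x₀ z)) (e (pt x₀ z) i)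

theorem isOrientedOrthonormal_iff (g : Metric N) (y : N) (e : Fin 4 → TangentSpace (𝓡 4) y) :
    IsOrientedOrthonormal g y e ↔ IsON (fiberForm g y) e ∧ 0 < det4 e := Iff.rfl

theorem isON_chartFrame (g : Metric N) {e : ∀ x : S, Fin 4 → TangentSpace (𝓡 4) (φ x)}
    (hz : z ∈ patch φ x₀ y₀) (he : IsON (fiberForm g (φ (pt x₀ z))) (e (pt x₀ z))) :
    IsON (pullForm g φ x₀ y₀ z) (chartFrame φ e x₀ y₀ z) :=
  fun i j => (chartForm_ofFiber g hz.2 _ _).trans (he i j)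

/-- Naturality of the frame description: a change of coordinates that carries one frame and its dual
frame to the other leaves the coefficients alone. No inverse relation between `O` and `T` has to be
assumed. -/
theorem apply_sdEnd_apply {O T : E4 →L[ℝ] E4} {b b' : Bilin} {e e' : Fin 4 → E4}
    (he : ∀ i, e' i = O (e i)) (hb : ∀ i v, b (e i) (T v) = b' (e' i) v) (u : Fin 3 → ℝ) (v : E4) :
    O (sdEnd b e u (T v)) = sdEnd b' e' u v := by
  have h1 : ∀ v : E4, O (frameMap e v) = frameMap e' v := by
    intro v
    rw [frameMap_apply, frameMap_apply, map_sum]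
    exact Finset.sum_congr rfl fun i _ => by rw [map_smul, he]
  have h2 : ∀ v : E4, coframe b e (T v) = coframe b' e' v := by
    intro v
    ext i
    rw [coframe_apply, coframe_apply, hb]
  have h3 : O (sdEnd b e u (T v)) = O (frameMap e (matEnd (sdMatrix u) (coframe b e (T v)))) := rfl
  rw [h3, h1, h2]
  rfl

/-- The endomorphism of the tangent space with given self-dual coefficients. -/
def fiberSd (g : Metric N) (y : N) (e : Fin 4 → TangentSpace (𝓡 4) y) (u : Fin 3 → ℝ) : EndT y :=
  sdEnd (fiberForm g y) e u

theorem localSection_fiberSd (g : Metric N) {e : ∀ x : S, Fin 4 → TangentSpace (𝓡 4) (φ x)}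
    (hz : z ∈ patch φ x₀ y₀) {J : EndSection φ} {u : Fin 3 → ℝ}
    (hJ : J (pt x₀ z) = fiberSd g (φ (pt x₀ z)) (e (pt x₀ z)) u) :
    localSection φ J x₀ y₀ z = sdEnd (pullForm g φ x₀ y₀ z) (chartFrame φ e x₀ y₀ z) u := by
  ext v : 1
  have h3 : localSection φ J x₀ y₀ z v = ofFiber y₀ (φ (pt x₀ z)) (fiberSd g (φ (pt x₀ z))
    (e (pt x₀ z)) u (toFiber y₀ (φ (pt x₀ z)) v)) :=
    congrArg (fun K : EndT (φ (pt x₀ z)) => ofFiber y₀ _ (K (toFiber y₀ _ v))) hJ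
  rw [h3]
  refine apply_sdEnd_apply (O := ofFiber y₀ (φ (pt x₀ z))) (T := toFiber y₀ (φ (pt x₀ z)))
    (fun _ => rfl) (fun i w => ?_) u v
  refine (chartForm_ofFiber g hz.2 _ _).symm.trans ?_
  exact congrArg (pullForm g φ x₀ y₀ z (chartFrame φ e x₀ y₀ z i)) (ofFiber_toFiber hz.2 w)

/-- Matches the wedge convention with the layout of `sdMatrix`, so that computations with the E_i
become computations with coefficient vectors. -/
theorem selfDual_eq (g : Metric N) (y : N) (e : Fin 4 → TangentSpace (𝓡 4) y) (i : Fin 3) :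
    selfDual g y e i = fiberSd g y e (Pi.single i 1) := by
  have key : ∀ (b : Bilin) (e : Fin 4 → E4) (a : Fin 3 → ℝ) (v : E4), sdEnd b e a v =
      ∑ k, (sdMatrix a).mulVec (fun j => b (e j) v) k • e k := by
    intro b e a v
    have : sdEnd b e a v = frameMap e (matEnd (sdMatrix a) (coframe b e v)) := rfl
    rw [this, frameMap_apply]
    refine Finset.sum_congr rfl fun k _ => ?_
    rw [matEnd_apply]
    congr 2
    ext j
    exact coframe_apply b e v j
  have hw : ∀ (b : Bilin) (a c v : E4), ((b c).smulRight a - (b a).smulRight c) v =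
      b c v • a - b a v • c := fun _ _ _ _ => rfl
  let b : Bilin := fiberForm g y
  let e' : Fin 4 → E4 := e
  have goal : ∀ i : Fin 3, (![((b (e' 1)).smulRight (e' 0) - (b (e' 0)).smulRight (e' 1)) +
      ((b (e' 3)).smulRight (e' 2) - (b (e' 2)).smulRight (e' 3)),
      ((b (e' 2)).smulRight (e' 0) - (b (e' 0)).smulRight (e' 2)) -
      ((b (e' 3)).smulRight (e' 1) - (b (e' 1)).smulRight (e' 3)),
      ((b (e' 3)).smulRight (e' 0) - (b (e' 0)).smulRight (e' 3)) +
      ((b (e' 2)).smulRight (e' 1) - (b (e' 1)).smulRight (e' 2))] : Fin 3 → E4 →L[ℝ] E4) i =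
      sdEnd b e' (Pi.single i 1) := by
    intro i
    ext v : 1
    rw [key]
    simp only [Fin.sum_univ_four, sdMatrix_mulVec]
    fin_cases i <;> simp <;> module
  exact goal i

/-! ### Smoothness -/

variable [IsManifold 𝓘(ℂ) ω S]

theorem contDiffOn_localMap (hφ : ContMDiff 𝓘(ℝ, ℂ) (𝓡 4) ∞ φ) (x₀ : S) (y₀ : N) :
    ContDiffOn ℝ ∞ (localMap φ x₀ y₀) (patch φ x₀ y₀) := by
  have := isManifold_real S
  have h1 : ContMDiffOn (𝓡 4) 𝓘(ℝ, E4) ∞ (chartAt E4 y₀) (chartAt E4 y₀).source :=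
    contMDiffOn_chart
  have h2 : ContMDiffOn 𝓘(ℝ, ℂ) 𝓘(ℝ, ℂ) ∞ (chartAt ℂ x₀).symm (chartAt ℂ x₀).target :=
    contMDiffOn_chart_symm
  have h3 := hφ.comp_contMDiffOn (h2.mono (t := patch φ x₀ y₀) fun z hz => hz.1)
  exact contMDiffOn_iff_contDiffOn.1 (h1.comp h3 fun z hz => hz.2)

theorem contDiffOn_fderiv_localMap (hφ : ContMDiff 𝓘(ℝ, ℂ) (𝓡 4) ∞ φ) (x₀ : S) (y₀ : N) :
    ContDiffOn ℝ ∞ (fun z => fderiv ℝ (localMap φ x₀ y₀) z) (patch φ x₀ y₀) :=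
  (contDiffOn_localMap hφ x₀ y₀).fderiv_of_isOpen (isOpen_patch hφ.continuous x₀ y₀) (by simp)

theorem contDiffOn_dMap (hφ : ContMDiff 𝓘(ℝ, ℂ) (𝓡 4) ∞ φ) (x₀ : S) (y₀ : N) (ζ : ℂ) :
    ContDiffOn ℝ ∞ (fun z => dMap φ x₀ y₀ z ζ) (patch φ x₀ y₀) :=
  (contDiffOn_fderiv_localMap hφ x₀ y₀).clm_apply contDiffOn_const

theorem contDiffOn_pullConn (g : Metric N) (hφ : ContMDiff 𝓘(ℝ, ℂ) (𝓡 4) ∞ φ) (x₀ : S) (y₀ : N)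
    (ζ : ℂ) : ContDiffOn ℝ ∞ (fun z => pullConn g φ x₀ y₀ z ζ) (patch φ x₀ y₀) :=
  contDiffOn_connForm g (contDiffOn_localMap hφ x₀ y₀) (contDiffOn_dMap hφ x₀ y₀ ζ)
    fun _ hz => localMap_mem_target hz

theorem contDiffOn_pullForm (g : Metric N) (hφ : ContMDiff 𝓘(ℝ, ℂ) (𝓡 4) ∞ φ) (x₀ : S) (y₀ : N) :
    ContDiffOn ℝ ∞ (pullForm g φ x₀ y₀) (patch φ x₀ y₀) :=
  (contDiffOn_chartForm g y₀).comp (contDiffOn_localMap hφ x₀ y₀) fun _ hz => localMap_mem_target hz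

/-- The chain rule transports metric compatibility from the target to the pulled back connection. -/
theorem fderiv_pullForm (g : Metric N) (hφ : ContMDiff 𝓘(ℝ, ℂ) (𝓡 4) ∞ φ)
    (hz : z ∈ patch φ x₀ y₀) (ζ : ℂ) (v w : E4) :
    fderiv ℝ (pullForm g φ x₀ y₀) z ζ v w =
      pullForm g φ x₀ y₀ z (pullConn g φ x₀ y₀ z ζ v) w +
      pullForm g φ x₀ y₀ z v (pullConn g φ x₀ y₀ z ζ w) := by
  have h1 : DifferentiableAt ℝ (chartForm g y₀) (localMap φ x₀ y₀ z) :=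
    ((contDiffOn_chartForm g y₀).contDiffAt ((chartAt E4 y₀).open_target.mem_nhds
      (localMap_mem_target hz))).differentiableAt (by simp)
  have h2 : DifferentiableAt ℝ (localMap φ x₀ y₀) z :=
    ((contDiffOn_localMap hφ x₀ y₀).contDiffAt
      ((isOpen_patch hφ.continuous x₀ y₀).mem_nhds hz)).differentiableAt (by simp)
  have h3 : fderiv ℝ (pullForm g φ x₀ y₀) z ζ =
      fderiv ℝ (chartForm g y₀) (localMap φ x₀ y₀ z) (dMap φ x₀ y₀ z ζ) := by
    have h4 : HasFDerivAt (pullForm g φ x₀ y₀) ((fderiv ℝ (chartForm g y₀) (localMap φ x₀ y₀ z)) ∘L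
        fderiv ℝ (localMap φ x₀ y₀) z) z :=
      HasFDerivAt.comp (E := ℂ) (F := E4) (G := Bilin) (g := chartForm g y₀) z h1.hasFDerivAt
        h2.hasFDerivAt
    rw [h4.fderiv]
    rfl
  rw [h3]
  exact fderiv_chartForm g (localMap_mem_target hz) _ v w

end MapCharts

/-! ### Coefficients of sections in the basis E₁, E₂, E₃. -/

section Coefficients

variable {S : Type*} {N : Type*} [TopologicalSpace N] [ChartedSpace E4 N] [IsManifold (𝓡 4) ∞ N]
  {φ : S → N}

theorem frameSection_eq (g : Metric N) (e : ∀ x : S, Fin 4 → TangentSpace (𝓡 4) (φ x)) (i : Fin 3)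
    (x : S) : frameSection g φ e i x = fiberSd g (φ x) (e x) (Pi.single i 1) :=
  selfDual_eq g (φ x) (e x) i

theorem dot3_single (u : Fin 3 → ℝ) (i : Fin 3) : dot3 u (Pi.single i 1) = u i := by
  fin_cases i <;> simp [dot3]

/-- The trace of the product with E_i is -4u_i, which the two normalising factors 1/2 and -1/2 turn
into u_i. -/
theorem frameCoeff_fiberSd (g : Metric N) {e : ∀ x : S, Fin 4 → TangentSpace (𝓡 4) (φ x)} {x : S}
    (he : IsON (fiberForm g (φ x)) (e x)) {J : EndSection φ} {u : Fin 3 → ℝ}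
    (hJ : J x = fiberSd g (φ x) (e x) u) (i : Fin 3) : frameCoeff g φ e J i x = u i := by
  rw [frameCoeff, skewInner, hJ, frameSection_eq]
  have h : LinearMap.trace ℝ (TangentSpace (𝓡 4) (φ x)) (fiberSd g (φ x) (e x) u ∘L
      fiberSd g (φ x) (e x) (Pi.single i 1)).toLinearMap = -4 * dot3 u (Pi.single i 1) :=
    trace_sdEnd_mul he u (Pi.single i 1)
  rw [h, dot3_single]
  ring

theorem exists_fiberSd (g : Metric N) {y : N} {e : Fin 4 → TangentSpace (𝓡 4) y}
    (he : IsOrientedOrthonormal g y e) {K : EndT y} (hK : K ∈ twistorFiber g y) :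
    ∃ u : Fin 3 → ℝ, dot3 u u = 1 ∧ K = fiberSd g y e u :=
  exists_sdEnd_of_mem_twistorSet he.1 he.2 hK

theorem fiberSd_mem_twistorFiber (g : Metric N) {y : N} {e : Fin 4 → TangentSpace (𝓡 4) y}
    (he : IsOrientedOrthonormal g y e) {u : Fin 3 → ℝ} (hu : dot3 u u = 1) :
    fiberSd g y e u ∈ twistorFiber g y :=
  sdEnd_mem_twistorSet he.1 he.2 hu

theorem fiberSd_eq_sum (g : Metric N) (e : ∀ x : S, Fin 4 → TangentSpace (𝓡 4) (φ x)) (x : S)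
    (u : Fin 3 → ℝ) : fiberSd g (φ x) (e x) u = ∑ i, u i • frameSection g φ e i x := by
  simp only [frameSection_eq]
  exact sdEnd_eq_sum u

/-- The coefficients of a section of the twistor bundle in a frame. -/
theorem eq_fiberSd_frameCoeff (g : Metric N) {e : ∀ x : S, Fin 4 → TangentSpace (𝓡 4) (φ x)}
    {x : S} (he : IsOrientedOrthonormal g (φ x) (e x)) {J : EndSection φ}
    (hJ : J x ∈ twistorFiber g (φ x)) :
    J x = fiberSd g (φ x) (e x) (fun i => frameCoeff g φ e J i x) ∧
      dot3 (fun i => frameCoeff g φ e J i x) (fun i => frameCoeff g φ e J i x) = 1 := by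
  obtain ⟨u, hu, hJu⟩ := exists_fiberSd g he hJ
  have : (fun i => frameCoeff g φ e J i x) = u := funext fun i => frameCoeff_fiberSd g he.1 hJu i
  rw [this]
  exact ⟨hJu, hu⟩

end Coefficients

/-! ### Covariant derivatives in a moving frame. -/

section MovingFrame

theorem fderiv_mul_apply_clm {A B : ℂ → E4 →L[ℝ] E4} {z : ℂ} (hA : DifferentiableAt ℝ A z)
    (hB : DifferentiableAt ℝ B z) (ζ : ℂ) :
    fderiv ℝ (fun w => A w * B w) z ζ = A z * fderiv ℝ B z ζ + fderiv ℝ A z ζ * B z := by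
  have h : HasFDerivAt (fun w => A w * B w) _ z := hA.hasFDerivAt.clm_comp hB.hasFDerivAt
  rw [h.fderiv]
  rfl

theorem differentiableAt_frameMap {e : ℂ → Fin 4 → E4} {z : ℂ}
    (he : ∀ i, DifferentiableAt ℝ (fun w => e w i) z) :
    DifferentiableAt ℝ (fun w => frameMap (e w)) z := by
  unfold frameMap
  refine DifferentiableAt.fun_sum fun i _ => ?_
  exact (ContinuousLinearMap.smulRightL ℝ E4 E4
    (EuclideanSpace.proj (𝕜 := ℝ) i : E4 →L[ℝ] ℝ)).differentiableAt.comp z (he i)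

theorem differentiableAt_coframe {b : ℂ → Bilin} {e : ℂ → Fin 4 → E4} {z : ℂ}
    (hb : DifferentiableAt ℝ b z) (he : ∀ i, DifferentiableAt ℝ (fun w => e w i) z) :
    DifferentiableAt ℝ (fun w => coframe (b w) (e w)) z := by
  unfold coframe
  refine DifferentiableAt.fun_sum fun i _ => ?_
  exact ((ContinuousLinearMap.smulRightL ℝ E4 E4).flip (bvec i)).differentiableAt.comp z
    (hb.clm_apply (he i))

/-- The linear map `u ↦ sdMatrix u`, with values in the operators. -/
def sdMatrixL : (Fin 3 → ℝ) →L[ℝ] (E4 →L[ℝ] E4) :=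
  LinearMap.toContinuousLinearMap
    { toFun := fun u => matEnd (sdMatrix u)
      map_add' := fun u v => by rw [sdMatrix_add, matEnd_add]
      map_smul' := fun c u => by rw [sdMatrix_smul, matEnd_smul]; rfl }

theorem fderiv_frameMap_apply {e : ℂ → Fin 4 → E4} {z : ℂ}
    (he : ∀ i, DifferentiableAt ℝ (fun w => e w i) z) (ζ : ℂ) :
    fderiv ℝ (fun w => frameMap (e w)) z ζ = frameMap (fun i => fderiv ℝ (fun w => e w i) z ζ) := by
  ext v : 1
  have h1 : HasFDerivAt (fun w => frameMap (e w) v) _ z :=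
    (differentiableAt_frameMap he).hasFDerivAt.clm_apply (hasFDerivAt_const v z)
  have h2 : HasFDerivAt (fun w => frameMap (e w) v)
      (∑ i, v i • fderiv ℝ (fun w => e w i) z) z := by
    simp only [frameMap_apply]
    exact HasFDerivAt.fun_sum fun i _ => ((he i).hasFDerivAt).const_smul (v i)
  have h3 := DFunLike.congr_fun (h1.unique h2) ζ
  rw [frameMap_apply]
  simpa using h3

/-- The connection matrix of a frame in one direction; `e'` is the derivative of the frame. -/
def frameConn (b : Bilin) (e e' : Fin 4 → E4) (P : E4 →L[ℝ] E4) : Matrix (Fin 4) (Fin 4) ℝ :=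
  Matrix.of fun i j => b (e i) (e' j + P (e j))

theorem coframe_mul_deriv (b : Bilin) (e e' : Fin 4 → E4) (P : E4 →L[ℝ] E4) :
    coframe b e * (frameMap e' + P * frameMap e) = matEnd (frameConn b e e' P) := by
  ext v i
  have h1 : (coframe b e * (frameMap e' + P * frameMap e)) v i =
      b (e i) (frameMap e' v + P (frameMap e v)) := coframe_apply _ _ _ _
  rw [h1, matEnd_apply, frameMap_apply, frameMap_apply, map_sum, ← Finset.sum_add_distrib, map_sum]
  simp only [Matrix.mulVec, dotProduct, frameConn, Matrix.of_apply]
  refine Finset.sum_congr rfl fun j _ => ?_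
  rw [map_smul, ← smul_add, map_smul, smul_eq_mul, mul_comm]

/-- The hypotheses give C' = -CF'C. Hence the covariant derivative of FXC is conjugate to X' + [ω,
X], where ω = C(F' + PF) is the connection matrix of the frame. -/
theorem deriv_conj_add_commutator {R : Type*} [Ring R] {F C F' C' : R} (h : F * C = 1)
    (h' : C * F' + C' * F = 0) (X X' P : R) :
    F * X * C' + (F * X' + F' * X) * C + (P * (F * X * C) - F * X * C * P) =
      F * (X' + (C * (F' + P * F) * X - X * (C * (F' + P * F)))) * C := by
  have h7 : C' = -(C * F' * C) := by
    calc C' = C' * (F * C) := by rw [h, mul_one]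
      _ = (C' * F) * C := by rw [mul_assoc]
      _ = _ := by rw [eq_neg_of_add_eq_zero_right h', neg_mul]
  rw [h7]
  calc _ = F * X' * C + (1 * F' * X * C - F * X * (C * F') * C) +
        (1 * P * F * X * C - F * X * C * P * 1) := by noncomm_ring
    _ = F * X' * C + ((F * C) * F' * X * C - F * X * (C * F') * C) +
        ((F * C) * P * F * X * C - F * X * C * P * (F * C)) := by rw [h]
    _ = _ := by noncomm_ring

variable {b : ℂ → Bilin} {e : ℂ → Fin 4 → E4} {z ζ : ℂ} {P : E4 →L[ℝ] E4}

/-- Differentiate ⟨e_i, e_j⟩ = δ_ij and use metric compatibility. Skewness is what allows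
`commutator_sdMatrix` to be applied. -/
theorem frameConn_skew (hb : DifferentiableAt ℝ b z)
    (he : ∀ i, DifferentiableAt ℝ (fun w => e w i) z) (hon : ∀ᶠ w in 𝓝 z, IsON (b w) (e w))
    (hs : ∀ v w, b z v w = b z w v)
    (hP : ∀ v w, fderiv ℝ b z ζ v w = b z (P v) w + b z v (P w)) (i j : Fin 4) :
    frameConn (b z) (e z) (fun i => fderiv ℝ (fun w => e w i) z ζ) P i j =
      -frameConn (b z) (e z) (fun i => fderiv ℝ (fun w => e w i) z ζ) P j i := by
  have h1 : HasFDerivAt (fun w => b w (e w i) (e w j)) _ z :=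
    (hb.hasFDerivAt.clm_apply (he i).hasFDerivAt).clm_apply (he j).hasFDerivAt
  have h2 : HasFDerivAt (fun w => b w (e w i) (e w j)) (0 : ℂ →L[ℝ] ℝ) z := by
    refine HasFDerivAt.congr_of_eventuallyEq (hasFDerivAt_const (if i = j then (1 : ℝ) else 0) z) ?_
    filter_upwards [hon] with w hw
    exact hw i j
  have h3 := DFunLike.congr_fun (h1.unique h2) ζ
  have h4 : b z (e z i) (fderiv ℝ (fun w => e w j) z ζ) + (b z (fderiv ℝ (fun w => e w i) z ζ) (e z j)
      + fderiv ℝ b z ζ (e z i) (e z j)) = 0 := h3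
  rw [hP] at h4
  simp only [frameConn, Matrix.of_apply, map_add]
  rw [hs (e z j), hs (e z j)]
  linarith

/-- The covariant derivative of a self-dual endomorphism in a moving frame. -/
theorem covDeriv_sdEnd (hb : DifferentiableAt ℝ b z)
    (he : ∀ i, DifferentiableAt ℝ (fun w => e w i) z) (hon : ∀ᶠ w in 𝓝 z, IsON (b w) (e w))
    (hs : ∀ v w, b z v w = b z w v)
    (hP : ∀ v w, fderiv ℝ b z ζ v w = b z (P v) w + b z v (P w))
    {u : ℂ → Fin 3 → ℝ} (hu : DifferentiableAt ℝ u z) :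
    fderiv ℝ (fun w => sdEnd (b w) (e w) (u w)) z ζ +
        (P * sdEnd (b z) (e z) (u z) - sdEnd (b z) (e z) (u z) * P) =
      sdEnd (b z) (e z) (fderiv ℝ u z ζ + cross3 (sdRotation
        (frameConn (b z) (e z) (fun i => fderiv ℝ (fun w => e w i) z ζ) P)) (u z)) := by
  have hF := differentiableAt_frameMap he
  have hC := differentiableAt_coframe hb he
  have hX : HasFDerivAt (fun w => matEnd (sdMatrix (u w))) (sdMatrixL ∘L fderiv ℝ u z) z :=
    sdMatrixL.hasFDerivAt.comp z hu.hasFDerivAt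
  have hX' : fderiv ℝ (fun w => matEnd (sdMatrix (u w))) z ζ = matEnd (sdMatrix (fderiv ℝ u z ζ)) := by
    rw [hX.fderiv]; rfl
  have hFX : DifferentiableAt ℝ (fun w => frameMap (e w) * matEnd (sdMatrix (u w))) z :=
    hF.clm_comp hX.differentiableAt
  have h1 : fderiv ℝ (fun w => sdEnd (b w) (e w) (u w)) z ζ = _ := fderiv_mul_apply_clm hFX hC ζ
  rw [h1, fderiv_mul_apply_clm hF hX.differentiableAt, hX']
  have hon0 := hon.self_of_nhds
  have hCF : coframe (b z) (e z) * fderiv ℝ (fun w => frameMap (e w)) z ζ +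
      fderiv ℝ (fun w => coframe (b w) (e w)) z ζ * frameMap (e z) = 0 := by
    rw [← fderiv_mul_apply_clm hC hF]
    have : HasFDerivAt (fun w => coframe (b w) (e w) * frameMap (e w))
        (0 : ℂ →L[ℝ] (E4 →L[ℝ] E4)) z := by
      refine HasFDerivAt.congr_of_eventuallyEq (hasFDerivAt_const (1 : E4 →L[ℝ] E4) z) ?_
      filter_upwards [hon] with w hw
      exact coframe_mul_frameMap hw
    rw [this.fderiv]
    rfl
  have hM := coframe_mul_deriv (b z) (e z) (fun i => fderiv ℝ (fun w => e w i) z ζ) P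
  have hW := commutator_sdMatrix (frameConn_skew hb he hon hs hP) (u z)
  rw [← fderiv_frameMap_apply he] at hM
  simp only [sdEnd]
  rw [sdMatrix_add, matEnd_add, ← hW, matEnd_sub, matEnd_mul, matEnd_mul, ← hM]
  exact deriv_conj_add_commutator (frameMap_mul_coframe hon0) hCF _ _ _

end MovingFrame

/-! ### The Cauchy–Riemann equation in terms of frame coefficients. -/

section Holomorphy

variable {S : Type*} [TopologicalSpace S] [ChartedSpace ℂ S]
  {N : Type*} [TopologicalSpace N] [ChartedSpace E4 N] [IsManifold (𝓡 4) ∞ N]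
  {φ : S → N} {x₀ : S} {y₀ : N} {z : ℂ} {J : EndSection φ} {g : Metric N}
  {e : ∀ x : S, Fin 4 → TangentSpace (𝓡 4) (φ x)}

/-- The covariant derivative of a section in coordinates. -/
def covDeriv (g : Metric N) (φ : S → N) (J : EndSection φ) (x₀ : S) (y₀ : N) (z ζ : ℂ) :
    E4 →L[ℝ] E4 :=
  fderiv ℝ (localSection φ J x₀ y₀) z ζ + (pullConn g φ x₀ y₀ z ζ * localSection φ J x₀ y₀ z -
    localSection φ J x₀ y₀ z * pullConn g φ x₀ y₀ z ζ)

theorem fderiv_graphMap (h : DifferentiableAt ℝ (localSection φ J x₀ y₀) z) (ζ : ℂ) :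
    fderiv ℝ (graphMap φ J x₀ y₀) z ζ = (ζ, fderiv ℝ (localSection φ J x₀ y₀) z ζ) := by
  have : HasFDerivAt (graphMap φ J x₀ y₀) _ z := (hasFDerivAt_id z).prodMk h.hasFDerivAt
  rw [this.fderiv]
  rfl

theorem verticalPart_graphMap (h : DifferentiableAt ℝ (localSection φ J x₀ y₀) z) (ζ : ℂ) :
    verticalPart g φ x₀ y₀ (graphMap φ J x₀ y₀ z) (fderiv ℝ (graphMap φ J x₀ y₀) z ζ) =
      covDeriv g φ J x₀ y₀ z ζ := by
  rw [fderiv_graphMap h]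
  rfl

theorem covDeriv_add_smul (a b : ℝ) (ζ η : ℂ) :
    covDeriv g φ J x₀ y₀ z (a • ζ + b • η) =
      a • covDeriv g φ J x₀ y₀ z ζ + b • covDeriv g φ J x₀ y₀ z η := by
  simp only [covDeriv, pullConn_add_smul, map_add, map_smul, add_mul, mul_add, clm_mul_smul,
    clm_smul_mul]
  module

/-- The Cauchy-Riemann equation of a section. -/
theorem intertwines_iff (h : DifferentiableAt ℝ (localSection φ J x₀ y₀) z)
    (hK : localSection φ J x₀ y₀ z * localSection φ J x₀ y₀ z = -1) :
    (∀ ζ : ℂ, fderiv ℝ (graphMap φ J x₀ y₀) z (Complex.I * ζ) =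
      twistorJ g φ x₀ y₀ (graphMap φ J x₀ y₀ z) (fderiv ℝ (graphMap φ J x₀ y₀) z ζ)) ↔
    covDeriv g φ J x₀ y₀ z Complex.I = covDeriv g φ J x₀ y₀ z 1 * localSection φ J x₀ y₀ z := by
  have key : ∀ ζ : ℂ, (fderiv ℝ (graphMap φ J x₀ y₀) z (Complex.I * ζ) =
      twistorJ g φ x₀ y₀ (graphMap φ J x₀ y₀ z) (fderiv ℝ (graphMap φ J x₀ y₀) z ζ)) ↔
      covDeriv g φ J x₀ y₀ z (Complex.I * ζ) =
        covDeriv g φ J x₀ y₀ z ζ * localSection φ J x₀ y₀ z := by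
    intro ζ
    have h1 : twistorJ g φ x₀ y₀ (graphMap φ J x₀ y₀ z) (fderiv ℝ (graphMap φ J x₀ y₀) z ζ) =
        (Complex.I * ζ, -(pullConn g φ x₀ y₀ z (Complex.I * ζ) * localSection φ J x₀ y₀ z -
          localSection φ J x₀ y₀ z * pullConn g φ x₀ y₀ z (Complex.I * ζ)) +
          covDeriv g φ J x₀ y₀ z ζ * localSection φ J x₀ y₀ z) := by
      rw [twistorJ, verticalPart_graphMap h, fderiv_graphMap h]
      refine Prod.ext ?_ ?_
      · exact add_zero _
      · rfl
    rw [h1, fderiv_graphMap h, Prod.mk.injEq]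
    have hc : covDeriv g φ J x₀ y₀ z (Complex.I * ζ) =
        fderiv ℝ (localSection φ J x₀ y₀) z (Complex.I * ζ) +
        (pullConn g φ x₀ y₀ z (Complex.I * ζ) * localSection φ J x₀ y₀ z -
          localSection φ J x₀ y₀ z * pullConn g φ x₀ y₀ z (Complex.I * ζ)) := rfl
    rw [hc]
    constructor
    · rintro ⟨-, h2⟩
      rw [h2]
      abel
    · intro h2
      refine ⟨rfl, ?_⟩
      rw [← h2]
      abel
  simp only [key]
  constructor
  · intro h1
    simpa using h1 1
  -- The covariant derivative is real linear in the direction. Its value at i determines the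
  -- equation in direction i as well, because K² = -1.
  · intro h1 ζ
    have h2 : ζ = ζ.re • (1 : ℂ) + ζ.im • Complex.I := by
      apply Complex.ext <;> simp
    have h3 : Complex.I * ζ = (-ζ.im) • (1 : ℂ) + ζ.re • Complex.I := by
      apply Complex.ext <;> simp
    have h4 : covDeriv g φ J x₀ y₀ z 1 * localSection φ J x₀ y₀ z * localSection φ J x₀ y₀ z =
        -covDeriv g φ J x₀ y₀ z 1 := by
      rw [mul_assoc, hK]
      ext v : 1
      exact map_neg (covDeriv g φ J x₀ y₀ z 1) v
    rw [h3, covDeriv_add_smul]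
    conv_rhs => rw [h2, covDeriv_add_smul]
    rw [add_mul, clm_smul_mul, clm_smul_mul, h1, h4]
    module

theorem pullForm_symm (z : ℂ) (v w : E4) :
    pullForm g φ x₀ y₀ z v w = pullForm g φ x₀ y₀ z w v :=
  chartForm_symm g y₀ _ v w

/-- The vector `θ` with `∇ (∑ u_i E_i) = ∑ (∂ u + θ × u)_i E_i`. -/
def frameRot (g : Metric N) (φ : S → N) (e : ∀ x : S, Fin 4 → TangentSpace (𝓡 4) (φ x)) (x₀ : S)
    (y₀ : N) (z ζ : ℂ) : Fin 3 → ℝ :=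
  sdRotation (frameConn (pullForm g φ x₀ y₀ z) (chartFrame φ e x₀ y₀ z)
    (fun i => fderiv ℝ (fun w => chartFrame φ e x₀ y₀ w i) z ζ) (pullConn g φ x₀ y₀ z ζ))

/-- The coefficients of the covariant derivative of `∑ u_i E_i`. -/
def covVec (g : Metric N) (φ : S → N) (e : ∀ x : S, Fin 4 → TangentSpace (𝓡 4) (φ x)) (x₀ : S)
    (y₀ : N) (u : ℂ → Fin 3 → ℝ) (z ζ : ℂ) : Fin 3 → ℝ :=
  fderiv ℝ u z ζ + cross3 (frameRot g φ e x₀ y₀ z ζ) (u z)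

theorem sdEnd_injective {b : Bilin} {e : Fin 4 → E4} (h : IsON b e) :
    Function.Injective (sdEnd b e) := by
  intro u v huv
  rw [← sub_eq_zero]
  refine eq_zero_of_sdEnd_apply_eq_zero h (v := bvec 0) (by simp) ?_
  rw [sdEnd_sub, huv, sub_self]
  rfl

variable {U : Set S}

variable [IsManifold 𝓘(ℂ) ω S]

theorem covDeriv_eq (hφ : ContMDiff 𝓘(ℝ, ℂ) (𝓡 4) ∞ φ) (hU : IsOpen U) (he : IsLocalFrame g φ U e)
    (hz : z ∈ patch φ x₀ y₀ ∩ pt x₀ ⁻¹' U) {u : ℂ → Fin 3 → ℝ} (hu : DifferentiableAt ℝ u z)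
    (hJ : ∀ᶠ w in 𝓝 z, J (pt x₀ w) = fiberSd g (φ (pt x₀ w)) (e (pt x₀ w)) (u w)) (ζ : ℂ) :
    covDeriv g φ J x₀ y₀ z ζ = sdEnd (pullForm g φ x₀ y₀ z) (chartFrame φ e x₀ y₀ z)
      (covVec g φ e x₀ y₀ u z ζ) := by
  have hev := eventually_mem_patch hφ.continuous hU hz
  have h1 : localSection φ J x₀ y₀ =ᶠ[𝓝 z]
      fun w => sdEnd (pullForm g φ x₀ y₀ w) (chartFrame φ e x₀ y₀ w) (u w) := by
    filter_upwards [hJ, hev] with w hw hw'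
    exact localSection_fiberSd g hw'.1 hw
  rw [covDeriv, h1.fderiv_eq, h1.self_of_nhds]
  have hon : ∀ᶠ w in 𝓝 z, IsON (pullForm g φ x₀ y₀ w) (chartFrame φ e x₀ y₀ w) := by
    filter_upwards [hev] with w hw
    exact isON_chartFrame g hw.1 (he.orthonormal _ hw.2).1
  exact covDeriv_sdEnd
    (((contDiffOn_pullForm g hφ x₀ y₀).contDiffAt
      ((isOpen_patch hφ.continuous x₀ y₀).mem_nhds hz.1)).differentiableAt (by simp))
    (fun i => ((he.smooth x₀ y₀ i).contDiffAt
      ((isOpen_patch_inter hφ.continuous x₀ y₀ hU).mem_nhds hz)).differentiableAt (by simp))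
    hon (pullForm_symm z) (fderiv_pullForm g hφ hz.1 ζ) hu

/-- Holomorphy in terms of the coefficients in a frame. -/
theorem covDeriv_sub_eq (hφ : ContMDiff 𝓘(ℝ, ℂ) (𝓡 4) ∞ φ) (hU : IsOpen U)
    (he : IsLocalFrame g φ U e) (hz : z ∈ patch φ x₀ y₀ ∩ pt x₀ ⁻¹' U) {u : ℂ → Fin 3 → ℝ}
    (hu : DifferentiableAt ℝ u z)
    (hJ : ∀ᶠ w in 𝓝 z, J (pt x₀ w) = fiberSd g (φ (pt x₀ w)) (e (pt x₀ w)) (u w))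
    (hu1 : ∀ᶠ w in 𝓝 z, dot3 (u w) (u w) = 1) :
    covDeriv g φ J x₀ y₀ z Complex.I - covDeriv g φ J x₀ y₀ z 1 * localSection φ J x₀ y₀ z =
      sdEnd (pullForm g φ x₀ y₀ z) (chartFrame φ e x₀ y₀ z)
        (covVec g φ e x₀ y₀ u z Complex.I - cross3 (u z) (covVec g φ e x₀ y₀ u z 1)) := by
  have hon := isON_chartFrame (y₀ := y₀) g hz.1 (he.orthonormal _ hz.2).1
  -- Since |u| = 1, the derivative of u is orthogonal to u, and so is the rotation term. The scalar
  -- part of the quaternion product therefore vanishes.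
  have h0 : dot3 (covVec g φ e x₀ y₀ u z 1) (u z) = 0 := by
    have h1 : ∀ i, HasFDerivAt (fun w => u w i) (ContinuousLinearMap.proj i ∘L fderiv ℝ u z) z :=
      fun i => (hasFDerivAt_pi'.1 hu.hasFDerivAt) i
    have h2 : HasFDerivAt (fun w => dot3 (u w) (u w)) _ z :=
      (((h1 0).mul (h1 0)).add ((h1 1).mul (h1 1))).add ((h1 2).mul (h1 2))
    have h3 : HasFDerivAt (fun w => dot3 (u w) (u w)) (0 : ℂ →L[ℝ] ℝ) z :=
      (hasFDerivAt_const (1 : ℝ) z).congr_of_eventuallyEq hu1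
    have h4 := DFunLike.congr_fun (h2.unique h3) 1
    have h5 : u z 0 * fderiv ℝ u z 1 0 + u z 0 * fderiv ℝ u z 1 0 +
        (u z 1 * fderiv ℝ u z 1 1 + u z 1 * fderiv ℝ u z 1 1) +
        (u z 2 * fderiv ℝ u z 1 2 + u z 2 * fderiv ℝ u z 1 2) = 0 := by simpa using h4
    simp only [covVec, dot3, Pi.add_apply, cross3, Matrix.cons_val]
    linear_combination (1 / 2) * h5
  rw [covDeriv_eq hφ hU he hz hu hJ, covDeriv_eq hφ hU he hz hu hJ,
    localSection_fiberSd g hz.1 hJ.self_of_nhds, sdEnd_mul hon, h0]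
  have hz : (-(0 : ℝ)) • (1 : E4 →L[ℝ] E4) = 0 := by ext; simp
  rw [hz, zero_add, sdEnd_sub]

theorem cauchyRiemann_iff (hφ : ContMDiff 𝓘(ℝ, ℂ) (𝓡 4) ∞ φ) (hU : IsOpen U)
    (he : IsLocalFrame g φ U e) (hz : z ∈ patch φ x₀ y₀ ∩ pt x₀ ⁻¹' U) {u : ℂ → Fin 3 → ℝ}
    (hu : DifferentiableAt ℝ u z)
    (hJ : ∀ᶠ w in 𝓝 z, J (pt x₀ w) = fiberSd g (φ (pt x₀ w)) (e (pt x₀ w)) (u w))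
    (hu1 : ∀ᶠ w in 𝓝 z, dot3 (u w) (u w) = 1) :
    (covDeriv g φ J x₀ y₀ z Complex.I = covDeriv g φ J x₀ y₀ z 1 * localSection φ J x₀ y₀ z) ↔
      covVec g φ e x₀ y₀ u z Complex.I = cross3 (u z) (covVec g φ e x₀ y₀ u z 1) := by
  have hon := isON_chartFrame (y₀ := y₀) g hz.1 (he.orthonormal _ hz.2).1
  rw [← sub_eq_zero, covDeriv_sub_eq hφ hU he hz hu hJ hu1, ← sub_eq_zero (b := cross3 _ _),
    ← (sdEnd_injective hon).eq_iff, sdEnd_zero]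

/-- E_j has constant coefficients, so only the rotation term of its covariant derivative survives.
The trace against E_i reads off a component. -/
theorem frameChristoffel_eq (hφ : ContMDiff 𝓘(ℝ, ℂ) (𝓡 4) ∞ φ) (hU : IsOpen U)
    (he : IsLocalFrame g φ U e) (hz : z ∈ patch φ x₀ y₀ ∩ pt x₀ ⁻¹' U) (α : Fin 2) (i j : Fin 3) :
    frameChristoffel g φ e x₀ y₀ z α i j =
      cross3 (frameRot g φ e x₀ y₀ z (dir α)) (Pi.single j 1) i := by
  have hon := isON_chartFrame (y₀ := y₀) g hz.1 (he.orthonormal _ hz.2).1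
  have hev := eventually_mem_patch hφ.continuous hU hz
  have hb : DifferentiableAt ℝ (pullForm g φ x₀ y₀) z :=
    ((contDiffOn_pullForm g hφ x₀ y₀).contDiffAt
      ((isOpen_patch hφ.continuous x₀ y₀).mem_nhds hz.1)).differentiableAt (by simp)
  have hF : ∀ i, DifferentiableAt ℝ (fun w => chartFrame φ e x₀ y₀ w i) z := fun i =>
    ((he.smooth x₀ y₀ i).contDiffAt
      ((isOpen_patch_inter hφ.continuous x₀ y₀ hU).mem_nhds hz)).differentiableAt (by simp)
  have hd : DifferentiableAt ℝ (localSection φ (frameSection g φ e j) x₀ y₀) z := by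
    have h1 : localSection φ (frameSection g φ e j) x₀ y₀ =ᶠ[𝓝 z] fun w =>
        sdEnd (pullForm g φ x₀ y₀ w) (chartFrame φ e x₀ y₀ w) (Pi.single j 1) := by
      filter_upwards [hev] with w hw
      exact localSection_fiberSd g hw.1 (frameSection_eq g e j _)
    refine DifferentiableAt.congr_of_eventuallyEq ?_ h1
    exact ((differentiableAt_frameMap hF).clm_comp
      (differentiableAt_const (matEnd (sdMatrix (Pi.single j 1))))).clm_comp
      (differentiableAt_coframe hb hF)
  rw [frameChristoffel, verticalPart_graphMap hd, covDeriv_eq hφ hU he hz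
    (differentiableAt_const (Pi.single j 1)) (.of_forall fun w => frameSection_eq g e j _),
    localSection_fiberSd g hz.1 (frameSection_eq g e i _)]
  have h2 := trace_sdEnd_mul hon (covVec g φ e x₀ y₀ (fun _ => Pi.single j 1) z (dir α))
    (Pi.single i 1)
  rw [ContinuousLinearMap.mul_def] at h2
  rw [h2, dot3_single, covVec]
  simp
  ring

theorem sum_frameChristoffel (hφ : ContMDiff 𝓘(ℝ, ℂ) (𝓡 4) ∞ φ) (hU : IsOpen U)
    (he : IsLocalFrame g φ U e) (hz : z ∈ patch φ x₀ y₀ ∩ pt x₀ ⁻¹' U) (α : Fin 2) (u : Fin 3 → ℝ)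
    (i : Fin 3) : ∑ j, frameChristoffel g φ e x₀ y₀ z α i j * u j =
      cross3 (frameRot g φ e x₀ y₀ z (dir α)) u i := by
  simp only [frameChristoffel_eq hφ hU he hz, Fin.sum_univ_three]
  fin_cases i <;> simp [cross3] <;> ring

theorem contDiffOn_frameRot (hφ : ContMDiff 𝓘(ℝ, ℂ) (𝓡 4) ∞ φ) (hU : IsOpen U)
    (he : IsLocalFrame g φ U e) (ζ : ℂ) (i : Fin 3) :
    ContDiffOn ℝ ∞ (fun z => frameRot g φ e x₀ y₀ z ζ i) (patch φ x₀ y₀ ∩ pt x₀ ⁻¹' U) := by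
  have hW : ∀ i j, ContDiffOn ℝ ∞ (fun z => frameConn (pullForm g φ x₀ y₀ z)
      (chartFrame φ e x₀ y₀ z) (fun i => fderiv ℝ (fun w => chartFrame φ e x₀ y₀ w i) z ζ)
      (pullConn g φ x₀ y₀ z ζ) i j) (patch φ x₀ y₀ ∩ pt x₀ ⁻¹' U) := by
    intro i j
    simp only [frameConn, Matrix.of_apply]
    refine (((contDiffOn_pullForm g hφ x₀ y₀).mono Set.inter_subset_left).clm_apply
      (he.smooth x₀ y₀ i)).clm_apply (ContDiffOn.add ?_ ?_)
    · exact ((he.smooth x₀ y₀ j).fderiv_of_isOpen (m := ∞)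
        (isOpen_patch_inter hφ.continuous x₀ y₀ hU) (by simp)).clm_apply contDiffOn_const
    · exact ((contDiffOn_pullConn g hφ x₀ y₀ ζ).mono Set.inter_subset_left).clm_apply
        (he.smooth x₀ y₀ j)
  fin_cases i
  · exact ((hW 0 1).add (hW 2 3)).neg
  · exact ((hW 0 2).sub (hW 1 3)).neg
  · exact ((hW 0 3).add (hW 1 2)).neg

theorem contDiffOn_frameChristoffel (hφ : ContMDiff 𝓘(ℝ, ℂ) (𝓡 4) ∞ φ) (hU : IsOpen U)
    (he : IsLocalFrame g φ U e) :
    ContDiffOn ℝ ∞ (frameChristoffel g φ e x₀ y₀) (patch φ x₀ y₀ ∩ pt x₀ ⁻¹' U) := by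
  refine contDiffOn_pi.2 fun α => contDiffOn_pi.2 fun i => contDiffOn_pi.2 fun j => ?_
  refine ContDiffOn.congr ?_ fun z hz => frameChristoffel_eq hφ hU he hz α i j
  have h := fun k => contDiffOn_frameRot (x₀ := x₀) (y₀ := y₀) hφ hU he (dir α) k
  have hc : ∀ c : ℝ, ContDiffOn ℝ ∞ (fun _ : ℂ => c) (patch φ x₀ y₀ ∩ pt x₀ ⁻¹' U) :=
    fun c => contDiffOn_const
  fin_cases i
  · exact ((h 1).mul (hc _)).sub ((h 2).mul (hc _))
  · exact ((h 2).mul (hc _)).sub ((h 0).mul (hc _))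
  · exact ((h 0).mul (hc _)).sub ((h 1).mul (hc _))

end Holomorphy

/-! ### The explicit elliptic system over the lower half sphere. -/

section System

/-- The negative height function over the disc. -/
def lowerHeight (u : Fin 2 → ℝ) : ℝ := -√(1 - (u 0 ^ 2 + u 1 ^ 2))

/-- The point of the lower half sphere over a point of the disc. -/
def lowerPoint (u : Fin 2 → ℝ) : Fin 3 → ℝ := ![lowerHeight u, u 0, u 1]

theorem lowerHeight_neg {u : Fin 2 → ℝ} (hu : u ∈ disc) : lowerHeight u < 0 :=
  neg_neg_iff_pos.2 (Real.sqrt_pos.2 (sub_pos.2 hu))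

theorem lowerHeight_sq {u : Fin 2 → ℝ} (hu : u ∈ disc) :
    lowerHeight u ^ 2 = 1 - (u 0 ^ 2 + u 1 ^ 2) := by
  rw [lowerHeight, neg_sq, Real.sq_sqrt (sub_pos.2 hu).le]

theorem contDiffOn_lowerHeight : ContDiffOn ℝ ∞ lowerHeight disc := by
  refine ContDiffOn.neg (ContDiffOn.sqrt ?_ fun u hu => (sub_pos.2 hu).ne')
  exact ContDiff.contDiffOn (by fun_prop)

/-- The matrix of the first principal coefficient. -/
def principalMatrix (u : Fin 2 → ℝ) : Matrix (Fin 2) (Fin 2) ℝ :=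
  !![u 0 * u 1 / lowerHeight u, lowerHeight u + u 1 ^ 2 / lowerHeight u;
    -(lowerHeight u + u 0 ^ 2 / lowerHeight u), -(u 0 * u 1 / lowerHeight u)]

/-- The principal coefficients of the equation of holomorphic sections. -/
def principalPart : Principal :=
  ![fun u => (Matrix.toLin' (principalMatrix u)).toContinuousLinearMap,
    fun _ => ContinuousLinearMap.id ℝ _]

/-- The lower order term of the equation of holomorphic sections. -/
def lowerOrderPart : LowerOrder := fun u => LinearMap.toContinuousLinearMap
  { toFun := fun Γ =>
      ![∑ j, (Γ 1 1 j - (u 1 * Γ 0 0 j - lowerHeight u * Γ 0 2 j)) * lowerPoint u j,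
        ∑ j, (Γ 1 2 j - (lowerHeight u * Γ 0 1 j - u 0 * Γ 0 0 j)) * lowerPoint u j]
    map_add' := fun Γ Γ' => by
      ext i; fin_cases i <;> simp [Fin.sum_univ_three] <;> ring
    map_smul' := fun c Γ => by
      ext i; fin_cases i <;> simp [Fin.sum_univ_three] <;> ring }

theorem contDiffOn_principalPart (α : Fin 2) : ContDiffOn ℝ ∞ (principalPart α) disc := by
  have hs := contDiffOn_lowerHeight
  have hs0 : ∀ u ∈ disc, lowerHeight u ≠ 0 := fun u hu => (lowerHeight_neg hu).ne
  have hc : ∀ i : Fin 2, ContDiffOn ℝ ∞ (fun u : Fin 2 → ℝ => u i) disc :=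
    fun i => ContDiff.contDiffOn (contDiff_apply ℝ ℝ i)
  fin_cases α
  · refine contDiffOn_clm_apply.2 fun v => contDiffOn_pi.2 fun i => ?_
    have h : ∀ u, principalPart 0 u v i = (principalMatrix u).mulVec v i := fun u => rfl
    refine ContDiffOn.congr ?_ fun u _ => h u
    simp only [Matrix.mulVec, dotProduct, Fin.sum_univ_two]
    fin_cases i
    · exact (((((hc 0).mul (hc 1)).div hs hs0)).mul contDiffOn_const).add
        ((hs.add (((hc 1).pow 2).div hs hs0)).mul contDiffOn_const)
    · exact (((hs.add (((hc 0).pow 2).div hs hs0)).neg).mul contDiffOn_const).add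
        (((((hc 0).mul (hc 1)).div hs hs0)).neg.mul contDiffOn_const)
  · exact contDiffOn_const

theorem contDiffOn_lowerOrderPart : ContDiffOn ℝ ∞ lowerOrderPart disc := by
  have hs := contDiffOn_lowerHeight
  have hc : ∀ i : Fin 2, ContDiffOn ℝ ∞ (fun u : Fin 2 → ℝ => u i) disc :=
    fun i => ContDiff.contDiffOn (contDiff_apply ℝ ℝ i)
  have hp : ∀ j, ContDiffOn ℝ ∞ (fun u => lowerPoint u j) disc := by
    intro j
    fin_cases j
    exacts [hs, hc 0, hc 1]
  refine contDiffOn_clm_apply.2 fun Γ => contDiffOn_pi.2 fun i => ?_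
  have h0 : ∀ u, lowerOrderPart u Γ 0 =
      ∑ j, (Γ 1 1 j - (u 1 * Γ 0 0 j - lowerHeight u * Γ 0 2 j)) * lowerPoint u j := fun _ => rfl
  have h1 : ∀ u, lowerOrderPart u Γ 1 =
      ∑ j, (Γ 1 2 j - (lowerHeight u * Γ 0 1 j - u 0 * Γ 0 0 j)) * lowerPoint u j := fun _ => rfl
  fin_cases i
  · refine ContDiffOn.congr ?_ fun u _ => h0 u
    exact ContDiffOn.sum fun j _ => (contDiffOn_const.sub (((hc 1).mul contDiffOn_const).sub
      (hs.mul contDiffOn_const))).mul (hp j)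
  · refine ContDiffOn.congr ?_ fun u _ => h1 u
    exact ContDiffOn.sum fun j _ => (contDiffOn_const.sub ((hs.mul contDiffOn_const).sub
      ((hc 0).mul contDiffOn_const))).mul (hp j)

/-- The first coefficient has trace 0 and, because the point lies on the unit sphere, determinant 1.
With the identity as second coefficient, the symbol has determinant |ξ|². -/
theorem isElliptic_principalPart : IsElliptic principalPart := by
  intro u hu ξ hξ
  have h1 : (ξ 0 • principalPart 0 u + ξ 1 • principalPart 1 u).det =
      (ξ 0 • principalMatrix u + ξ 1 • (1 : Matrix (Fin 2) (Fin 2) ℝ)).det := by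
    rw [← LinearMap.det_toLin', ContinuousLinearMap.det]
    congr 1
    rw [map_add, map_smul, map_smul, Matrix.toLin'_one]
    rfl
  have hs := (lowerHeight_neg hu).ne
  have hq := lowerHeight_sq hu
  have h2 : (ξ 0 • principalMatrix u + ξ 1 • (1 : Matrix (Fin 2) (Fin 2) ℝ)).det =
      ξ 0 ^ 2 + ξ 1 ^ 2 := by
    rw [Matrix.det_fin_two]
    simp [principalMatrix]
    field_simp
    linear_combination (ξ 0) ^ 2 * lowerHeight u ^ 2 * hq
  rw [h1, h2]
  intro h
  refine hξ ?_
  have h3 : ξ 0 = 0 := by nlinarith [sq_nonneg (ξ 0), sq_nonneg (ξ 1)]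
  have h4 : ξ 1 = 0 := by nlinarith [sq_nonneg (ξ 0), sq_nonneg (ξ 1)]
  ext i
  fin_cases i
  exacts [h3, h4]

/-- The system is the equation `D₂ = u × D₁` for maps into the lower half sphere. -/
theorem solvesAt_iff {u : ℂ → Fin 3 → ℝ} {z : ℂ} (hu : DifferentiableAt ℝ u z)
    (hu1 : ∀ᶠ w in 𝓝 z, dot3 (u w) (u w) = 1) (hneg : u z 0 < 0) {Γ : Fin 2 → Fin 3 → Fin 3 → ℝ}
    {θ : Fin 2 → Fin 3 → ℝ} (hΓ : ∀ α i, ∑ j, Γ α i j * u z j = cross3 (θ α) (u z) i) :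
    SolvesAt principalPart lowerOrderPart Γ (fun w => ![u w 1, u w 2]) z ↔
      fderiv ℝ u z (dir 1) + cross3 (θ 1) (u z) =
        cross3 (u z) (fderiv ℝ u z (dir 0) + cross3 (θ 0) (u z)) := by
  have hi : ∀ i, HasFDerivAt (fun w => u w i) (ContinuousLinearMap.proj i ∘L fderiv ℝ u z) z :=
    fun i => (hasFDerivAt_pi'.1 hu.hasFDerivAt) i
  have hd : ∀ ζ, u z 0 * fderiv ℝ u z ζ 0 + u z 1 * fderiv ℝ u z ζ 1 +
      u z 2 * fderiv ℝ u z ζ 2 = 0 := by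
    intro ζ
    have h2 : HasFDerivAt (fun w => dot3 (u w) (u w)) _ z :=
      (((hi 0).mul (hi 0)).add ((hi 1).mul (hi 1))).add ((hi 2).mul (hi 2))
    have h3 : HasFDerivAt (fun w => dot3 (u w) (u w)) (0 : ℂ →L[ℝ] ℝ) z :=
      (hasFDerivAt_const (1 : ℝ) z).congr_of_eventuallyEq hu1
    have h4 := DFunLike.congr_fun (h2.unique h3) ζ
    have h5 : u z 0 * fderiv ℝ u z ζ 0 + u z 0 * fderiv ℝ u z ζ 0 +
        (u z 1 * fderiv ℝ u z ζ 1 + u z 1 * fderiv ℝ u z ζ 1) +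
        (u z 2 * fderiv ℝ u z ζ 2 + u z 2 * fderiv ℝ u z ζ 2) = 0 := by simpa using h4
    linear_combination (1 / 2) * h5
  have hv : HasFDerivAt (fun w => (![u w 1, u w 2] : Fin 2 → ℝ))
      (ContinuousLinearMap.pi ![ContinuousLinearMap.proj 1 ∘L fderiv ℝ u z,
        ContinuousLinearMap.proj 2 ∘L fderiv ℝ u z]) z := by
    refine hasFDerivAt_pi.2 fun i => ?_
    fin_cases i
    exacts [hi 1, hi 2]
  have hn : u z 0 ^ 2 + u z 1 ^ 2 + u z 2 ^ 2 = 1 := by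
    have := hu1.self_of_nhds
    simp only [dot3] at this
    linear_combination this
  have hs : lowerHeight ![u z 1, u z 2] = u z 0 := by
    have : 1 - (u z 1 ^ 2 + u z 2 ^ 2) = (u z 0) ^ 2 := by linear_combination -hn
    simp only [lowerHeight, Matrix.cons_val_zero, Matrix.cons_val_one]
    rw [this, Real.sqrt_sq_eq_abs, abs_of_neg hneg, neg_neg]
  have hp : lowerPoint ![u z 1, u z 2] = u z := by
    ext i
    fin_cases i
    exacts [hs, rfl, rfl]
  have hne : u z 0 ≠ 0 := hneg.ne
  have hS : SolvesAt principalPart lowerOrderPart Γ (fun w => ![u w 1, u w 2]) z ↔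
      ∀ i : Fin 2, (principalMatrix ![u z 1, u z 2]).mulVec
        ![fderiv ℝ u z (dir 0) 1, fderiv ℝ u z (dir 0) 2] i +
        (![fderiv ℝ u z (dir 1) 1, fderiv ℝ u z (dir 1) 2] : Fin 2 → ℝ) i +
        lowerOrderPart ![u z 1, u z 2] Γ i = 0 := by
    have hα : ∀ ζ, fderiv ℝ (fun w => (![u w 1, u w 2] : Fin 2 → ℝ)) z ζ =
        ![fderiv ℝ u z ζ 1, fderiv ℝ u z ζ 2] := by
      intro ζ
      rw [hv.fderiv]
      ext i
      fin_cases i <;> rfl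
    rw [SolvesAt, hα, hα, funext_iff]
    rfl
  have hB : lowerOrderPart ![u z 1, u z 2] Γ =
      ![cross3 (θ 1) (u z) 1 - (u z 2 * cross3 (θ 0) (u z) 0 - u z 0 * cross3 (θ 0) (u z) 2),
        cross3 (θ 1) (u z) 2 - (u z 0 * cross3 (θ 0) (u z) 1 - u z 1 * cross3 (θ 0) (u z) 0)] := by
    have h0 : lowerOrderPart ![u z 1, u z 2] Γ =
      ![∑ j, (Γ 1 1 j - (u z 2 * Γ 0 0 j - lowerHeight ![u z 1, u z 2] * Γ 0 2 j)) *
          lowerPoint ![u z 1, u z 2] j,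
        ∑ j, (Γ 1 2 j - (lowerHeight ![u z 1, u z 2] * Γ 0 1 j - u z 1 * Γ 0 0 j)) *
          lowerPoint ![u z 1, u z 2] j] := rfl
    rw [h0, hs, hp]
    simp only [← hΓ, Fin.sum_univ_three]
    ext i
    fin_cases i <;> simp <;> ring
  rw [hS, hB, Fin.forall_fin_two, funext_iff, Fin.forall_fin_succ, Fin.forall_fin_two]
  simp only [principalMatrix, hs, Matrix.mulVec, dotProduct, Fin.sum_univ_two, Matrix.of_apply,
    Matrix.cons_val, Pi.add_apply, Fin.succ_zero_eq_one, Fin.succ_one_eq_two]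
  have hd0 := hd (dir 0)
  have hd1 := hd (dir 1)
  simp only [cross3, Matrix.cons_val, Pi.add_apply]
  generalize fderiv ℝ u z (dir 0) = a at *
  generalize fderiv ℝ u z (dir 1) = c at *
  generalize θ 0 = s at *
  generalize θ 1 = t at *
  generalize u z = v at *
  -- The derivative `a 0` of the height is eliminated by u · ∂₁u = 0. This is the origin of the
  -- quotients in `principalMatrix`.
  have e1 : v 1 * v 2 / v 0 * a 1 + (v 0 + v 2 ^ 2 / v 0) * a 2 = v 0 * a 2 - v 2 * a 0 := by
    field_simp
    linear_combination v 2 * hd0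
  have e2 : -(v 0 + v 1 ^ 2 / v 0) * a 1 + -(v 1 * v 2 / v 0) * a 2 = v 1 * a 0 - v 0 * a 1 := by
    field_simp
    linear_combination -v 1 * hd0
  rw [e1, e2]
  constructor
  · rintro ⟨h1, h2⟩
    -- The vector D₂ - u × D₁ is always orthogonal to u. As the height is nonzero, its height
    -- component vanishes once the other two do.
    refine ⟨mul_left_cancel₀ hne ?_, ?_, ?_⟩
    · linear_combination hd1 - v 1 * h1 - v 2 * h2
    · linear_combination h1
    · linear_combination h2
  · rintro ⟨-, h1, h2⟩
    exact ⟨by linear_combination h1, by linear_combination h2⟩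

end System

/-! ### Orthonormal bases, adapted bases and Gram–Schmidt frames. -/

section OrthonormalBases

variable {b : Bilin}

theorem IsON.det4_ne_zero {e : Fin 4 → E4} (h : IsON b e) : det4 e ≠ 0 := by
  intro h0
  have h1 := det4_frameMap e (fun j => coframe b e (bvec j))
  simp only [frameMap_coframe h, h0, zero_mul] at h1
  have h2 : det4 bvec = 1 := by
    rw [det4, ← Matrix.det_one (n := Fin 4)]
    refine congrArg Matrix.det (Matrix.ext fun i j => ?_)
    simp [Matrix.one_apply]
  exact one_ne_zero (h2.symm.trans h1)

/-- Three linear conditions on a four-dimensional space have a nonzero solution, which positivity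
allows to be normalised. -/
theorem exists_unit_of_functionals (hpos : ∀ v, v ≠ 0 → 0 < b v v) (l : Fin 3 → E4 →L[ℝ] ℝ) :
    ∃ v, b v v = 1 ∧ ∀ i, l i v = 0 := by
  let L : E4 →ₗ[ℝ] (Fin 3 → ℝ) := LinearMap.pi fun i => (l i).toLinearMap
  have h1 : LinearMap.ker L ≠ ⊥ := LinearMap.ker_ne_bot_of_finrank_lt (by simp)
  obtain ⟨v, hv, hv0⟩ := Submodule.exists_mem_ne_zero_of_ne_bot h1
  have h2 : ∀ i, l i v = 0 := fun i => congrFun (LinearMap.mem_ker.1 hv) i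
  have h3 := hpos v hv0
  refine ⟨(√(b v v))⁻¹ • v, ?_, fun i => by rw [map_smul, h2, smul_zero]⟩
  simp only [map_smul, smul_apply, smul_eq_mul]
  have h4 := Real.mul_self_sqrt h3.le
  have h5 := (Real.sqrt_pos.2 h3).ne'
  field_simp
  linear_combination -h4

theorem exists_isON (hsymm : ∀ v w, b v w = b w v) (hpos : ∀ v, v ≠ 0 → 0 < b v v) :
    ∃ e, IsON b e := by
  have key : ∀ k : ℕ, k ≤ 4 → ∃ e : Fin 4 → E4, ∀ i j : Fin 4, i.val < k → j.val < k →
      b (e i) (e j) = if i = j then 1 else 0 := by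
    intro k
    induction k with
    | zero => exact fun _ => ⟨0, fun i j hi => absurd hi (Nat.not_lt_zero _)⟩
    | succ k ih =>
      intro hk
      obtain ⟨e, he⟩ := ih (Nat.le_of_succ_le hk)
      -- At stage k only k ≤ 3 conditions are needed; the remaining ones are filled with the zero
      -- functional.
      obtain ⟨v, hv, hv0⟩ := exists_unit_of_functionals hpos
        fun i : Fin 3 => if i.val < k then b (e i.castSucc) else 0
      have h0 : ∀ i : Fin 4, i.val < k → b (e i) v = 0 := by
        intro i hi
        have := hv0 ⟨i.val, by omega⟩
        simpa [hi] using this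
      refine ⟨Function.update e ⟨k, hk⟩ v, fun i j hi hj => ?_⟩
      rcases Nat.lt_succ_iff_lt_or_eq.1 hi with hi | hi <;>
        rcases Nat.lt_succ_iff_lt_or_eq.1 hj with hj | hj
      · rw [Function.update_of_ne (by rintro rfl; exact hi.false),
          Function.update_of_ne (by rintro rfl; exact hj.false), he i j hi hj]
      · obtain rfl : j = ⟨k, hk⟩ := Fin.ext hj
        have hne : i ≠ ⟨k, hk⟩ := by rintro rfl; exact hi.false
        rw [Function.update_of_ne hne, Function.update_self, h0 i hi, if_neg hne]
      · obtain rfl : i = ⟨k, hk⟩ := Fin.ext hi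
        have hne : j ≠ ⟨k, hk⟩ := by rintro rfl; exact hj.false
        rw [Function.update_of_ne hne, Function.update_self, hsymm, h0 j hj, if_neg hne.symm]
      · obtain rfl : i = ⟨k, hk⟩ := Fin.ext hi
        obtain rfl : j = ⟨k, hk⟩ := Fin.ext hj
        rw [Function.update_self, hv, if_pos rfl]
  obtain ⟨e, he⟩ := key 4 le_rfl
  exact ⟨e, fun i j => he i j i.2 j.2⟩

/-- If necessary, exchanging the first two vectors corrects the orientation. -/
theorem exists_isON_det4_pos (hsymm : ∀ v w, b v w = b w v) (hpos : ∀ v, v ≠ 0 → 0 < b v v) :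
    ∃ e, IsON b e ∧ 0 < det4 e := by
  obtain ⟨e, he⟩ := exists_isON hsymm hpos
  rcases lt_or_gt_of_ne he.det4_ne_zero with h | h
  · refine ⟨e ∘ Equiv.swap 0 1, fun i j => ?_, ?_⟩
    · rw [Function.comp_apply, Function.comp_apply, he]
      simp only [(Equiv.swap (0 : Fin 4) 1).injective.eq_iff]
    · have h1 := Matrix.det_permute' (Equiv.swap (0 : Fin 4) 1) (Matrix.of fun i j : Fin 4 => e j i)
      have h2 : det4 (e ∘ Equiv.swap 0 1) = -det4 e := by
        refine (Eq.trans ?_ h1).trans ?_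
        · rfl
        · rw [Equiv.Perm.sign_swap (by decide)]
          simp [det4]
      rw [h2]
      exact neg_pos.2 h
  · exact ⟨e, he, h⟩

/-- An oriented orthonormal basis adapted to an oriented complex structure. -/
theorem exists_adapted_isON (hsymm : ∀ v w, b v w = b w v) (hpos : ∀ v, v ≠ 0 → 0 < b v v)
    {K : E4 →L[ℝ] E4} (hK : K ∈ twistorSet b) {v : E4} (hv : b v v = 1) :
    ∃ e, IsON b e ∧ 0 < det4 e ∧ e 0 = v ∧ K (e 0) = e 1 ∧ K (e 1) = -e 0 ∧ K (e 2) = e 3 ∧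
      K (e 3) = -e 2 := by
  obtain ⟨h1, h2, h3⟩ := hK
  have hskew : ∀ x y, b (K x) y = -b x (K y) := by
    intro x y
    have := h1 x (K y)
    rw [h2, map_neg] at this
    linarith
  have hself : ∀ x, b x (K x) = 0 := by
    intro x
    have := hskew x x
    rw [hsymm] at this
    linarith
  obtain ⟨w, hw, hw0⟩ := exists_unit_of_functionals hpos ![b v, b (K v), 0]
  have w0 : b v w = 0 := hw0 0
  have w1 : b (K v) w = 0 := hw0 1
  have w2 : b v (K w) = 0 := by linarith [hskew v w]
  have w3 : b (K v) (K w) = 0 := by rw [h1, w0]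
  have hon : IsON b ![v, K v, w, K w] := by
    intro i j
    fin_cases i <;> fin_cases j <;>
      simp [hv, hw, w0, w1, w2, w3, hself, h1, hsymm w v, hsymm w (K v), hsymm (K w) v,
        hsymm (K v) v, hsymm (K w) w]
  exact ⟨![v, K v, w, K w], hon, h3 v w ((linearIndependent_iff_det4 _).2 hon.det4_ne_zero), rfl,
    rfl, h2 v, rfl, h2 w⟩

/-- Smooth orthonormal frames with a prescribed value at a point. -/
theorem exists_smooth_isON {b : E4 → Bilin} {T : Set E4} (hT : IsOpen T)
    (hb : ContDiffOn ℝ ∞ b T) (hsymm : ∀ q v w, b q v w = b q w v) {q₀ : E4} (hq₀ : q₀ ∈ T)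
    {v : Fin 4 → E4} (hv : IsON (b q₀) v) :
    ∃ (T' : Set E4) (w : E4 → Fin 4 → E4), IsOpen T' ∧ q₀ ∈ T' ∧ T' ⊆ T ∧
      (∀ i, ContDiffOn ℝ ∞ (fun q => w q i) T') ∧ (∀ q ∈ T', IsON (b q) (w q)) ∧ w q₀ = v := by
  have key : ∀ k : ℕ, k ≤ 4 → ∃ (T' : Set E4) (w : E4 → Fin 4 → E4), IsOpen T' ∧ q₀ ∈ T' ∧ T' ⊆ T ∧
      (∀ i, ContDiffOn ℝ ∞ (fun q => w q i) T') ∧ (∀ q ∈ T', ∀ i j : Fin 4, i.val < k → j.val < k →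
        b q (w q i) (w q j) = if i = j then 1 else 0) ∧ w q₀ = v := by
    intro k
    induction k with
    | zero => exact fun _ => ⟨T, fun _ => v, hT, hq₀, subset_rfl, fun i => contDiffOn_const,
        fun q _ i j hi => absurd hi (Nat.not_lt_zero _), rfl⟩
    | succ k ih =>
      intro hk
      obtain ⟨T', w, hT', hqT', hsub, hw, hon, hwv⟩ := ih (Nat.le_of_succ_le hk)
      let m : Fin 4 := ⟨k, hk⟩
      -- Gram–Schmidt applied to the constant fields `v m`. They are already orthonormal at q₀, so
      -- nothing is subtracted there and the prescribed value is kept. The neighbourhood shrinks to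
      -- where the residual has positive length.
      let r : E4 → E4 := fun q => v m - ∑ i : Fin 4, if i.val < k then b q (w q i) (v m) • w q i else 0
      have hr : ContDiffOn ℝ ∞ r T' := by
        refine contDiffOn_const.sub (ContDiffOn.sum fun i _ => ?_)
        by_cases hi : i.val < k
        · simp only [hi, if_true]
          exact (((hb.mono hsub).clm_apply (hw i)).clm_apply contDiffOn_const).smul (hw i)
        · simp only [hi, if_false]
          exact contDiffOn_const
      have hrr : ContDiffOn ℝ ∞ (fun q => b q (r q) (r q)) T' :=
        ((hb.mono hsub).clm_apply hr).clm_apply hr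
      have hr0 : r q₀ = v m := by
        simp only [r]
        rw [Finset.sum_eq_zero, sub_zero]
        intro i _
        split_ifs with hi
        · rw [hwv, hv i m, if_neg (by rintro rfl; exact hi.false), zero_smul]
        · rfl
      have horth : ∀ q ∈ T', ∀ i : Fin 4, i.val < k → b q (w q i) (r q) = 0 := by
        intro q hq i hi
        simp only [r, map_sub, map_sum]
        rw [Finset.sum_eq_single i]
        · simp only [hi, if_true, map_smul, hon q hq i i hi hi, smul_eq_mul, mul_one, sub_self]
        · intro j _ hj
          split_ifs with hjk
          · rw [map_smul, hon q hq i j hi hjk, if_neg hj.symm, smul_zero]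
          · exact map_zero _
        · simp
      let T'' := T' ∩ (fun q => b q (r q) (r q)) ⁻¹' Set.Ioi 0
      have hT'' : IsOpen T'' := hrr.continuousOn.isOpen_inter_preimage hT' isOpen_Ioi
      have hnorm : ∀ q ∈ T'', b q ((√(b q (r q) (r q)))⁻¹ • r q)
          ((√(b q (r q) (r q)))⁻¹ • r q) = 1 := by
        rintro q ⟨-, hq⟩
        have hq : 0 < b q (r q) (r q) := hq
        simp only [map_smul, smul_apply, smul_eq_mul]
        have h4 := Real.mul_self_sqrt hq.le
        have h5 := (Real.sqrt_pos.2 hq).ne'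
        field_simp
        linear_combination -h4
      have hq0'' : b q₀ (r q₀) (r q₀) = 1 := by rw [hr0, hv m m, if_pos rfl]
      refine ⟨T'', fun q => Function.update (w q) m ((√(b q (r q) (r q)))⁻¹ • r q), hT'', ⟨hqT', ?_⟩,
        Set.inter_subset_left.trans hsub, ?_, ?_, ?_⟩
      · rw [Set.mem_preimage, hq0'']
        exact zero_lt_one (α := ℝ)
      · intro i
        by_cases hi : i = m
        · subst hi
          simp only [Function.update_self]
          refine ContDiffOn.smul (ContDiffOn.inv (ContDiffOn.sqrt (hrr.mono Set.inter_subset_left)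
            fun q hq => ne_of_gt hq.2) fun q hq => (Real.sqrt_pos.2 hq.2).ne')
            (hr.mono Set.inter_subset_left)
        · simp only [Function.update_of_ne hi]
          exact (hw i).mono Set.inter_subset_left
      · intro q hq i j hi hj
        beta_reduce
        rcases Nat.lt_succ_iff_lt_or_eq.1 hi with hi | hi <;>
          rcases Nat.lt_succ_iff_lt_or_eq.1 hj with hj | hj
        · have hne : i ≠ m := by rintro rfl; exact hi.false
          have hne' : j ≠ m := by rintro rfl; exact hj.false
          rw [Function.update_of_ne hne, Function.update_of_ne hne', hon q hq.1 i j hi hj]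
        · obtain rfl : j = m := Fin.ext hj
          have hne : i ≠ m := by rintro rfl; exact hi.false
          rw [Function.update_of_ne hne, Function.update_self, map_smul, horth q hq.1 i hi, smul_zero,
            if_neg hne]
        · obtain rfl : i = m := Fin.ext hi
          have hne : j ≠ m := by rintro rfl; exact hj.false
          rw [Function.update_of_ne hne, Function.update_self, hsymm, map_smul, horth q hq.1 j hj,
            smul_zero, if_neg hne.symm]
        · obtain rfl : i = m := Fin.ext hi
          obtain rfl : j = m := Fin.ext hj
          rw [Function.update_self, hnorm q hq, if_pos rfl]
      · beta_reduce
        rw [hq0'', Real.sqrt_one, inv_one, one_smul, hr0, hwv]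
        exact Function.update_eq_self m v
  obtain ⟨T', w, h1, h2, h3, h4, h5, h6⟩ := key 4 le_rfl
  exact ⟨T', w, h1, h2, h3, h4, fun q hq i j => h5 q hq i j i.2 j.2, h6⟩

end OrthonormalBases

/-! ### Smooth oriented orthonormal frames along the map. -/

section LocalFrames

variable {N : Type*} [TopologicalSpace N] [ChartedSpace E4 N] [IsManifold (𝓡 4) ∞ N]

theorem fiberForm_symm (g : Metric N) (y : N) (v w : E4) : fiberForm g y v w = fiberForm g y w v :=
  g.symm y v w

theorem fiberForm_pos (g : Metric N) (y : N) (v : E4) (hv : v ≠ 0) : 0 < fiberForm g y v v :=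
  g.pos y v hv

theorem exists_isOrientedOrthonormal (g : Metric N) (y : N) :
    ∃ e : Fin 4 → TangentSpace (𝓡 4) y, IsOrientedOrthonormal g y e :=
  exists_isON_det4_pos (fiberForm_symm g y) (fiberForm_pos g y)

/-- Smooth oriented orthonormal frames in a chart, with a prescribed value at its centre. -/
theorem exists_chart_frame (g : Metric N) (y₀ : N) {f : Fin 4 → TangentSpace (𝓡 4) y₀}
    (hf : IsOrientedOrthonormal g y₀ f) :
    ∃ (T : Set E4) (w : E4 → Fin 4 → E4), IsOpen T ∧ chartAt E4 y₀ y₀ ∈ T ∧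
      (∀ i, ContDiffOn ℝ ∞ (fun q => w q i) T) ∧
      (∀ q ∈ T, IsON (chartForm g y₀ q) (w q) ∧ 0 < det4 (w q)) ∧ w (chartAt E4 y₀ y₀) = f := by
  have hy : y₀ ∈ (chartAt E4 y₀).source := mem_chart_source E4 y₀
  have hf' : IsON (chartForm g y₀ (chartAt E4 y₀ y₀)) f := by
    intro i j
    refine Eq.trans ?_ (hf.1 i j)
    refine Eq.trans ?_ (chartForm_ofFiber g hy (f i) (f j))
    exact (congrArg₂ (fun v w => chartForm g y₀ (chartAt E4 y₀ y₀) v w) (ofFiber_self y₀ (f i))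
      (ofFiber_self y₀ (f j))).symm
  obtain ⟨T, w, hT, hqT, hsub, hw, hon, hw0⟩ := exists_smooth_isON (chartAt E4 y₀).open_target
    (contDiffOn_chartForm g y₀) (chartForm_symm g y₀) ((chartAt E4 y₀).map_source hy) hf'
  have hdet : ContinuousOn (fun q => det4 (w q)) T := by
    refine (contDiffOn_det fun i j => ?_).continuousOn
    exact contDiffOn_euclidean.1 (hw j) i
  refine ⟨T ∩ (fun q => det4 (w q)) ⁻¹' Set.Ioi 0, w, hdet.isOpen_inter_preimage hT isOpen_Ioi,
    ⟨hqT, ?_⟩, fun i => (hw i).mono Set.inter_subset_left, fun q hq => ⟨hon q hq.1, hq.2⟩, hw0⟩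
  rw [Set.mem_preimage, hw0]
  exact hf.2

variable {S : Type*} [TopologicalSpace S] [ChartedSpace ℂ S] [IsManifold 𝓘(ℂ) ω S] {φ : S → N}

/-- Smooth oriented orthonormal frames along a map, with a prescribed value at a point. -/
theorem exists_isLocalFrame (hN : IsOrientedAtlas N) (g : Metric N)
    (hφ : ContMDiff 𝓘(ℝ, ℂ) (𝓡 4) ∞ φ) (p : S) {f : Fin 4 → TangentSpace (𝓡 4) (φ p)}
    (hf : IsOrientedOrthonormal g (φ p) f) :
    ∃ (U : Set S) (e : ∀ x : S, Fin 4 → TangentSpace (𝓡 4) (φ x)),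
      IsOpen U ∧ p ∈ U ∧ IsLocalFrame g φ U e ∧ e p = f := by
  obtain ⟨T', w, hT', hqT', hw, hon, hw0⟩ := exists_chart_frame g (φ p) hf
  let O := (chartAt E4 (φ p)).source ∩ chartAt E4 (φ p) ⁻¹' T'
  have hO : IsOpen O := (chartAt E4 (φ p)).isOpen_inter_preimage hT'
  -- The frame is pulled back from a frame of the target near φ p. Smoothness in an arbitrary chart
  -- then follows from that of the tangent coordinate changes.
  refine ⟨φ ⁻¹' O, fun x i => toFiber (φ p) (φ x) (w (chartAt E4 (φ p) (φ x)) i),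
    hO.preimage hφ.continuous, ⟨mem_chart_source E4 (φ p), hqT'⟩, ⟨?_, ?_⟩, ?_⟩
  · rintro x ⟨hx, hxT⟩
    refine ⟨fun i j => ?_, det4_toFiber_pos hN hx (hon _ hxT).2⟩
    refine Eq.trans ?_ ((hon _ hxT).1 i j)
    refine (chartForm_ofFiber g hx _ _).symm.trans ?_
    exact congrArg₂ (fun v w => chartForm g (φ p) (chartAt E4 (φ p) (φ x)) v w) (ofFiber_toFiber hx _)
      (ofFiber_toFiber hx _)
  · intro x₁ y₁ i
    have hpatch : ∀ z ∈ patch φ x₁ y₁ ∩ pt x₁ ⁻¹' (φ ⁻¹' O), z ∈ patch φ x₁ (φ p) :=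
      fun z hz => ⟨hz.1.1, hz.2.1⟩
    have hsymm : ∀ z ∈ patch φ x₁ (φ p), (chartAt E4 (φ p)).symm (localMap φ x₁ (φ p) z) = φ (pt x₁ z) :=
      fun z hz => (chartAt E4 (φ p)).left_inv hz.2
    have hl := (contDiffOn_localMap hφ x₁ (φ p)).mono hpatch
    have h1 : ContDiffOn ℝ ∞ (fun z => tangentCoordChange (𝓡 4) (φ p) y₁
        ((chartAt E4 (φ p)).symm (localMap φ x₁ (φ p) z))) (patch φ x₁ y₁ ∩ pt x₁ ⁻¹' (φ ⁻¹' O)) := by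
      refine (contDiffOn_tangentCoordChange (φ p) y₁).comp hl fun z hz => ?_
      refine ⟨localMap_mem_target (hpatch z hz), ?_⟩
      rw [Set.mem_preimage, hsymm z (hpatch z hz)]
      exact hz.1.2
    have h2 : ContDiffOn ℝ ∞ (fun z => w (localMap φ x₁ (φ p) z) i)
        (patch φ x₁ y₁ ∩ pt x₁ ⁻¹' (φ ⁻¹' O)) :=
      (hw i).comp hl fun z hz => hz.2.2
    refine (h1.clm_apply h2).congr fun z hz => ?_
    rw [hsymm z (hpatch z hz)]
    exact ofFiber_toFiber_change (hpatch z hz).2 hz.1.2 _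
  · ext1 i
    exact (toFiber_self (φ p) _).trans (congrFun hw0 i)

end LocalFrames

/-! ### Regularity of sections and of their coefficients. -/

section SmoothSections

theorem contDiffAt_sdEnd {b : ℂ → Bilin} {e : ℂ → Fin 4 → E4} {u : ℂ → Fin 3 → ℝ} {z : ℂ}
    {n : WithTop ℕ∞} (hb : ContDiffAt ℝ n b z) (he : ∀ i, ContDiffAt ℝ n (fun w => e w i) z)
    (hu : ContDiffAt ℝ n u z) : ContDiffAt ℝ n (fun w => sdEnd (b w) (e w) (u w)) z := by
  have h1 : ContDiffAt ℝ n (fun w => frameMap (e w)) z := by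
    unfold frameMap
    refine ContDiffAt.sum fun i _ => ?_
    exact (ContinuousLinearMap.smulRightL ℝ E4 E4
      (EuclideanSpace.proj (𝕜 := ℝ) i : E4 →L[ℝ] ℝ)).contDiff.contDiffAt.comp z (he i)
  have h2 : ContDiffAt ℝ n (fun w => coframe (b w) (e w)) z := by
    unfold coframe
    refine ContDiffAt.sum fun i _ => ?_
    exact ((ContinuousLinearMap.smulRightL ℝ E4 E4).flip (bvec i)).contDiff.contDiffAt.comp z
      (hb.clm_apply (he i))
  exact (h1.clm_comp (sdMatrixL.contDiff.contDiffAt.comp z hu)).clm_comp h2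

theorem continuousAt_cross3 {z : ℂ} {a c : ℂ → Fin 3 → ℝ} (ha : ContinuousAt a z) (hc : ContinuousAt c z) :
    ContinuousAt (fun w => cross3 (a w) (c w)) z := by
  have h2 := continuousAt_pi.1 ha
  have h3 := continuousAt_pi.1 hc
  refine continuousAt_pi.2 fun i => ?_
  fin_cases i
  · exact ((h2 1).mul (h3 2)).sub ((h2 2).mul (h3 1))
  · exact ((h2 2).mul (h3 0)).sub ((h2 0).mul (h3 2))
  · exact ((h2 0).mul (h3 1)).sub ((h2 1).mul (h3 0))

variable {S : Type*} [TopologicalSpace S] [ChartedSpace ℂ S]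
  {N : Type*} [TopologicalSpace N] [ChartedSpace E4 N] [IsManifold (𝓡 4) ∞ N]
  {φ : S → N} {x₀ : S} {y₀ : N} {z : ℂ} {J : EndSection φ} {g : Metric N}
  {e : ∀ x : S, Fin 4 → TangentSpace (𝓡 4) (φ x)} {U V : Set S}

/-- Coefficient functions of class `C¹` at a point of the surface. -/
def IsC1At (u : S → Fin 3 → ℝ) (p : S) : Prop :=
  ∀ x₀ z, z ∈ (chartAt ℂ x₀).target → pt x₀ z = p → ContDiffAt ℝ 1 (fun w => u (pt x₀ w)) z

theorem eventually_pt {P : S → Prop} (hz : z ∈ (chartAt ℂ x₀).target)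
    (h : ∀ᶠ x in 𝓝 (pt x₀ z), P x) : ∀ᶠ w in 𝓝 z, P (pt x₀ w) :=
  (continuousAt_pt hz).eventually h

theorem covDeriv_congr {J J' : EndSection φ}
    (h : localSection φ J x₀ y₀ =ᶠ[𝓝 z] localSection φ J' x₀ y₀) (ζ : ℂ) :
    covDeriv g φ J x₀ y₀ z ζ = covDeriv g φ J' x₀ y₀ z ζ := by
  rw [covDeriv, covDeriv, h.fderiv_eq, h.self_of_nhds]

theorem localSection_eventuallyEq {J J' : EndSection φ} (hz : z ∈ (chartAt ℂ x₀).target)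
    (h : ∀ᶠ x in 𝓝 (pt x₀ z), J x = J' x) :
    localSection φ J x₀ y₀ =ᶠ[𝓝 z] localSection φ J' x₀ y₀ := by
  filter_upwards [eventually_pt hz h] with w hw
  rw [localSection, hw, localSection]

theorem localSection_mul_self (hz : z ∈ patch φ x₀ y₀)
    (hJ : J (pt x₀ z) ∈ twistorFiber g (φ (pt x₀ z))) :
    localSection φ J x₀ y₀ z * localSection φ J x₀ y₀ z = -1 := by
  ext v : 1
  have h1 : (localSection φ J x₀ y₀ z * localSection φ J x₀ y₀ z) v =
      ofFiber y₀ (φ (pt x₀ z)) (J (pt x₀ z) (toFiber y₀ (φ (pt x₀ z)) (ofFiber y₀ (φ (pt x₀ z))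
        (J (pt x₀ z) (toFiber y₀ (φ (pt x₀ z)) v))))) := rfl
  rw [h1]
  refine (congrArg (fun w => ofFiber y₀ (φ (pt x₀ z)) (J (pt x₀ z) w))
    (toFiber_ofFiber hz.2 _)).trans ?_
  refine (congrArg (ofFiber y₀ (φ (pt x₀ z))) (hJ.2.1 _)).trans ?_
  exact (map_neg _ _).trans (congrArg Neg.neg (ofFiber_toFiber hz.2 v))

theorem contDiffAt_chartFrame (hφ : Continuous φ) (hU : IsOpen U) (he : IsLocalFrame g φ U e)
    (hz : z ∈ patch φ x₀ y₀ ∩ pt x₀ ⁻¹' U) (i : Fin 4) :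
    ContDiffAt ℝ ∞ (fun w => chartFrame φ e x₀ y₀ w i) z :=
  (he.smooth x₀ y₀ i).contDiffAt ((isOpen_patch_inter hφ x₀ y₀ hU).mem_nhds hz)

/-- Holomorphic sections are the `C¹` sections which solve the Cauchy-Riemann equation. -/
theorem isHolomorphicOn_iff_covDeriv (hφ : Continuous φ) (hV : IsOpen V)
    (hJ : IsC1SectionOn g φ J V) : IsHolomorphicOn g φ J V ↔
      ∀ x₀ y₀, ∀ z ∈ patch φ x₀ y₀ ∩ pt x₀ ⁻¹' V,
        covDeriv g φ J x₀ y₀ z Complex.I = covDeriv g φ J x₀ y₀ z 1 * localSection φ J x₀ y₀ z := by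
  have h : ∀ x₀ y₀, ∀ z ∈ patch φ x₀ y₀ ∩ pt x₀ ⁻¹' V,
      (∀ ζ : ℂ, fderiv ℝ (graphMap φ J x₀ y₀) z (Complex.I * ζ) =
        twistorJ g φ x₀ y₀ (graphMap φ J x₀ y₀ z) (fderiv ℝ (graphMap φ J x₀ y₀) z ζ)) ↔
      covDeriv g φ J x₀ y₀ z Complex.I =
        covDeriv g φ J x₀ y₀ z 1 * localSection φ J x₀ y₀ z := by
    intro x₀ y₀ z hz
    refine intertwines_iff (((hJ.2 x₀ y₀).contDiffAt
      ((isOpen_patch_inter hφ x₀ y₀ hV).mem_nhds hz)).differentiableAt (by simp)) ?_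
    exact localSection_mul_self hz.1 (hJ.1 _ hz.2)
  constructor
  · intro h1 x₀ y₀ z hz
    exact (h x₀ y₀ z hz).1 (h1.2 x₀ y₀ z hz)
  · intro h1
    exact ⟨hJ, fun x₀ y₀ z hz => (h x₀ y₀ z hz).2 (h1 x₀ y₀ z hz)⟩

variable [IsManifold 𝓘(ℂ) ω S]

/-- Coordinate changes are smooth, so one chart decides. -/
theorem isC1At_of_contDiffAt {u : S → Fin 3 → ℝ} {x₁ : S} {z₁ : ℂ}
    (hz₁ : z₁ ∈ (chartAt ℂ x₁).target) (h : ContDiffAt ℝ 1 (fun w => u (pt x₁ w)) z₁) :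
    IsC1At u (pt x₁ z₁) := by
  intro x₀ z hz hp
  have hm : pt x₁ z₁ ∈ (chartAt ℂ x₁).source := (chartAt ℂ x₁).map_target hz₁
  have hov : z ∈ overlap x₀ x₁ := ⟨hz, by rw [Set.mem_preimage, hp]; exact hm⟩
  have ht : transition x₀ x₁ z = z₁ := by
    rw [transition, hp]
    exact (chartAt ℂ x₁).right_inv hz₁
  have h1 : (fun w => u (pt x₀ w)) =ᶠ[𝓝 z] (fun w => u (pt x₁ w)) ∘ transition x₀ x₁ := by
    filter_upwards [(isOpen_overlap x₀ x₁).mem_nhds hov] with w hw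
    exact congrArg u (pt_transition hw).symm
  refine ContDiffAt.congr_of_eventuallyEq ?_ h1
  refine ContDiffAt.comp z (by rw [ht]; exact h) ?_
  exact ((((contDiffOn_transition x₀ x₁).contDiffAt
    ((isOpen_overlap x₀ x₁).mem_nhds hov)).restrict_scalars ℝ).of_le (by simp))

theorem contDiffAt_pullForm (hφ : ContMDiff 𝓘(ℝ, ℂ) (𝓡 4) ∞ φ) (hz : z ∈ patch φ x₀ y₀) :
    ContDiffAt ℝ ∞ (pullForm g φ x₀ y₀) z :=
  (contDiffOn_pullForm g hφ x₀ y₀).contDiffAt ((isOpen_patch hφ.continuous x₀ y₀).mem_nhds hz)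

theorem contDiffAt_localSection (hφ : ContMDiff 𝓘(ℝ, ℂ) (𝓡 4) ∞ φ) (hU : IsOpen U)
    (he : IsLocalFrame g φ U e) (hz : z ∈ patch φ x₀ y₀ ∩ pt x₀ ⁻¹' U) {u : S → Fin 3 → ℝ}
    (hu : IsC1At u (pt x₀ z)) (hJ : ∀ᶠ x in 𝓝 (pt x₀ z), J x = fiberSd g (φ x) (e x) (u x)) :
    ContDiffAt ℝ 1 (localSection φ J x₀ y₀) z := by
  refine ContDiffAt.congr_of_eventuallyEq (contDiffAt_sdEnd
    ((contDiffAt_pullForm (g := g) hφ hz.1).of_le (by simp))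
    (fun i => (contDiffAt_chartFrame hφ.continuous hU he hz i).of_le (by simp))
    (hu x₀ z hz.1.1 rfl)) ?_
  filter_upwards [eventually_mem_patch hφ.continuous hU hz, eventually_pt hz.1.1 hJ] with w hw hw'
  exact localSection_fiberSd g hw.1 hw'

/-- The coefficients are -1/4 times traces of the section against the smooth E_i, so they inherit
its regularity. -/
theorem isC1At_frameCoeff (hφ : ContMDiff 𝓘(ℝ, ℂ) (𝓡 4) ∞ φ) (hU : IsOpen U)
    (he : IsLocalFrame g φ U e) (hV : IsOpen V) (hVU : V ⊆ U) (hJ : IsC1SectionOn g φ J V) {p : S}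
    (hp : p ∈ V) : IsC1At (fun x i => frameCoeff g φ e J i x) p := by
  rintro x₀ z hz rfl
  have hzp : z ∈ patch φ x₀ (φ (pt x₀ z)) ∩ pt x₀ ⁻¹' V := ⟨mem_patch hz, hp⟩
  have hzU : z ∈ patch φ x₀ (φ (pt x₀ z)) ∩ pt x₀ ⁻¹' U := ⟨mem_patch hz, hVU hp⟩
  refine contDiffAt_pi.2 fun i => ?_
  let tr : (E4 →L[ℝ] E4) →L[ℝ] ℝ := LinearMap.toContinuousLinearMap
    ((LinearMap.trace ℝ E4) ∘ₗ ContinuousLinearMap.coeLM ℝ)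
  have h1 : (fun w => frameCoeff g φ e J i (pt x₀ w)) =ᶠ[𝓝 z] fun w =>
      -(1 / 4) * tr ((localSection φ J x₀ (φ (pt x₀ z)) w).comp
        (sdEnd (pullForm g φ x₀ (φ (pt x₀ z)) w) (chartFrame φ e x₀ (φ (pt x₀ z)) w)
          (Pi.single i 1))) := by
    filter_upwards [eventually_mem_patch hφ.continuous hV hzp] with w hw
    have ho := he.orthonormal _ (hVU hw.2)
    have h2 := (eq_fiberSd_frameCoeff g ho (hJ.1 _ hw.2)).1
    rw [localSection_fiberSd g hw.1 h2]
    have h3 := trace_sdEnd_mul (isON_chartFrame g hw.1 ho.1)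
      (fun i => frameCoeff g φ e J i (pt x₀ w)) (Pi.single i 1)
    rw [dot3_single] at h3
    have h4 : tr ((sdEnd (pullForm g φ x₀ (φ (pt x₀ z)) w) (chartFrame φ e x₀ (φ (pt x₀ z)) w)
        fun i => frameCoeff g φ e J i (pt x₀ w)).comp
        (sdEnd (pullForm g φ x₀ (φ (pt x₀ z)) w) (chartFrame φ e x₀ (φ (pt x₀ z)) w)
          (Pi.single i 1))) = -4 * frameCoeff g φ e J i (pt x₀ w) := h3
    rw [h4]
    ring
  refine ContDiffAt.congr_of_eventuallyEq ?_ h1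
  refine contDiffAt_const.mul (tr.contDiff.contDiffAt.comp z (ContDiffAt.clm_comp ?_ ?_))
  · exact (hJ.2 x₀ _).contDiffAt ((isOpen_patch_inter hφ.continuous x₀ _ hV).mem_nhds hzp)
  · exact contDiffAt_sdEnd ((contDiffAt_pullForm (g := g) hφ hzp.1).of_le (by simp))
      (fun i => (contDiffAt_chartFrame hφ.continuous hU he hzU i).of_le (by simp)) contDiffAt_const

theorem covDeriv_iff_covVec (hφ : ContMDiff 𝓘(ℝ, ℂ) (𝓡 4) ∞ φ) (hU : IsOpen U)
    (he : IsLocalFrame g φ U e) (hz : z ∈ patch φ x₀ y₀ ∩ pt x₀ ⁻¹' U) {u : S → Fin 3 → ℝ}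
    (hu : IsC1At u (pt x₀ z)) (hJ : ∀ᶠ x in 𝓝 (pt x₀ z), J x = fiberSd g (φ x) (e x) (u x))
    (hu1 : ∀ᶠ x in 𝓝 (pt x₀ z), dot3 (u x) (u x) = 1) :
    (covDeriv g φ J x₀ y₀ z Complex.I = covDeriv g φ J x₀ y₀ z 1 * localSection φ J x₀ y₀ z) ↔
      covVec g φ e x₀ y₀ (fun w => u (pt x₀ w)) z Complex.I =
        cross3 (u (pt x₀ z)) (covVec g φ e x₀ y₀ (fun w => u (pt x₀ w)) z 1) :=
  cauchyRiemann_iff hφ hU he hz ((hu x₀ z hz.1.1 rfl).differentiableAt (by simp))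
    (eventually_pt hz.1.1 hJ) (eventually_pt hz.1.1 hu1)

theorem isHolomorphicOn_iff_covVec (hφ : ContMDiff 𝓘(ℝ, ℂ) (𝓡 4) ∞ φ) (hU : IsOpen U)
    (he : IsLocalFrame g φ U e) (hV : IsOpen V) (hVU : V ⊆ U) (hJ : IsC1SectionOn g φ J V) :
    IsHolomorphicOn g φ J V ↔ ∀ x₀ y₀, ∀ z ∈ patch φ x₀ y₀ ∩ pt x₀ ⁻¹' V,
      covVec g φ e x₀ y₀ (fun w i => frameCoeff g φ e J i (pt x₀ w)) z Complex.I =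
        cross3 (fun i => frameCoeff g φ e J i (pt x₀ z))
          (covVec g φ e x₀ y₀ (fun w i => frameCoeff g φ e J i (pt x₀ w)) z 1) := by
  rw [isHolomorphicOn_iff_covDeriv hφ.continuous hV hJ]
  refine forall_congr' fun x₀ => forall_congr' fun y₀ => forall₂_congr fun z hz => ?_
  have hev : ∀ᶠ x in 𝓝 (pt x₀ z), x ∈ V := hV.mem_nhds hz.2
  refine covDeriv_iff_covVec (u := fun x i => frameCoeff g φ e J i x) hφ hU he ⟨hz.1, hVU hz.2⟩
    (isC1At_frameCoeff hφ hU he hV hVU hJ hz.2) ?_ ?_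
  · filter_upwards [hev] with x hx
    exact (eq_fiberSd_frameCoeff g (he.orthonormal x (hVU hx)) (hJ.1 x hx)).1
  · filter_upwards [hev] with x hx
    exact (eq_fiberSd_frameCoeff g (he.orthonormal x (hVU hx)) (hJ.1 x hx)).2

theorem continuousAt_covVec (hφ : ContMDiff 𝓘(ℝ, ℂ) (𝓡 4) ∞ φ) (hU : IsOpen U)
    (he : IsLocalFrame g φ U e) (hz : z ∈ patch φ x₀ y₀ ∩ pt x₀ ⁻¹' U) {u : ℂ → Fin 3 → ℝ}
    (hu : ContDiffAt ℝ 1 u z) (ζ : ℂ) :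
    ContinuousAt (fun w => covVec g φ e x₀ y₀ u w ζ) z := by
  have h1 : ContinuousAt (fun w => fderiv ℝ u w ζ) z :=
    ((hu.fderiv_right (m := 0) (by simp)).continuousAt).clm_apply continuousAt_const
  have h2 : ∀ i, ContinuousAt (fun w => frameRot g φ e x₀ y₀ w ζ i) z := fun i =>
    ((contDiffOn_frameRot hφ hU he ζ i).contDiffAt
      ((isOpen_patch_inter hφ.continuous x₀ y₀ hU).mem_nhds hz)).continuousAt
  have h3 : ∀ i, ContinuousAt (fun w => u w i) z := fun i =>
    (continuousAt_pi.1 hu.continuousAt) i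
  refine h1.add (continuousAt_pi.2 fun i => ?_)
  fin_cases i
  · exact ((h2 1).mul (h3 2)).sub ((h2 2).mul (h3 1))
  · exact ((h2 2).mul (h3 0)).sub ((h2 0).mul (h3 2))
  · exact ((h2 0).mul (h3 1)).sub ((h2 1).mul (h3 0))

/-- The Cauchy-Riemann equation extends over isolated points. -/
theorem covVec_eq_of_punctured (hφ : ContMDiff 𝓘(ℝ, ℂ) (𝓡 4) ∞ φ) (hU : IsOpen U)
    (he : IsLocalFrame g φ U e) (hz : z ∈ patch φ x₀ y₀ ∩ pt x₀ ⁻¹' U) {u : ℂ → Fin 3 → ℝ}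
    (hu : ContDiffAt ℝ 1 u z)
    (h : ∀ᶠ w in 𝓝[≠] z, covVec g φ e x₀ y₀ u w Complex.I =
      cross3 (u w) (covVec g φ e x₀ y₀ u w 1)) :
    covVec g φ e x₀ y₀ u z Complex.I = cross3 (u z) (covVec g φ e x₀ y₀ u z 1) := by
  -- As u is C¹ at the point itself, both sides of the equation are continuous there.
  have h1 := (continuousAt_covVec hφ hU he hz hu Complex.I).tendsto.mono_left
    (nhdsWithin_le_nhds (s := {z}ᶜ))
  have h2 := (continuousAt_cross3 hu.continuousAt (continuousAt_covVec hφ hU he hz hu 1)).tendsto.mono_left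
    (nhdsWithin_le_nhds (s := {z}ᶜ))
  exact tendsto_nhds_unique (h1.congr' h) h2

end SmoothSections

/-! ### The affine coordinate, its Riccati equation, and removable singularities. -/

section RemovableSingularities

/-- The affine coordinate of a point of the sphere. -/
def affineCoord (u : Fin 3 → ℝ) : ℂ := (u 1 - u 2 * Complex.I) * ((1 - u 0 : ℝ) : ℂ)⁻¹

/-- The point of the sphere with a given affine coordinate. -/
def affinePoint (w : ℂ) : Fin 3 → ℝ :=
  ![(Complex.normSq w - 1) / (Complex.normSq w + 1), 2 * w.re / (Complex.normSq w + 1),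
    -(2 * w.im) / (Complex.normSq w + 1)]

theorem dot3_affinePoint (w : ℂ) : dot3 (affinePoint w) (affinePoint w) = 1 := by
  have h : Complex.normSq w + 1 ≠ 0 := by positivity [Complex.normSq_nonneg w]
  simp only [dot3, affinePoint, Matrix.cons_val]
  field_simp
  simp only [Complex.normSq_apply]
  ring

theorem affineCoord_re (u : Fin 3 → ℝ) : (affineCoord u).re = u 1 / (1 - u 0) := by
  rw [affineCoord, ← Complex.ofReal_inv, Complex.re_mul_ofReal]
  simp [div_eq_mul_inv]

theorem affineCoord_im (u : Fin 3 → ℝ) : (affineCoord u).im = -u 2 / (1 - u 0) := by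
  rw [affineCoord, ← Complex.ofReal_inv, Complex.im_mul_ofReal]
  simp [div_eq_mul_inv]

/-- This translates a gap below u 0 = 1 into boundedness of the affine coordinate. -/
theorem normSq_affineCoord {u : Fin 3 → ℝ} (hu : dot3 u u = 1) (h : u 0 < 1) :
    Complex.normSq (affineCoord u) = (1 + u 0) / (1 - u 0) := by
  have h1 : 1 - u 0 ≠ 0 := by linarith
  rw [Complex.normSq_apply, affineCoord_re, affineCoord_im]
  simp only [dot3] at hu
  field_simp
  linear_combination hu

theorem affinePoint_affineCoord {u : Fin 3 → ℝ} (hu : dot3 u u = 1) (h : u 0 < 1) :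
    affinePoint (affineCoord u) = u := by
  have h1 : 1 - u 0 ≠ 0 := by linarith
  have h2 : Complex.normSq (affineCoord u) + 1 = 2 / (1 - u 0) := by
    rw [normSq_affineCoord hu h]
    field_simp
    ring
  have h3 : Complex.normSq (affineCoord u) - 1 = 2 * u 0 / (1 - u 0) := by
    rw [normSq_affineCoord hu h]
    field_simp
    ring
  ext i
  fin_cases i
  · simp only [affinePoint, h2, h3]
    simp
    field_simp
  · simp only [affinePoint, h2, affineCoord_re]
    simp
    field_simp
  · simp only [affinePoint, h2, affineCoord_im]
    simp
    field_simp

theorem contDiffAt_affinePoint {w : ℂ → ℂ} {z : ℂ} (hw : ContDiffAt ℝ 1 w z) :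
    ContDiffAt ℝ 1 (fun x => affinePoint (w x)) z := by
  have hre : ContDiffAt ℝ 1 (fun x => (w x).re) z := Complex.reCLM.contDiff.contDiffAt.comp z hw
  have him : ContDiffAt ℝ 1 (fun x => (w x).im) z := Complex.imCLM.contDiff.contDiffAt.comp z hw
  have hn : ContDiffAt ℝ 1 (fun x => Complex.normSq (w x)) z := by
    simp only [Complex.normSq_apply]
    exact (hre.mul hre).add (him.mul him)
  have h0 : Complex.normSq (w z) + 1 ≠ 0 := by positivity [Complex.normSq_nonneg (w z)]
  refine contDiffAt_pi.2 fun i => ?_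
  fin_cases i
  · exact (hn.sub contDiffAt_const).div (hn.add contDiffAt_const) h0
  · exact (contDiffAt_const.mul hre).div (hn.add contDiffAt_const) h0
  · exact (contDiffAt_const.mul him).neg.div (hn.add contDiffAt_const) h0

/-- The quadratic vector field which is induced by a rotation in the affine coordinate. -/
def rotField (θ : Fin 3 → ℝ) (w : ℂ) : ℂ :=
  -(Complex.I / 2 * θ 1 + θ 2 / 2) + -(Complex.I * θ 0) * w + (Complex.I / 2 * θ 1 - θ 2 / 2) * w ^ 2

/-- The Riccati equation, before division. -/
theorem riccati_identity {u a c s t : Fin 3 → ℝ} (hu : dot3 u u = 1) (ha : dot3 u a = 0)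
    (h : c + cross3 t u = cross3 u (a + cross3 s u)) :
    (((a 1 - a 2 * Complex.I) * (1 - u 0) + (u 1 - u 2 * Complex.I) * a 0) +
      Complex.I * ((c 1 - c 2 * Complex.I) * (1 - u 0) + (u 1 - u 2 * Complex.I) * c 0) : ℂ) =
    -((-(Complex.I / 2 * s 1 + s 2 / 2) * (1 - u 0) ^ 2 + -(Complex.I * s 0) * (u 1 - u 2 * Complex.I)
        * (1 - u 0) + (Complex.I / 2 * s 1 - s 2 / 2) * (u 1 - u 2 * Complex.I) ^ 2) +
      Complex.I * (-(Complex.I / 2 * t 1 + t 2 / 2) * (1 - u 0) ^ 2 + -(Complex.I * t 0) *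
        (u 1 - u 2 * Complex.I) * (1 - u 0) +
        (Complex.I / 2 * t 1 - t 2 / 2) * (u 1 - u 2 * Complex.I) ^ 2)) := by
  have hn : ((u 0 : ℂ)) ^ 2 + u 1 ^ 2 + u 2 ^ 2 = 1 := by
    simp only [dot3] at hu
    exact_mod_cast (by linear_combination hu : u 0 ^ 2 + u 1 ^ 2 + u 2 ^ 2 = 1)
  have ha' : (u 0 : ℂ) * a 0 + u 1 * a 1 + u 2 * a 2 = 0 := by
    simp only [dot3] at ha
    exact_mod_cast ha
  have hI : Complex.I ^ 2 = -1 := Complex.I_sq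
  -- the action of a rotation
  have rot : ∀ θ : Fin 3 → ℝ, ((cross3 θ u 1 - cross3 θ u 2 * Complex.I) * (1 - u 0) +
      (u 1 - u 2 * Complex.I) * cross3 θ u 0 : ℂ) =
      -(Complex.I / 2 * θ 1 + θ 2 / 2) * (1 - u 0) ^ 2 + -(Complex.I * θ 0) * (u 1 - u 2 * Complex.I)
        * (1 - u 0) + (Complex.I / 2 * θ 1 - θ 2 / 2) * (u 1 - u 2 * Complex.I) ^ 2 := by
    intro θ
    simp only [cross3, Matrix.cons_val]
    push_cast
    linear_combination (-(1 / 2) * (θ 2 : ℂ) - Complex.I / 2 * θ 1) * hn +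
      (-(u 2 : ℂ) * θ 0 * (1 - u 0) + u 1 * u 2 * θ 1 - Complex.I / 2 * θ 1 * u 2 ^ 2 +
        θ 2 / 2 * u 2 ^ 2) * hI
  -- On tangent vectors of the sphere, A ↦ u × A corresponds to multiplication by i in this
  -- coordinate. That is why the conjugate u 1 - i u 2 is used in `affineCoord`.
  have tang : ∀ A : Fin 3 → ℝ, dot3 u A = 0 →
      (((A 1 - A 2 * Complex.I) * (1 - u 0) + (u 1 - u 2 * Complex.I) * A 0) + Complex.I *
        ((cross3 u A 1 - cross3 u A 2 * Complex.I) * (1 - u 0) +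
        (u 1 - u 2 * Complex.I) * cross3 u A 0) : ℂ) = 0 := by
    intro A hA
    have hA' : (u 0 : ℂ) * A 0 + u 1 * A 1 + u 2 * A 2 = 0 := by
      simp only [dot3] at hA
      exact_mod_cast hA
    simp only [cross3, Matrix.cons_val]
    push_cast
    linear_combination (u 1 - u 2 * Complex.I) * hA' + (-A 1 + A 2 * Complex.I) * hn -
      ((u 0 * A 1 - u 1 * A 0) * (1 - u 0) + u 2 * (u 1 * A 2 - u 2 * A 1)) * hI
  have hA : dot3 u (a + cross3 s u) = 0 := by
    simp only [dot3, cross3, Pi.add_apply, Matrix.cons_val] at ha ⊢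
    linear_combination ha
  have h1 := tang _ hA
  rw [← h] at h1
  simp only [Pi.add_apply] at h1
  push_cast at h1
  linear_combination h1 - rot s - Complex.I * rot t

/-- The affine coordinate of a solution of the Cauchy-Riemann equation solves a Riccati equation. -/
theorem dbar_affineCoord {u : ℂ → Fin 3 → ℝ} {z : ℂ} (hd : DifferentiableAt ℝ u z)
    (hu : ∀ᶠ w in 𝓝 z, dot3 (u w) (u w) = 1) (h1 : u z 0 < 1) {s t : Fin 3 → ℝ}
    (h : fderiv ℝ u z Complex.I + cross3 t (u z) =
      cross3 (u z) (fderiv ℝ u z 1 + cross3 s (u z))) :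
    DifferentiableAt ℝ (fun w => affineCoord (u w)) z ∧
    dbar (fun w => affineCoord (u w)) z =
      -(rotField s (affineCoord (u z)) + Complex.I * rotField t (affineCoord (u z))) := by
  have hi : ∀ i, HasFDerivAt (fun w => u w i) (ContinuousLinearMap.proj i ∘L fderiv ℝ u z) z :=
    fun i => (hasFDerivAt_pi'.1 hd.hasFDerivAt) i
  have hd0 : dot3 (u z) (fderiv ℝ u z 1) = 0 := by
    have h2 : HasFDerivAt (fun w => dot3 (u w) (u w)) _ z :=
      (((hi 0).mul (hi 0)).add ((hi 1).mul (hi 1))).add ((hi 2).mul (hi 2))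
    have h3 : HasFDerivAt (fun w => dot3 (u w) (u w)) (0 : ℂ →L[ℝ] ℝ) z :=
      (hasFDerivAt_const (1 : ℝ) z).congr_of_eventuallyEq hu
    have h4 := DFunLike.congr_fun (h2.unique h3) 1
    have h5 : u z 0 * fderiv ℝ u z 1 0 + u z 0 * fderiv ℝ u z 1 0 +
        (u z 1 * fderiv ℝ u z 1 1 + u z 1 * fderiv ℝ u z 1 1) +
        (u z 2 * fderiv ℝ u z 1 2 + u z 2 * fderiv ℝ u z 1 2) = 0 := by simpa using h4
    simp only [dot3]
    linear_combination (1 / 2) * h5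
  have hne : (1 - u z 0 : ℝ) ≠ 0 := by linarith
  have hneC : (1 - u z 0 : ℂ) ≠ 0 := by exact_mod_cast hne
  have hc : ∀ i, HasFDerivAt (fun w => (u w i : ℂ))
      (Complex.ofRealCLM ∘L (ContinuousLinearMap.proj i ∘L fderiv ℝ u z)) z := fun i =>
    Complex.ofRealCLM.hasFDerivAt.comp z (hi i)
  have hnum : HasFDerivAt (fun w => (u w 1 - u w 2 * Complex.I : ℂ)) _ z :=
    (hc 1).sub ((hc 2).mul_const Complex.I)
  have hinv0 : HasFDerivAt (fun w => (1 - u w 0)⁻¹) _ z :=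
    (hasDerivAt_inv hne).comp_hasFDerivAt z ((hi 0).const_sub 1)
  have hinv : HasFDerivAt (fun w => ((1 - u w 0 : ℝ) : ℂ)⁻¹) _ z :=
    (Complex.ofRealCLM.hasFDerivAt.comp z hinv0).congr_of_eventuallyEq
      (.of_forall fun w => (Complex.ofReal_inv _).symm)
  have hw : HasFDerivAt (fun w => affineCoord (u w)) _ z := hnum.mul hinv
  refine ⟨hw.differentiableAt, ?_⟩
  have hdir : ∀ ζ, fderiv ℝ (fun w => affineCoord (u w)) z ζ =
      ((fderiv ℝ u z ζ 1 - fderiv ℝ u z ζ 2 * Complex.I) * (1 - u z 0) +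
        (u z 1 - u z 2 * Complex.I) * fderiv ℝ u z ζ 0) / (1 - u z 0) ^ 2 := by
    intro ζ
    rw [hw.fderiv]
    simp
    field_simp
    ring
  rw [dbar, hdir, hdir, smul_eq_mul]
  have key := riccati_identity hu.self_of_nhds hd0 h
  rw [eq_comm, rotField, rotField, affineCoord]
  push_cast
  field_simp
  linear_combination -2 * key

variable {S : Type*} [TopologicalSpace S] [ChartedSpace ℂ S] [IsManifold 𝓘(ℂ) ω S]
  {N : Type*} [TopologicalSpace N] [ChartedSpace E4 N] [IsManifold (𝓡 4) ∞ N]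
  {φ : S → N} {x₀ : S} {y₀ : N} {z : ℂ} {g : Metric N}
  {e : ∀ x : S, Fin 4 → TangentSpace (𝓡 4) (φ x)} {U : Set S}

/-- Bounded isolated singularities of solutions of the Cauchy-Riemann equation are removable. -/
theorem exists_extension_of_covVec (hφ : ContMDiff 𝓘(ℝ, ℂ) (𝓡 4) ∞ φ) (hU : IsOpen U)
    (he : IsLocalFrame g φ U e) (hz : z ∈ patch φ x₀ y₀ ∩ pt x₀ ⁻¹' U) {u : ℂ → Fin 3 → ℝ} {δ : ℝ}
    (hδ : 0 < δ)
    (h : ∀ᶠ w in 𝓝[≠] z, DifferentiableAt ℝ u w ∧ (∀ᶠ w' in 𝓝 w, dot3 (u w') (u w') = 1) ∧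
      u w 0 ≤ 1 - δ ∧ covVec g φ e x₀ y₀ u w Complex.I =
        cross3 (u w) (covVec g φ e x₀ y₀ u w 1)) :
    ∃ u' : ℂ → Fin 3 → ℝ, ContDiffAt ℝ 1 u' z ∧ (∀ w, dot3 (u' w) (u' w) = 1) ∧
      ∀ᶠ w in 𝓝[≠] z, u w = u' w := by
  let r : ℂ → Fin 3 → ℂ → ℂ := fun ζ i w => (frameRot g φ e x₀ y₀ w ζ i : ℂ)
  have hr : ∀ ζ i, ContDiffAt ℝ 1 (r ζ i) z := fun ζ i =>
    Complex.ofRealCLM.contDiff.contDiffAt.comp z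
      (((contDiffOn_frameRot hφ hU he ζ i).contDiffAt
        ((isOpen_patch_inter hφ.continuous x₀ y₀ hU).mem_nhds hz)).of_le (by simp))
  have hcm : ∀ (c : ℂ) (f : ℂ → ℂ), ContDiffAt ℝ 1 f z → ContDiffAt ℝ 1 (fun w => c * f w) z :=
    fun c f hf => contDiffAt_const.mul hf
  -- The bound comes from |w|² = (1 + u 0)/(1 - u 0) ≤ 2/δ. The coefficients are those of -(rotField
  -- θ₁ + i rotField θ₂) as a quadratic polynomial in w.
  obtain ⟨w', hw', hww'⟩ := riccati_removable (p := z) (R := √(2 / δ))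
    (a := fun w => (Complex.I / 2 * r 1 1 w + 1 / 2 * r 1 2 w) +
      (Complex.I * (Complex.I / 2) * r Complex.I 1 w + Complex.I * (1 / 2) * r Complex.I 2 w))
    (b := fun w => Complex.I * r 1 0 w + Complex.I * Complex.I * r Complex.I 0 w)
    (c := fun w => (-(Complex.I / 2) * r 1 1 w + 1 / 2 * r 1 2 w) +
      (-(Complex.I * (Complex.I / 2)) * r Complex.I 1 w + Complex.I * (1 / 2) * r Complex.I 2 w))
    (w := fun w => affineCoord (u w))
    (((hcm _ _ (hr _ _)).add (hcm _ _ (hr _ _))).add ((hcm _ _ (hr _ _)).add (hcm _ _ (hr _ _))))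
    ((hcm _ _ (hr _ _)).add (hcm _ _ (hr _ _)))
    (((hcm _ _ (hr _ _)).add (hcm _ _ (hr _ _))).add ((hcm _ _ (hr _ _)).add (hcm _ _ (hr _ _))))
    (by
      filter_upwards [h] with w ⟨hd, h1, hle, hcr⟩
      have hlt : u w 0 < 1 := by linarith
      obtain ⟨h2, h3⟩ := dbar_affineCoord hd h1 hlt hcr
      refine ⟨h2, ?_, ?_⟩
      · rw [h3, rotField, rotField]
        simp only [r]
        ring
      · refine Real.le_sqrt_of_sq_le ?_
        rw [← Complex.normSq_eq_norm_sq, normSq_affineCoord h1.self_of_nhds hlt]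
        have : u w 0 ≤ 1 := hlt.le
        gcongr
        · linarith
        · linarith)
  refine ⟨fun w => affinePoint (w' w), contDiffAt_affinePoint hw', fun w => dot3_affinePoint _, ?_⟩
  filter_upwards [h, hww'] with w ⟨_, h1, hle, _⟩ h2
  have hlt : u w 0 < 1 := by linarith
  rw [← h2, affinePoint_affineCoord h1.self_of_nhds hlt]

open Classical in
/-- Bounded isolated singularities of holomorphic sections are removable. -/
theorem exists_holomorphic_extension [T2Space S] (hφ : ContMDiff 𝓘(ℝ, ℂ) (𝓡 4) ∞ φ) {V : Set S}
    {p : S} {J : EndSection φ} {δ : ℝ} (hV : IsOpen V) (hp : p ∈ V) (he : IsLocalFrame g φ V e)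
    (hJ : IsHolomorphicOn g φ J (V \ {p})) (hδ : 0 < δ)
    (hb : ∀ x ∈ V \ {p}, frameCoeff g φ e J 0 x ≤ 1 - δ) :
    ∃ J' : EndSection φ, (∀ x ∈ V \ {p}, J' x = J x) ∧ IsHolomorphicOn g φ J' V := by
  have hV' : IsOpen (V \ {p}) := hV.sdiff isClosed_singleton
  have hVV' : V \ {p} ⊆ V := Set.sdiff_subset
  set z₀ := chartAt ℂ p p with hz₀
  have hz₀t : z₀ ∈ (chartAt ℂ p).target := (chartAt ℂ p).map_source (mem_chart_source ℂ p)
  have hpz : pt p z₀ = p := (chartAt ℂ p).left_inv (mem_chart_source ℂ p)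
  have hzV : z₀ ∈ patch φ p (φ (pt p z₀)) ∩ pt p ⁻¹' V :=
    ⟨mem_patch hz₀t, by rw [Set.mem_preimage, hpz]; exact hp⟩
  have hcr := (isHolomorphicOn_iff_covVec hφ hV he hV' hVV' hJ.1).1 hJ
  have hC1 := fun x (hx : x ∈ V \ {p}) => isC1At_frameCoeff hφ hV he hV' hVV' hJ.1 hx
  have hcoeff := fun x (hx : x ∈ V \ {p}) =>
    eq_fiberSd_frameCoeff g (he.orthonormal x (hVV' hx)) (hJ.1.1 x hx)
  have hpunct : ∀ᶠ x in 𝓝[≠] p, x ∈ V \ {p} := by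
    filter_upwards [nhdsWithin_le_nhds (hV.mem_nhds hp), self_mem_nhdsWithin] with x h1 h2
    exact ⟨h1, h2⟩
  have htend := tendsto_pt_punctured hz₀t
  rw [hpz] at htend
  obtain ⟨u', hu', hu'1, huu'⟩ := exists_extension_of_covVec (u := fun w i =>
    frameCoeff g φ e J i (pt p w)) hφ hV he hzV hδ (by
      filter_upwards [htend.eventually hpunct, nhdsWithin_le_nhds
        (eventually_mem_patch hφ.continuous hV hzV)] with w hw hwV
      refine ⟨(hC1 _ hw p w hwV.1.1 rfl).differentiableAt (by simp), ?_, hb _ hw,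
        hcr p _ w ⟨hwV.1, hw⟩⟩
      refine eventually_pt (P := fun x => dot3 (fun i => frameCoeff g φ e J i x)
        (fun i => frameCoeff g φ e J i x) = 1) hwV.1.1 ?_
      filter_upwards [hV'.mem_nhds hw] with x hx
      exact (hcoeff x hx).2)
  -- Only the value at p changes. There u agrees locally with the C¹ extension, and the
  -- Cauchy–Riemann equation at p follows by continuity from the punctured neighbourhood.
  let u : S → Fin 3 → ℝ := Function.update (fun x i => frameCoeff g φ e J i x) p (u' z₀)
  let J' : EndSection φ := Function.update J p (fiberSd g (φ p) (e p) (u' z₀))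
  have hJ'J : ∀ x, x ≠ p → J' x = J x := fun x hx => Function.update_of_ne hx _ _
  have hux : ∀ x, x ≠ p → u x = fun i => frameCoeff g φ e J i x :=
    fun x hx => Function.update_of_ne hx _ _
  have hJ'u : ∀ x ∈ V, J' x = fiberSd g (φ x) (e x) (u x) ∧ dot3 (u x) (u x) = 1 := by
    intro x hx
    by_cases hxp : x = p
    · subst hxp
      simp only [J', u, Function.update_self]
      exact ⟨trivial, hu'1 _⟩
    · rw [hJ'J x hxp, hux x hxp]
      exact hcoeff x ⟨hx, hxp⟩
  have hev : ∀ x ∈ V, ∀ᶠ x' in 𝓝 x, x' ∈ V := fun x hx => hV.mem_nhds hx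
  have hC1' : ∀ x ∈ V, IsC1At u x := by
    intro x hx
    by_cases hxp : x = p
    · subst hxp
      have h1 : (fun w => u (pt x w)) =ᶠ[𝓝 z₀] u' := by
        have h2 : ∀ᶠ w in 𝓝[≠] z₀, u (pt x w) = u' w := by
          filter_upwards [htend.eventually self_mem_nhdsWithin, huu'] with w hw hw'
          rw [hux _ hw, hw']
        refine eventually_nhdsWithin_iff.1 h2 |>.mono fun w hw => ?_
        by_cases hwz : w = z₀
        · rw [hwz]
          refine (congrArg u hpz).trans ?_
          exact Function.update_self _ _ _
        · exact hw hwz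
      have h3 := isC1At_of_contDiffAt (u := u) hz₀t (hu'.congr_of_eventuallyEq h1)
      rwa [hpz] at h3
    · intro x₁ z₁ hz₁ hzx
      refine (hC1 x ⟨hx, hxp⟩ x₁ z₁ hz₁ hzx).congr_of_eventuallyEq ?_
      refine (eventually_pt (P := fun x => u x = fun i => frameCoeff g φ e J i x) hz₁ ?_)
      rw [hzx]
      filter_upwards [isOpen_compl_singleton.mem_nhds hxp] with x' hx'
      exact hux x' hx'
  have hJ'C1 : IsC1SectionOn g φ J' V := by
    refine ⟨fun x hx => ?_, fun x₁ y₁ z₁ hz₁ => ?_⟩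
    · rw [(hJ'u x hx).1]
      exact fiberSd_mem_twistorFiber g (he.orthonormal x hx) (hJ'u x hx).2
    · exact (contDiffAt_localSection hφ hV he hz₁ (hC1' _ hz₁.2)
        ((hev _ hz₁.2).mono fun x hx => (hJ'u x hx).1)).contDiffWithinAt
  refine ⟨J', fun x hx => hJ'J x hx.2, ?_⟩
  rw [isHolomorphicOn_iff_covDeriv hφ.continuous hV hJ'C1]
  have hreg : ∀ x₁ y₁, ∀ w ∈ patch φ x₁ y₁ ∩ pt x₁ ⁻¹' V, pt x₁ w ≠ p →
      covDeriv g φ J' x₁ y₁ w Complex.I =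
        covDeriv g φ J' x₁ y₁ w 1 * localSection φ J' x₁ y₁ w := by
    intro x₁ y₁ w hw hwp
    have h1 : localSection φ J' x₁ y₁ =ᶠ[𝓝 w] localSection φ J x₁ y₁ := by
      refine localSection_eventuallyEq hw.1.1 ?_
      filter_upwards [isOpen_compl_singleton.mem_nhds hwp] with x' hx'
      exact hJ'J x' hx'
    rw [covDeriv_congr h1, covDeriv_congr h1, h1.self_of_nhds]
    exact (isHolomorphicOn_iff_covDeriv hφ.continuous hV' hJ.1).1 hJ x₁ y₁ w ⟨hw.1, hw.2, hwp⟩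
  intro x₁ y₁ z₁ hz₁
  by_cases hzp : pt x₁ z₁ = p
  · have hiff : ∀ w ∈ patch φ x₁ y₁ ∩ pt x₁ ⁻¹' V, _ := fun w hw =>
      covDeriv_iff_covVec (J := J') (u := u) hφ hV he hw (hC1' _ hw.2)
        ((hev _ hw.2).mono fun x hx => (hJ'u x hx).1) ((hev _ hw.2).mono fun x hx => (hJ'u x hx).2)
    refine (hiff z₁ hz₁).2 (covVec_eq_of_punctured hφ hV he hz₁ (hC1' _ hz₁.2 x₁ z₁ hz₁.1.1 rfl) ?_)
    filter_upwards [nhdsWithin_le_nhds (eventually_mem_patch hφ.continuous hV hz₁),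
      (tendsto_pt_punctured hz₁.1.1).eventually self_mem_nhdsWithin] with w hw hwp
    rw [hzp] at hwp
    exact (hiff w hw).1 (hreg x₁ y₁ w hw hwp)
  · exact hreg x₁ y₁ z₁ hz₁ hzp

end RemovableSingularities

/-! ### The differential of the map and structures compatible with it. -/

section Differential

variable {S : Type*} [TopologicalSpace S] [ChartedSpace ℂ S]
  {N : Type*} [TopologicalSpace N] [ChartedSpace E4 N]
  {φ : S → N} {x₀ : S} {y₀ : N} {z : ℂ}

/-- The differential of a map, in the preferred charts at a point and at its image. -/
def dAt (φ : S → N) (x : S) : ℂ →L[ℝ] E4 := mfderiv 𝓘(ℝ, ℂ) (𝓡 4) φ x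

theorem pt_chartAt (x : S) : pt x (chartAt ℂ x x) = x :=
  (chartAt ℂ x).left_inv (mem_chart_source ℂ x)

theorem chartAt_mem_target (x : S) : chartAt ℂ x x ∈ (chartAt ℂ x).target :=
  (chartAt ℂ x).map_source (mem_chart_source ℂ x)

theorem chartAt_mem_patch (φ : S → N) (x : S) : chartAt ℂ x x ∈ patch φ x (φ x) :=
  ⟨chartAt_mem_target x, by rw [pt_chartAt]; exact mem_chart_source E4 (φ x)⟩

theorem dAt_eq_dMap (hφ : ContMDiff 𝓘(ℝ, ℂ) (𝓡 4) ∞ φ) (x : S) (ζ : ℂ) :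
    dAt φ x ζ = dMap φ x (φ x) (chartAt ℂ x x) ζ := by
  have h := (hφ.mdifferentiable (by simp) x).mfderiv
  have h2 : dAt φ x = _ := h
  rw [h2, modelWithCornersSelf_coe, Set.range_id, fderivWithin_univ]
  rfl

theorem eventually_pt_punctured {P : S → Prop} (x : S)
    (h : ∀ᶠ z in 𝓝[≠] (chartAt ℂ x x), P (pt x z)) : ∀ᶠ x' in 𝓝[≠] x, P x' := by
  have h1 : Filter.Tendsto (chartAt ℂ x) (𝓝[≠] x) (𝓝[≠] (chartAt ℂ x x)) := by
    refine tendsto_nhdsWithin_iff.2 ⟨((chartAt ℂ x).continuousAt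
      (mem_chart_source ℂ x)).tendsto.mono_left nhdsWithin_le_nhds, ?_⟩
    filter_upwards [nhdsWithin_le_nhds ((chartAt ℂ x).open_source.mem_nhds (mem_chart_source ℂ x)),
      self_mem_nhdsWithin] with w hw hwz h
    exact hwz ((chartAt ℂ x).injOn hw (mem_chart_source ℂ x) h)
  filter_upwards [h1.eventually h, nhdsWithin_le_nhds ((chartAt ℂ x).open_source.mem_nhds
    (mem_chart_source ℂ x))] with w hw hw'
  have : pt x (chartAt ℂ x w) = w := (chartAt ℂ x).left_inv hw'
  rwa [this] at hw

theorem eventually_of_pt {P : S → Prop} (x : S)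
    (h : ∀ᶠ z in 𝓝 (chartAt ℂ x x), P (pt x z)) : ∀ᶠ x' in 𝓝 x, P x' := by
  have h1 : ContinuousAt (chartAt ℂ x) x := (chartAt ℂ x).continuousAt (mem_chart_source ℂ x)
  filter_upwards [h1.eventually h, (chartAt ℂ x).open_source.mem_nhds
    (mem_chart_source ℂ x)] with w hw hw'
  have : pt x (chartAt ℂ x w) = w := (chartAt ℂ x).left_inv hw'
  rwa [this] at hw

variable {J : EndSection φ}

/-- Sections which are compatible with the differential of the map. -/
def IsCompatibleAt (φ : S → N) (J : EndSection φ) (x : S) : Prop :=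
  ∀ ζ : ℂ, (J x (dAt φ x ζ) : E4) = dAt φ x (Complex.I * ζ)

/-- Since c and ic span ℂ over the reals and K² = -1, compatibility on one nonzero vector suffices.
-/
theorem apply_eq_of_apply_eq {K : E4 →L[ℝ] E4} {d : ℂ →L[ℝ] E4} (hK : ∀ v, K (K v) = -v) {c : ℂ}
    (hc : c ≠ 0) (h : K (d c) = d (Complex.I * c)) (ζ : ℂ) : K (d ζ) = d (Complex.I * ζ) := by
  have h1 : K (d (Complex.I * c)) = -d c := by rw [← h, hK]
  have h2 : ζ = (ζ / c).re • c + (ζ / c).im • (Complex.I * c) := by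
    rw [Complex.real_smul, Complex.real_smul, ← mul_assoc, ← add_mul, Complex.re_add_im,
      div_mul_cancel₀ _ hc]
  have h3 : Complex.I * ζ = (ζ / c).re • (Complex.I * c) + (ζ / c).im • (-c) := by
    conv_lhs => rw [h2]
    simp only [Complex.real_smul]
    linear_combination ((ζ / c).im : ℂ) * c * Complex.I_sq
  rw [h3, map_add, map_smul, map_smul, map_neg, ← h, ← h1, ← map_smul K, ← map_smul K,
    ← map_add K, ← map_smul d, ← map_smul d, ← map_add d, ← h2]

theorem isCompatibleAt_of_apply {x : S} (hJ : ∀ v, J x (J x v) = -v) {c : ℂ} (hc : c ≠ 0)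
    (h : (J x (dAt φ x c) : E4) = dAt φ x (Complex.I * c)) : IsCompatibleAt φ J x :=
  apply_eq_of_apply_eq (K := J x) hJ hc h

variable [IsManifold (𝓡 4) ∞ N] {g : Metric N}

theorem localSection_apply_ofFiber (hz : z ∈ patch φ x₀ y₀) (v : TangentSpace (𝓡 4) (φ (pt x₀ z))) :
    localSection φ J x₀ y₀ z (ofFiber y₀ (φ (pt x₀ z)) v) =
      ofFiber y₀ (φ (pt x₀ z)) (J (pt x₀ z) v) :=
  congrArg (fun w => ofFiber y₀ (φ (pt x₀ z)) (J (pt x₀ z) w)) (toFiber_ofFiber hz.2 v)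

theorem chartForm_self (g : Metric N) (y : N) (v w : E4) :
    chartForm g y (chartAt E4 y y) v w = fiberForm g y v w := by
  refine Eq.trans ?_ (chartForm_ofFiber g (mem_chart_source E4 y) v w)
  exact (congrArg₂ (fun v w => chartForm g y (chartAt E4 y y) v w) (ofFiber_self y v)
    (ofFiber_self y w)).symm

theorem IsBranchedMinimalImmersion.fiberForm_dAt (h : IsBranchedMinimalImmersion g φ) (x : S) :
    fiberForm g (φ x) (dAt φ x Complex.I) (dAt φ x Complex.I) =
      fiberForm g (φ x) (dAt φ x 1) (dAt φ x 1) ∧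
    fiberForm g (φ x) (dAt φ x 1) (dAt φ x Complex.I) = 0 := by
  have h1 := h.conformal x (φ x) _ (chartAt_mem_patch φ x)
  simp only [pullbackMetric, ← chartForm_apply, ← dAt_eq_dMap h.smooth] at h1
  have h2 : localMap φ x (φ x) (chartAt ℂ x x) = chartAt E4 (φ x) (φ x) := by
    rw [localMap, pt_chartAt]
  rw [h2] at h1
  simpa only [chartForm_self] using h1

theorem IsBranchedMinimalImmersion.fiberForm_dAt_apply (h : IsBranchedMinimalImmersion g φ) (x : S)
    (ζ η : ℂ) : fiberForm g (φ x) (dAt φ x ζ) (dAt φ x η) =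
      (ζ.re * η.re + ζ.im * η.im) * fiberForm g (φ x) (dAt φ x 1) (dAt φ x 1) := by
  obtain ⟨h1, h2⟩ := h.fiberForm_dAt x
  have h3 : ∀ ζ : ℂ, dAt φ x ζ = ζ.re • dAt φ x 1 + ζ.im • dAt φ x Complex.I := by
    intro ζ
    rw [← map_smul, ← map_smul, ← map_add]
    congr 1
    apply Complex.ext <;> simp
  have h4 := fiberForm_symm g (φ x) (dAt φ x Complex.I) (dAt φ x 1)
  rw [h2] at h4
  rw [h3 ζ, h3 η]
  simp only [map_add, map_smul, add_apply, smul_apply, smul_eq_mul, h1, h2, h4]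
  ring

theorem dAt_ne_zero {x : S} (hx : ¬ IsBranchPoint φ x)
    (h : IsBranchedMinimalImmersion g φ) : dAt φ x 1 ≠ 0 := by
  intro h0
  refine hx ?_
  have h1 : dAt φ x = 0 := by
    ext ζ : 1
    by_contra h2
    have h3 := fiberForm_pos g (φ x) (dAt φ x ζ) h2
    rw [h.fiberForm_dAt_apply, h0, map_zero, mul_zero] at h3
    exact h3.false
  exact h1

/-- Away from the branch points compatible sections are the sections in adapted bases. -/
theorem isCompatibleAt_iff (h : IsBranchedMinimalImmersion g φ) {x : S}
    (hJ : J x ∈ twistorFiber g (φ x)) (hx : ¬ IsBranchPoint φ x) :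
    IsCompatibleAt φ J x ↔ ∃ e : Fin 4 → TangentSpace (𝓡 4) (φ x), IsAdaptedFrame g φ x e ∧
      J x (e 0) = e 1 ∧ J x (e 1) = -e 0 ∧ J x (e 2) = e 3 ∧ J x (e 3) = -e 2 := by
  have hpos := fiberForm_pos g (φ x) _ (dAt_ne_zero hx h)
  constructor
  · intro hc
    set l := fiberForm g (φ x) (dAt φ x 1) (dAt φ x 1) with hl
    have hs := Real.sqrt_pos.2 hpos
    set a : ℂ := Complex.ofReal (√l)⁻¹ with ha
    have hva : fiberForm g (φ x) (dAt φ x a) (dAt φ x a) = 1 := by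
      rw [h.fiberForm_dAt_apply, ← hl]
      simp only [ha, Complex.ofReal_re, Complex.ofReal_im, mul_zero, add_zero]
      have := Real.mul_self_sqrt hpos.le
      field_simp
      linear_combination -this
    obtain ⟨e, he, hdet, he0, h1, h2, h3, h4⟩ := exists_adapted_isON (fiberForm_symm g (φ x))
      (fiberForm_pos g (φ x)) (K := J x) hJ hva
    refine ⟨e, ⟨⟨he, hdet⟩, a, Complex.I * a, ?_, he0.symm, ?_⟩, h1, h2, h3, h4⟩
    · simp [ha]
      positivity
    · refine (hc a).symm.trans (Eq.trans ?_ h1)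
      exact congrArg (J x) he0.symm
  · rintro ⟨e, ⟨⟨hon, -⟩, a, b, hab, h0, h1⟩, h2, -, -, -⟩
    have h0' : dAt φ x a = e 0 := h0
    have h1' : dAt φ x b = e 1 := h1
    have e00 : fiberForm g (φ x) (e 0) (e 0) = 1 := hon 0 0
    have e11 : fiberForm g (φ x) (e 1) (e 1) = 1 := hon 1 1
    have e01 : fiberForm g (φ x) (e 0) (e 1) = 0 := hon 0 1
    rw [← h0', h.fiberForm_dAt_apply] at e00
    rw [← h1', h.fiberForm_dAt_apply] at e11
    rw [← h0', ← h1', h.fiberForm_dAt_apply] at e01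
    have hn : a.re * a.re + a.im * a.im = b.re * b.re + b.im * b.im :=
      mul_right_cancel₀ hpos.ne' (e00.trans e11.symm)
    have ho : a.re * b.re + a.im * b.im = 0 := (mul_eq_zero.1 e01).resolve_right hpos.ne'
    have ha0 : a ≠ 0 := by
      rintro rfl
      simp at hab
    have hab' : 0 < a.re * b.im - a.im * b.re := by
      have : ((starRingEnd ℂ) a * b).im = a.re * b.im - a.im * b.re := by
        simp [Complex.mul_im]; ring
      rwa [this] at hab
    have hna : 0 < a.re * a.re + a.im * a.im := by
      have := Complex.normSq_pos.2 ha0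
      rwa [Complex.normSq_apply] at this
    -- Lagrange's identity gives the determinant of a, b up to sign, and the orientation fixes the
    -- sign. Together with orthogonality this forces b = ia.
    have hd : a.re * b.im - a.im * b.re = a.re * a.re + a.im * a.im := by
      have h3 : (a.re * b.im - a.im * b.re) ^ 2 = (a.re * a.re + a.im * a.im) ^ 2 := by
        linear_combination (-(a.re * b.re + a.im * b.im)) * ho -
          (a.re * a.re + a.im * a.im) * hn
      exact (pow_left_inj₀ hab'.le hna.le two_ne_zero).1 h3
    have hb : b = Complex.I * a := by
      have h4 : b.re = -a.im := by
        refine mul_left_cancel₀ hna.ne' ?_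
        linear_combination a.re * ho - a.im * hd
      have h5 : b.im = a.re := by
        refine mul_left_cancel₀ hna.ne' ?_
        linear_combination a.im * ho + a.re * hd
      apply Complex.ext
      · simp [h4]
      · simp [h5]
    refine isCompatibleAt_of_apply hJ.2.1 ha0 ?_
    rw [← hb, h0', h1']
    exact h2

variable [IsManifold 𝓘(ℂ) ω S]

/-- The differential in arbitrary charts. -/
theorem exists_dMap_eq (hφ : ContMDiff 𝓘(ℝ, ℂ) (𝓡 4) ∞ φ) (hz : z ∈ patch φ x₀ y₀) :
    ∃ c : ℂ, c ≠ 0 ∧ ∀ ζ, dMap φ x₀ y₀ z ζ = ofFiber y₀ (φ (pt x₀ z)) (dAt φ (pt x₀ z) (c * ζ)) := by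
  set x := pt x₀ z with hx
  have hov : z ∈ overlap x₀ x := ⟨hz.1, mem_chart_source ℂ x⟩
  have ht : transition x₀ x z = chartAt ℂ x x := rfl
  refine ⟨deriv (transition x₀ x) z, deriv_transition_ne_zero hov, fun ζ => ?_⟩
  rw [dAt_eq_dMap hφ]
  have hp := chartAt_mem_patch φ x
  -- the coordinate change of the target
  let G : E4 → E4 := fun q => chartAt E4 y₀ ((chartAt E4 (φ x)).symm q)
  have hG : HasFDerivAt G (ofFiber y₀ (φ x) : E4 →L[ℝ] E4) (localMap φ x (φ x) (chartAt ℂ x x)) := by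
    have h1 := hasFDerivWithinAt_tangentCoordChange (I := 𝓡 4) (x := φ x) (y := y₀) (z := φ x)
      (by simpa using hz.2)
    rw [modelWithCornersSelf_coe, Set.range_id, hasFDerivWithinAt_univ] at h1
    have h2 : localMap φ x (φ x) (chartAt ℂ x x) = chartAt E4 (φ x) (φ x) := by
      rw [localMap, pt_chartAt]
    rw [h2]
    exact h1
  have hl : HasFDerivAt (localMap φ x (φ x)) (fderiv ℝ (localMap φ x (φ x)) (chartAt ℂ x x))
      (chartAt ℂ x x) :=
    (((contDiffOn_localMap hφ x (φ x)).contDiffAt ((isOpen_patch hφ.continuous x (φ x)).mem_nhds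
      hp)).differentiableAt (by simp)).hasFDerivAt
  -- The coordinate change of the surface is holomorphic, so its derivative is multiplication by a
  -- complex number and commutes with i.
  have htr := ((differentiableAt_transition hov).hasDerivAt.hasFDerivAt).restrictScalars ℝ
  have hcomp := HasFDerivAt.comp z (g := localMap φ x (φ x)) (f := transition x₀ x)
    (by rw [ht]; exact hl) htr
  have hcomp2 := HasFDerivAt.comp (E := ℂ) (F := E4) (G := E4) z (g := G)
    (f := localMap φ x (φ x) ∘ transition x₀ x) (by exact hG) hcomp
  have hev : localMap φ x₀ y₀ =ᶠ[𝓝 z] G ∘ (localMap φ x (φ x) ∘ transition x₀ x) := by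
    have h1 : ∀ᶠ w in 𝓝 z, φ (pt x₀ w) ∈ (chartAt E4 (φ x)).source :=
      eventually_pt (P := fun x' => φ x' ∈ (chartAt E4 (φ x)).source) hz.1
        (hφ.continuous.continuousAt.eventually ((chartAt E4 (φ x)).open_source.mem_nhds
          (mem_chart_source E4 (φ x))))
    filter_upwards [(isOpen_overlap x₀ x).mem_nhds hov, h1] with w hw hw'
    simp only [Function.comp_apply, G, localMap]
    rw [pt_transition hw, (chartAt E4 (φ x)).left_inv hw']
  rw [dMap, hev.fderiv_eq, hcomp2.fderiv]
  have h3 : ∀ ζ : ℂ, deriv (transition x₀ x) z * ζ = ζ * deriv (transition x₀ x) z :=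
    fun ζ => mul_comm _ _
  rw [h3]
  rfl

theorem IsCompatibleAt.localSection_dMap (hφ : ContMDiff 𝓘(ℝ, ℂ) (𝓡 4) ∞ φ)
    (hz : z ∈ patch φ x₀ y₀) (h : IsCompatibleAt φ J (pt x₀ z)) (ζ : ℂ) :
    localSection φ J x₀ y₀ z (dMap φ x₀ y₀ z ζ) = dMap φ x₀ y₀ z (Complex.I * ζ) := by
  obtain ⟨c, -, hc⟩ := exists_dMap_eq hφ hz
  rw [hc, hc]
  refine (localSection_apply_ofFiber hz _).trans (congrArg (ofFiber y₀ (φ (pt x₀ z))) ?_)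
  refine (h (c * ζ)).trans (congrArg (dAt φ (pt x₀ z)) ?_)
  ring

theorem isCompatibleAt_of_localSection (hφ : ContMDiff 𝓘(ℝ, ℂ) (𝓡 4) ∞ φ)
    (hz : z ∈ patch φ x₀ y₀) (hJ : ∀ v, J (pt x₀ z) (J (pt x₀ z) v) = -v)
    (h : localSection φ J x₀ y₀ z (dMap φ x₀ y₀ z 1) = dMap φ x₀ y₀ z Complex.I) :
    IsCompatibleAt φ J (pt x₀ z) := by
  obtain ⟨c, hc0, hc⟩ := exists_dMap_eq hφ hz
  refine isCompatibleAt_of_apply hJ hc0 ?_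
  rw [hc, hc] at h
  have h1 := (localSection_apply_ofFiber hz _).symm.trans h
  have h2 := congrArg (toFiber y₀ (φ (pt x₀ z))) h1
  have h3 := (toFiber_ofFiber hz.2 _).symm.trans (h2.trans (toFiber_ofFiber hz.2 _))
  rw [mul_one, mul_comm c] at h3
  exact h3

theorem IsBranchedMinimalImmersion.eventually_conformalFactor_ne
    (h : IsBranchedMinimalImmersion g φ) (hz : z ∈ patch φ x₀ y₀) :
    ∀ᶠ w in 𝓝[≠] z, conformalFactor g φ x₀ y₀ w ≠ 0 := by
  by_cases h0 : conformalFactor g φ x₀ y₀ z = 0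
  · exact (h.branch x₀ y₀ _ hz h0).1
  · refine nhdsWithin_le_nhds (ContinuousAt.eventually_ne ?_ h0)
    have h1 : ContDiffAt ℝ ∞ (pullForm g φ x₀ y₀) _ := contDiffAt_pullForm h.smooth hz
    have h2 := ((contDiffOn_dMap h.smooth x₀ y₀ 1).contDiffAt
      ((isOpen_patch h.smooth.continuous x₀ y₀).mem_nhds hz))
    exact ((h1.clm_apply h2).clm_apply h2).continuousAt

/-- Branch points are isolated. -/
theorem eventually_not_isBranchPoint (h : IsBranchedMinimalImmersion g φ) (x : S) :
    ∀ᶠ x' in 𝓝[≠] x, ¬ IsBranchPoint φ x' := by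
  refine eventually_pt_punctured x ?_
  have hp := chartAt_mem_patch φ x
  filter_upwards [h.eventually_conformalFactor_ne hp, nhdsWithin_le_nhds ((isOpen_patch h.smooth.continuous x (φ x)).mem_nhds hp)]
    with w hw hwp hb
  obtain ⟨c, -, hc⟩ := exists_dMap_eq h.smooth hwp
  have h0 : dAt φ (pt x w) = 0 := hb
  refine hw ?_
  have h1 : dMap φ x (φ x) w 1 = 0 := by
    rw [hc, h0]
    exact map_zero _
  have h2 : conformalFactor g φ x (φ x) w =
    chartForm g (φ x) (localMap φ x (φ x) w) (dMap φ x (φ x) w 1) (dMap φ x (φ x) w 1) := rfl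
  rw [h2, h1, map_zero]

end Differential

/-! ### Factoring the differential of a weakly conformal harmonic map at a branch point. -/

section Factorization

/-- Complex vectors. -/
abbrev C4 := Fin 4 → ℂ

/-- The inclusion of the real vectors. -/
def toC4 : E4 →L[ℝ] C4 :=
  ContinuousLinearMap.pi fun k => Complex.ofRealCLM ∘L (EuclideanSpace.proj (𝕜 := ℝ) k)

theorem toC4_apply (v : E4) (k : Fin 4) : toC4 v k = v k := rfl

/-- The real part of a complex vector. -/
def reC4 : C4 →L[ℝ] E4 :=
  ((EuclideanSpace.equiv (Fin 4) ℝ).symm : (Fin 4 → ℝ) →L[ℝ] E4) ∘L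
    ContinuousLinearMap.pi fun k => Complex.reCLM ∘L (ContinuousLinearMap.proj k)

/-- The imaginary part of a complex vector. -/
def imC4 : C4 →L[ℝ] E4 :=
  ((EuclideanSpace.equiv (Fin 4) ℝ).symm : (Fin 4 → ℝ) →L[ℝ] E4) ∘L
    ContinuousLinearMap.pi fun k => Complex.imCLM ∘L (ContinuousLinearMap.proj k)

theorem reC4_apply (w : C4) (k : Fin 4) : reC4 w k = (w k).re := rfl

theorem imC4_apply (w : C4) (k : Fin 4) : imC4 w k = (w k).im := rfl

/-- The complex linear extension of a real endomorphism. -/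
def complexify (P : E4 →L[ℝ] E4) : C4 →L[ℂ] C4 :=
  ∑ k, ∑ j, ((P (bvec j) k : ℝ) : ℂ) •
    (ContinuousLinearMap.proj (R := ℂ) (φ := fun _ : Fin 4 => ℂ) j).smulRight
      (Pi.single k (1 : ℂ) : C4)

theorem complexify_toC4 (P : E4 →L[ℝ] E4) (v : E4) : complexify P (toC4 v) = toC4 (P v) := by
  have hv : v = ∑ j, v j • bvec j := by
    ext j; simp [Pi.single_apply]
  ext k
  rw [toC4_apply]
  conv_rhs => rw [hv, map_sum]
  simp [complexify, Finset.sum_apply, Pi.single_apply, toC4_apply, mul_comm]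

theorem contDiffAt_complexify {P : ℂ → E4 →L[ℝ] E4} {z : ℂ} {n : WithTop ℕ∞}
    (hP : ContDiffAt ℝ n P z) : ContDiffAt ℝ n (fun w => complexify (P w)) z := by
  unfold complexify
  refine ContDiffAt.sum fun k _ => ContDiffAt.sum fun j _ => ?_
  have h1 : ContDiffAt ℝ n (fun w => P w (bvec j) k) z :=
    (EuclideanSpace.proj (𝕜 := ℝ) k : E4 →L[ℝ] ℝ).contDiff.contDiffAt.comp z
      (hP.clm_apply contDiffAt_const)
  exact (((ContinuousLinearMap.toSpanSingleton ℂ ((ContinuousLinearMap.proj (R := ℂ)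
    (φ := fun _ : Fin 4 => ℂ) j).smulRight (Pi.single k (1 : ℂ) : C4))).restrictScalars
    ℝ).contDiff.contDiffAt.comp z (Complex.ofRealCLM.contDiff.contDiffAt.comp z h1))

/-- The local form of the differential of a harmonic map at a branch point. -/
theorem exists_factorization {d₁ d₂ : ℂ → E4} {P₁ P₂ : ℂ → E4 →L[ℝ] E4} {p : ℂ}
    (hP₁ : ContDiffAt ℝ 1 P₁ p) (hP₂ : ContDiffAt ℝ 1 P₂ p)
    (hd : ∀ᶠ z in 𝓝 p, DifferentiableAt ℝ d₁ z ∧ DifferentiableAt ℝ d₂ z ∧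
      fderiv ℝ d₁ z Complex.I = fderiv ℝ d₂ z 1 ∧ P₁ z (d₂ z) = P₂ z (d₁ z) ∧
      fderiv ℝ d₁ z 1 + P₁ z (d₁ z) + fderiv ℝ d₂ z Complex.I + P₂ z (d₂ z) = 0)
    (h0 : ∀ᶠ z in 𝓝[≠] p, d₁ z ≠ 0) :
    ∃ (c : ℂ → ℂ) (a b : ℂ → E4), (∀ᶠ z in 𝓝[≠] p, c z ≠ 0) ∧ ContDiffAt ℝ 1 a p ∧ ContDiffAt ℝ 1 b p ∧
      (a p ≠ 0 ∨ b p ≠ 0) ∧ ∀ᶠ z in 𝓝 p, d₁ z = (c z).re • a z + (c z).im • b z ∧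
        d₂ z = (c z).re • b z - (c z).im • a z := by
  -- Up to a constant factor this is ∂φ/∂z. The imaginary part of ∂̄f vanishes by the symmetry of
  -- second derivatives, that of Mf by the absence of torsion. The real parts add up to the tension
  -- field.
  set f : ℂ → C4 := fun z => toC4 (d₁ z) - Complex.I • toC4 (d₂ z) with hf
  set M : ℂ → C4 →L[ℂ] C4 := fun z => complexify (P₁ z) + Complex.I • complexify (P₂ z) with hM
  have hMc : ContDiffAt ℝ 1 M p := by
    refine (contDiffAt_complexify hP₁).add ?_
    exact (((Complex.I • ContinuousLinearMap.id ℂ (C4 →L[ℂ] C4)).restrictScalars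
      ℝ).contDiff.contDiffAt.comp p (contDiffAt_complexify hP₂))
  have hfd : ∀ᶠ z in 𝓝 p, DifferentiableAt ℝ f z ∧ dbar f z = -M z (f z) := by
    filter_upwards [hd] with z hz
    obtain ⟨h1, h2, h3, h4, h5⟩ := hz
    have hL : HasFDerivAt f (toC4 ∘L fderiv ℝ d₁ z -
        ((Complex.I • ContinuousLinearMap.id ℂ C4).restrictScalars ℝ ∘L toC4) ∘L fderiv ℝ d₂ z) z :=
      (toC4.hasFDerivAt.comp z h1.hasFDerivAt).sub
        ((((Complex.I • ContinuousLinearMap.id ℂ C4).restrictScalars ℝ ∘L toC4).hasFDerivAt).comp z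
          h2.hasFDerivAt)
    refine ⟨hL.differentiableAt, ?_⟩
    rw [dbar, hL.fderiv]
    have hfd : ∀ ζ : ℂ, (toC4 ∘L fderiv ℝ d₁ z -
        ((Complex.I • ContinuousLinearMap.id ℂ C4).restrictScalars ℝ ∘L toC4) ∘L fderiv ℝ d₂ z) ζ =
        toC4 (fderiv ℝ d₁ z ζ) - Complex.I • toC4 (fderiv ℝ d₂ z ζ) := fun ζ => rfl
    have hMf : M z (f z) = toC4 (P₁ z (d₁ z)) + toC4 (P₂ z (d₂ z)) := by
      have : M z (f z) = complexify (P₁ z) (f z) + Complex.I • complexify (P₂ z) (f z) := rfl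
      rw [this, hf]
      simp only [map_sub, map_smul, complexify_toC4, h4]
      ext k
      simp only [Pi.add_apply, Pi.sub_apply, Pi.smul_apply, smul_eq_mul]
      linear_combination -toC4 (P₂ z (d₂ z)) k * Complex.I_sq
    rw [hfd, hfd, hMf, ← map_add, h3]
    have h6 : P₁ z (d₁ z) + P₂ z (d₂ z) = -(fderiv ℝ d₁ z 1 + fderiv ℝ d₂ z Complex.I) := by
      rw [eq_neg_iff_add_eq_zero, ← h5]; abel
    rw [h6, map_neg, map_add, neg_neg]
    ext k
    simp only [Pi.add_apply, Pi.sub_apply, Pi.smul_apply, smul_eq_mul]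
    linear_combination -toC4 (fderiv ℝ d₂ z Complex.I) k * Complex.I_sq
  have hre : ∀ z, reC4 (f z) = d₁ z := fun z => by
    ext k; simp [hf, reC4_apply, toC4_apply]
  have him : ∀ z, imC4 (f z) = -d₂ z := fun z => by
    ext k; simp [hf, imC4_apply, toC4_apply]
  have hf0 : ∀ᶠ z in 𝓝[≠] p, f z ≠ 0 := by
    filter_upwards [h0] with z hz h
    exact hz (by rw [← hre, h, map_zero])
  obtain ⟨n, ψ, hψ, hψp, hfψ⟩ := exists_pow_smul_of_dbar hMc hfd hf0
  -- With ψ = a - ib, the real and imaginary parts of d₁ - i d₂ = c(a - ib) are the two asserted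
  -- identities.
  refine ⟨fun z => (z - p) ^ n, fun z => reC4 (ψ z), fun z => -imC4 (ψ z), ?_,
    reC4.contDiff.contDiffAt.comp p hψ, (imC4.contDiff.contDiffAt.comp p hψ).neg, ?_, ?_⟩
  · filter_upwards [self_mem_nhdsWithin] with z hz
    exact pow_ne_zero n (sub_ne_zero.2 hz)
  · by_contra! h
    refine hψp (funext fun k => Complex.ext ?_ ?_)
    · rw [← reC4_apply, h.1]; rfl
    · rw [← imC4_apply, neg_eq_zero.1 h.2]; rfl
  · filter_upwards [hfψ] with z hz
    constructor
    · rw [← hre, hz]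
      ext k
      simp [reC4_apply, imC4_apply, Complex.mul_re, sub_eq_add_neg]
    · rw [← neg_neg (d₂ z), ← him, hz]
      ext k
      simp [reC4_apply, imC4_apply, Complex.mul_im]
      ring

/-- Conformality is the vanishing of the complex bilinear square of d₁ - i d₂ = c(x - iy), which is
c² times that of x - iy. -/
theorem conformal_of_factorization {b : Bilin} (hb : ∀ v w, b v w = b w v) {x y d₁ d₂ : E4} {c : ℂ}
    (hc : c ≠ 0) (h₁ : d₁ = c.re • x + c.im • y) (h₂ : d₂ = c.re • y - c.im • x)
    (hn : b d₂ d₂ = b d₁ d₁) (ho : b d₁ d₂ = 0) : b x x = b y y ∧ b x y = 0 := by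
  have hc' : 0 < c.re * c.re + c.im * c.im := by
    have := Complex.normSq_pos.2 hc
    rwa [Complex.normSq_apply] at this
  have hyx := hb y x
  rw [h₁, h₂] at hn ho
  simp only [map_add, map_sub, map_smul, add_apply, sub_apply, smul_apply,
    smul_eq_mul, hyx] at hn ho
  have hQ : (c.re * c.re + c.im * c.im) ^ 2 * (b x x - b y y) = 0 := by
    linear_combination -(c.re ^ 2 - c.im ^ 2) * hn - 4 * (c.re * c.im) * ho
  have hR : (c.re * c.re + c.im * c.im) ^ 2 * b x y = 0 := by
    linear_combination -(c.re * c.im) * hn + (c.re ^ 2 - c.im ^ 2) * ho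
  have hne : (c.re * c.re + c.im * c.im) ^ 2 ≠ 0 := (pow_pos hc' 2).ne'
  exact ⟨sub_eq_zero.1 ((mul_eq_zero.1 hQ).resolve_left hne), (mul_eq_zero.1 hR).resolve_left hne⟩

/-- The coefficients of the oriented complex structure that maps `x` to `y`. -/
def rotCoeff (b : Bilin) (e : Fin 4 → E4) (x y : E4) : Fin 3 → ℝ :=
  (b x x)⁻¹ • -sdWedge (coframe b e x) (coframe b e y)

/-- The normalised form of `sdMatrix_mulVec_of_orthogonal`, read in an orthonormal frame. Smoothness
in x and y is visible from the formula. -/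
theorem sdEnd_rotCoeff {b : Bilin} {e : Fin 4 → E4} (h : IsON b e) {x y : E4} (hx : b x x ≠ 0)
    (hn : b x x = b y y) (ho : b x y = 0) :
    dot3 (rotCoeff b e x y) (rotCoeff b e x y) = 1 ∧ sdEnd b e (rotCoeff b e x y) x = y ∧
      sdEnd b e (rotCoeff b e x y) y = -x := by
  have hxx := h.apply_eq_sum x x
  have hyy := h.apply_eq_sum y y
  have hxy := h.apply_eq_sum x y
  rw [Fin.sum_univ_four] at hxx hyy hxy
  obtain ⟨h1, h2, h3⟩ := sdMatrix_mulVec_of_orthogonal (x := coframe b e x) (y := coframe b e y)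
    (by rw [← hxx, ← hyy, hn]) (by rw [← hxy, ho])
  rw [← hxx] at h1 h2 h3
  have key : ∀ v, sdEnd b e (rotCoeff b e x y) v = (b x x)⁻¹ • frameMap e
      (matEnd (sdMatrix (-sdWedge (coframe b e x) (coframe b e y))) (coframe b e v)) := by
    intro v
    rw [rotCoeff, sdEnd_smul]
    rfl
  refine ⟨?_, ?_, ?_⟩
  · have : dot3 (rotCoeff b e x y) (rotCoeff b e x y) = ((b x x)⁻¹) ^ 2 *
        dot3 (sdWedge (coframe b e x) (coframe b e y)) (sdWedge (coframe b e x) (coframe b e y)) := by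
      simp [dot3, rotCoeff]; ring
    rw [this, h3]
    field_simp
  · have h4 : matEnd (sdMatrix (-sdWedge (coframe b e x) (coframe b e y))) (coframe b e x) =
        b x x • coframe b e y := by
      ext i
      rw [matEnd_apply, h1]; rfl
    rw [key, h4, map_smul, frameMap_coframe h, inv_smul_smul₀ hx]
  · have h4 : matEnd (sdMatrix (-sdWedge (coframe b e x) (coframe b e y))) (coframe b e y) =
        b x x • -coframe b e x := by
      ext i
      rw [matEnd_apply, h2]; simp
    rw [key, h4, map_smul, map_neg, frameMap_coframe h, inv_smul_smul₀ hx]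

theorem contDiffAt_rotCoeff {b : ℂ → Bilin} {e : ℂ → Fin 4 → E4} {x y : ℂ → E4} {z : ℂ}
    {n : WithTop ℕ∞} (hb : ContDiffAt ℝ n b z) (he : ∀ i, ContDiffAt ℝ n (fun w => e w i) z)
    (hx : ContDiffAt ℝ n x z) (hy : ContDiffAt ℝ n y z) (h0 : b z (x z) (x z) ≠ 0) :
    ContDiffAt ℝ n (fun w => rotCoeff (b w) (e w) (x w) (y w)) z := by
  have hc : ∀ {v : ℂ → E4}, ContDiffAt ℝ n v z → ∀ i,
      ContDiffAt ℝ n (fun w => coframe (b w) (e w) (v w) i) z := by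
    intro v hv i
    simp only [coframe_apply]
    exact (hb.clm_apply (he i)).clm_apply hv
  refine ((((hb.clm_apply hx).clm_apply hx).inv h0).smul (ContDiffAt.neg ?_))
  refine contDiffAt_pi.2 fun i => ?_
  fin_cases i
  · exact ((((hc hx 0).mul (hc hy 1)).sub ((hc hx 1).mul (hc hy 0))).add
      ((hc hx 2).mul (hc hy 3))).sub ((hc hx 3).mul (hc hy 2))
  · exact ((((hc hx 0).mul (hc hy 2)).sub ((hc hx 2).mul (hc hy 0))).sub
      ((hc hx 1).mul (hc hy 3))).add ((hc hx 3).mul (hc hy 1))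
  · exact ((((hc hx 0).mul (hc hy 3)).sub ((hc hx 3).mul (hc hy 0))).add
      ((hc hx 1).mul (hc hy 2))).sub ((hc hx 2).mul (hc hy 1))

end Factorization

/-! ### A C¹ compatible structure near every point, branch points included. -/

section LocalLift

variable {S : Type*} [TopologicalSpace S] [ChartedSpace ℂ S] [IsManifold 𝓘(ℂ) ω S]
  {N : Type*} [TopologicalSpace N] [ChartedSpace E4 N] [IsManifold (𝓡 4) ∞ N]
  {φ : S → N} {x₀ : S} {y₀ : N} {z : ℂ} {g : Metric N}
  {e : ∀ x : S, Fin 4 → TangentSpace (𝓡 4) (φ x)} {U : Set S}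

theorem fderiv_dMap_comm (hφ : ContMDiff 𝓘(ℝ, ℂ) (𝓡 4) ∞ φ) (hz : z ∈ patch φ x₀ y₀) :
    fderiv ℝ (fun w => dMap φ x₀ y₀ w 1) z Complex.I =
      fderiv ℝ (fun w => dMap φ x₀ y₀ w Complex.I) z 1 := by
  have hp := (isOpen_patch hφ.continuous x₀ y₀).mem_nhds hz
  have h1 : ContDiffAt ℝ ∞ (localMap φ x₀ y₀) z := (contDiffOn_localMap hφ x₀ y₀).contDiffAt hp
  have h2 : DifferentiableAt ℝ (fun w => fderiv ℝ (localMap φ x₀ y₀) w) z :=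
    ((contDiffOn_fderiv_localMap hφ x₀ y₀).contDiffAt hp).differentiableAt (by simp)
  have h3 : ∀ ζ η : ℂ, fderiv ℝ (fun w => dMap φ x₀ y₀ w ζ) z η =
      fderiv ℝ (fun w => fderiv ℝ (localMap φ x₀ y₀) w) z η ζ := by
    intro ζ η
    have := (h2.hasFDerivAt.clm_apply (hasFDerivAt_const ζ z)).fderiv
    unfold dMap
    rw [this]
    simp
  rw [h3, h3]
  exact (h1.isSymmSndFDerivAt (by
    simp only [minSmoothness_of_isRCLikeNormedField]
    exact WithTop.coe_le_coe.2 (le_top : (2 : ℕ∞) ≤ ⊤))).eq _ _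

/-- Near every point there is a `C¹` complex structure compatible with the differential. -/
theorem exists_local_lift (h : IsBranchedMinimalImmersion g φ) (hU : IsOpen U)
    (he : IsLocalFrame g φ U e) (hz : z ∈ patch φ x₀ y₀ ∩ pt x₀ ⁻¹' U) :
    ∃ u : ℂ → Fin 3 → ℝ, ContDiffAt ℝ 1 u z ∧ ∀ᶠ w in 𝓝 z, dot3 (u w) (u w) = 1 ∧
      sdEnd (pullForm g φ x₀ y₀ w) (chartFrame φ e x₀ y₀ w) (u w) (dMap φ x₀ y₀ w 1) =
        dMap φ x₀ y₀ w Complex.I := by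
  have hφ := h.smooth
  have hp := (isOpen_patch hφ.continuous x₀ y₀).mem_nhds hz.1
  have hP : ∀ ζ, ContDiffAt ℝ 1 (fun w => pullConn g φ x₀ y₀ w ζ) z := fun ζ =>
    ((contDiffOn_pullConn g hφ x₀ y₀ ζ).contDiffAt hp).of_le (by simp)
  have hd : ∀ w ∈ patch φ x₀ y₀, ∀ ζ, DifferentiableAt ℝ (fun w => dMap φ x₀ y₀ w ζ) w :=
    fun w hw ζ => ((contDiffOn_dMap hφ x₀ y₀ ζ).contDiffAt
      ((isOpen_patch hφ.continuous x₀ y₀).mem_nhds hw)).differentiableAt (by simp)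
  obtain ⟨c, a, b, hc, ha, hb, hab, hfac⟩ := exists_factorization (d₁ := fun w => dMap φ x₀ y₀ w 1)
    (d₂ := fun w => dMap φ x₀ y₀ w Complex.I) (hP 1) (hP Complex.I) (by
      filter_upwards [hp] with w hw
      refine ⟨hd w hw 1, hd w hw Complex.I, fderiv_dMap_comm hφ hw, ?_, h.harmonic x₀ y₀ w hw⟩
      exact connForm_comm g y₀ _ _ _) (by
      filter_upwards [h.eventually_conformalFactor_ne hz.1] with w hw h0
      refine hw ?_
      have : conformalFactor g φ x₀ y₀ w =
        pullForm g φ x₀ y₀ w (dMap φ x₀ y₀ w 1) (dMap φ x₀ y₀ w 1) := rfl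
      rw [this, h0, map_zero])
  set B := pullForm g φ x₀ y₀ with hB
  have hBc : ContDiffAt ℝ 1 B z := (contDiffAt_pullForm hφ hz.1).of_le (by simp)
  have hE : ∀ i, ContDiffAt ℝ 1 (fun w => chartFrame φ e x₀ y₀ w i) z := fun i =>
    (contDiffAt_chartFrame hφ.continuous hU he hz i).of_le (by simp)
  have hon : ∀ᶠ w in 𝓝 z, IsON (B w) (chartFrame φ e x₀ y₀ w) := by
    filter_upwards [eventually_mem_patch hφ.continuous hU hz] with w hw
    exact isON_chartFrame g hw.1 ((isOrientedOrthonormal_iff g _ _).1 (he.orthonormal _ hw.2)).1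
  have hconf : ∀ᶠ w in 𝓝[≠] z, B w (a w) (a w) = B w (b w) (b w) ∧ B w (a w) (b w) = 0 := by
    filter_upwards [hc, nhdsWithin_le_nhds hfac, nhdsWithin_le_nhds hp] with w hcw hw hwp
    exact conformal_of_factorization (pullForm_symm w) hcw hw.1 hw.2 (h.conformal x₀ y₀ w hwp).1
      (h.conformal x₀ y₀ w hwp).2
  -- At z itself the factor c may vanish, so conformality of a, b is obtained as a limit.
  have hlim : B z (a z) (a z) = B z (b z) (b z) ∧ B z (a z) (b z) = 0 := by
    have haa := ((hBc.clm_apply ha).clm_apply ha).continuousAt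
    have hbb := ((hBc.clm_apply hb).clm_apply hb).continuousAt
    have hab := ((hBc.clm_apply ha).clm_apply hb).continuousAt
    constructor
    · refine tendsto_nhds_unique (haa.tendsto.mono_left nhdsWithin_le_nhds) (Filter.Tendsto.congr' ?_
        (hbb.tendsto.mono_left nhdsWithin_le_nhds) : Filter.Tendsto _ (𝓝[≠] z) _)
      filter_upwards [hconf] with w hw using hw.1.symm
    · refine tendsto_nhds_unique (hab.tendsto.mono_left nhdsWithin_le_nhds) (Filter.Tendsto.congr' ?_
        tendsto_const_nhds : Filter.Tendsto _ (𝓝[≠] z) _)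
      filter_upwards [hconf] with w hw using hw.2.symm
  have hconf' : ∀ᶠ w in 𝓝 z, B w (a w) (a w) = B w (b w) (b w) ∧ B w (a w) (b w) = 0 := by
    rw [eventually_nhdsWithin_iff] at hconf
    filter_upwards [hconf] with w hw
    by_cases hwz : w = z
    · rw [hwz]; exact hlim
    · exact hw hwz
  have hpos : ∀ v, v ≠ 0 → 0 < B z v v := fun v hv =>
    chartForm_pos g (localMap_mem_target hz.1) hv
  -- One of a, b is nonzero at z and their lengths agree, so the division in `rotCoeff` is
  -- legitimate.
  have haz : B z (a z) (a z) ≠ 0 := by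
    rcases hab with h1 | h1
    · exact (hpos _ h1).ne'
    · rw [hlim.1]
      exact (hpos _ h1).ne'
  refine ⟨fun w => rotCoeff (B w) (chartFrame φ e x₀ y₀ w) (a w) (b w),
    contDiffAt_rotCoeff hBc hE ha hb haz, ?_⟩
  filter_upwards [hconf', hon, hfac,
    ((hBc.clm_apply ha).clm_apply ha).continuousAt.eventually_ne haz] with w h1 h2 h3 h4
  obtain ⟨k1, k2, k3⟩ := sdEnd_rotCoeff h2 h4 h1.1 h1.2
  refine ⟨k1, ?_⟩
  rw [h3.1, h3.2, map_add, map_smul, map_smul, k2, k3, smul_neg, sub_eq_add_neg]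

end LocalLift

theorem sdEnd_eq_of_apply_eq {b : Bilin} {e : Fin 4 → E4} (h : IsON b e) {u u' : Fin 3 → ℝ} {v : E4}
    (hv : v ≠ 0) (huv : sdEnd b e u v = sdEnd b e u' v) : u = u' := by
  refine sub_eq_zero.1 (eq_zero_of_sdEnd_apply_eq_zero h hv ?_)
  rw [sdEnd_sub]
  exact sub_eq_zero.2 huv

/-! ### Global existence, uniqueness and holomorphy of the lift. -/

section Lift

variable {S : Type*} [TopologicalSpace S] [ChartedSpace ℂ S]
  {N : Type*} [TopologicalSpace N] [ChartedSpace E4 N]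
  {φ : S → N} {x₀ : S} {y₀ : N} {z : ℂ} {J J' : EndSection φ}

theorem IsCompatibleAt.congr {x : S} (h : IsCompatibleAt φ J x) (hJ : J x = J' x) :
    IsCompatibleAt φ J' x := fun ζ => by
  refine Eq.trans ?_ (h ζ)
  exact congrArg (fun K : EndT (φ x) => K (dAt φ x ζ)) hJ.symm

variable [IsManifold (𝓡 4) ∞ N] {g : Metric N}
  {e : ∀ x : S, Fin 4 → TangentSpace (𝓡 4) (φ x)} {U : Set S}

/-- Both are self-dual in a common frame, and a self-dual endomorphism with a kernel is zero. -/
theorem eq_of_apply_eq {y : N} {K K' : EndT y} (hK : K ∈ twistorFiber g y)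
    (hK' : K' ∈ twistorFiber g y) {v : E4} (hv : v ≠ 0) (h : (K v : E4) = K' v) : K = K' := by
  obtain ⟨f, hf⟩ := exists_isOrientedOrthonormal g y
  obtain ⟨u, -, rfl⟩ := exists_fiberSd g hf hK
  obtain ⟨u', -, rfl⟩ := exists_fiberSd g hf hK'
  rw [sdEnd_eq_of_apply_eq (e := f) ((isOrientedOrthonormal_iff g y f).1 hf).1 hv h]

theorem apply_eq_of_localSection_eq (hz : z ∈ patch φ x₀ y₀)
    (h : localSection φ J x₀ y₀ z = localSection φ J' x₀ y₀ z) : J (pt x₀ z) = J' (pt x₀ z) := by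
  refine ContinuousLinearMap.ext fun v => ?_
  have h1 := DFunLike.congr_fun h (ofFiber y₀ (φ (pt x₀ z)) v)
  rw [localSection_apply_ofFiber hz, localSection_apply_ofFiber hz] at h1
  exact (toFiber_ofFiber hz.2 _).symm.trans
    ((congrArg (toFiber y₀ (φ (pt x₀ z))) h1).trans (toFiber_ofFiber hz.2 _))

/-- Continuous sections which agree off a point agree at the point. -/
theorem eq_of_eventually_eq (x : S)
    (hJ : ContinuousAt (localSection φ J x (φ x)) (chartAt ℂ x x))
    (hJ' : ContinuousAt (localSection φ J' x (φ x)) (chartAt ℂ x x))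
    (h : ∀ᶠ x' in 𝓝[≠] x, J x' = J' x') : J x = J' x := by
  have hz := chartAt_mem_patch φ x
  have h1 : ∀ᶠ w in 𝓝[≠] (chartAt ℂ x x), J (pt x w) = J' (pt x w) := by
    have := tendsto_pt_punctured hz.1
    rw [pt_chartAt] at this
    exact this.eventually h
  have h2 : localSection φ J x (φ x) (chartAt ℂ x x) = localSection φ J' x (φ x) (chartAt ℂ x x) := by
    refine tendsto_nhds_unique (hJ.tendsto.mono_left nhdsWithin_le_nhds) (Filter.Tendsto.congr' ?_
      (hJ'.tendsto.mono_left nhdsWithin_le_nhds) : Filter.Tendsto _ (𝓝[≠] (chartAt ℂ x x)) _)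
    filter_upwards [h1] with w hw
    unfold localSection
    rw [hw]
  have h3 := apply_eq_of_localSection_eq hz h2
  have h4 : ∀ x', x' = x → J x' = J' x' → J x = J' x := by
    rintro _ rfl h
    exact h
  exact h4 _ (pt_chartAt x) h3

/-- A `C¹` section of complex structures near a point which is compatible with the differential. -/
def IsLiftAt (g : Metric N) (φ : S → N) (J : EndSection φ) (p : S) : Prop :=
  ∃ (U : Set S) (e : ∀ x : S, Fin 4 → TangentSpace (𝓡 4) (φ x)) (u : S → Fin 3 → ℝ),
    IsOpen U ∧ p ∈ U ∧ IsLocalFrame g φ U e ∧ IsC1At u p ∧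
    ∀ᶠ x in 𝓝 p, J x = fiberSd g (φ x) (e x) (u x) ∧ dot3 (u x) (u x) = 1 ∧ IsCompatibleAt φ J x

theorem IsLiftAt.congr {p : S} (h : IsLiftAt g φ J p) (hJ : ∀ᶠ x in 𝓝 p, J x = J' x) :
    IsLiftAt g φ J' p := by
  obtain ⟨U, e, u, hU, hp, he, hu, hev⟩ := h
  refine ⟨U, e, u, hU, hp, he, hu, ?_⟩
  filter_upwards [hev, hJ] with x hx hJx
  exact ⟨hJx.symm.trans hx.1, hx.2.1, hx.2.2.congr hJx⟩

theorem IsLiftAt.eventually {p : S} (h : IsLiftAt g φ J p) :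
    ∀ᶠ x in 𝓝 p, J x ∈ twistorFiber g (φ x) ∧ IsCompatibleAt φ J x := by
  obtain ⟨U, e, u, hU, hp, he, hu, hev⟩ := h
  filter_upwards [hev, hU.mem_nhds hp] with x hx hxU
  refine ⟨?_, hx.2.2⟩
  rw [hx.1]
  exact fiberSd_mem_twistorFiber g (he.orthonormal x hxU) hx.2.1

theorem eq_of_isCompatibleAt (h : IsBranchedMinimalImmersion g φ) {x : S}
    (hJ : J x ∈ twistorFiber g (φ x)) (hJ' : J' x ∈ twistorFiber g (φ x))
    (hx : ¬ IsBranchPoint φ x) (hc : IsCompatibleAt φ J x) (hc' : IsCompatibleAt φ J' x) :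
    J x = J' x :=
  eq_of_apply_eq hJ hJ' (dAt_ne_zero hx h) ((hc 1).trans (hc' 1).symm)

variable [IsManifold 𝓘(ℂ) ω S]

theorem IsLiftAt.contDiffAt (hφ : ContMDiff 𝓘(ℝ, ℂ) (𝓡 4) ∞ φ) (hz : z ∈ patch φ x₀ y₀)
    (h : IsLiftAt g φ J (pt x₀ z)) : ContDiffAt ℝ 1 (localSection φ J x₀ y₀) z := by
  obtain ⟨U, e, u, hU, hp, he, hu, hev⟩ := h
  exact contDiffAt_localSection hφ hU he ⟨hz, hp⟩ hu (hev.mono fun x hx => hx.1)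

theorem IsLiftAt.continuousAt (hφ : ContMDiff 𝓘(ℝ, ℂ) (𝓡 4) ∞ φ) {x : S}
    (h : IsLiftAt g φ J x) : ContinuousAt (localSection φ J x (φ x)) (chartAt ℂ x x) :=
  (IsLiftAt.contDiffAt hφ (chartAt_mem_patch φ x) (by rwa [pt_chartAt])).continuousAt

/-- Near every point there is a lift. -/
theorem exists_isLiftAt (hN : IsOrientedAtlas N) (h : IsBranchedMinimalImmersion g φ) (p : S) :
    ∃ J : EndSection φ, ∀ᶠ x in 𝓝 p, IsLiftAt g φ J x := by
  obtain ⟨f, hf⟩ := exists_isOrientedOrthonormal g (φ p)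
  obtain ⟨U, e, hU, hp, he, -⟩ := exists_isLocalFrame hN g h.smooth p hf
  have hz := chartAt_mem_patch φ p
  have hzU : chartAt ℂ p p ∈ patch φ p (φ p) ∩ pt p ⁻¹' U := ⟨hz, by
    rw [Set.mem_preimage, pt_chartAt]; exact hp⟩
  obtain ⟨u, hu, hev⟩ := exists_local_lift h hU he hzU
  have hr : ∀ w ∈ (chartAt ℂ p).target, chartAt ℂ p (pt p w) = w := fun w hw =>
    (chartAt ℂ p).right_inv hw
  set v : S → Fin 3 → ℝ := fun x => u (chartAt ℂ p x) with hv
  let J : EndSection φ := fun x => fiberSd g (φ x) (e x) (v x)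
  have h1 : ∀ᶠ x in 𝓝 p, IsC1At v x ∧ dot3 (v x) (v x) = 1 ∧ IsCompatibleAt φ J x ∧ x ∈ U := by
    refine eventually_of_pt p ?_
    filter_upwards [hu.eventually (by simp), hev, eventually_mem_patch h.smooth.continuous hU hzU]
      with w hw1 hw2 hw3
    have hvw : v (pt p w) = u w := congrArg u (hr w hw3.1.1)
    have hdot : dot3 (v (pt p w)) (v (pt p w)) = 1 := by rw [hvw]; exact hw2.1
    refine ⟨isC1At_of_contDiffAt hw3.1.1 (hw1.congr_of_eventuallyEq ?_), hdot, ?_, hw3.2⟩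
    · filter_upwards [(chartAt ℂ p).open_target.mem_nhds hw3.1.1] with w' hw'
      exact congrArg u (hr w' hw')
    · refine isCompatibleAt_of_localSection h.smooth hw3.1
        (fiberSd_mem_twistorFiber g (he.orthonormal _ hw3.2) hdot).2.1 ?_
      rw [localSection_fiberSd g hw3.1 (J := J) rfl, hvw]
      exact hw2.2
  refine ⟨J, ?_⟩
  filter_upwards [h1.eventually_nhds] with x hx
  obtain ⟨k1, -, -, k4⟩ := hx.self_of_nhds
  exact ⟨U, e, v, hU, k4, he, k1, hx.mono fun x' hx' => ⟨rfl, hx'.2.1, hx'.2.2.1⟩⟩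

/-- Compatibility determines the structure off the branch points. These are isolated, so continuity
settles the point itself. -/
theorem IsLiftAt.eq (h : IsBranchedMinimalImmersion g φ) {x : S} (hJ : IsLiftAt g φ J x)
    (hJ' : IsLiftAt g φ J' x) : J x = J' x := by
  refine eq_of_eventually_eq x (hJ.continuousAt h.smooth) (hJ'.continuousAt h.smooth) ?_
  filter_upwards [nhdsWithin_le_nhds hJ.eventually, nhdsWithin_le_nhds hJ'.eventually,
    eventually_not_isBranchPoint h x] with x' h1 h2 h3
  exact eq_of_isCompatibleAt h h1.1 h2.1 h3 h1.2 h2.2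

/-- The section takes at x the value of a local lift chosen for x. By local uniqueness it coincides
near p with the single lift chosen for p, so it inherits its regularity. -/
theorem exists_isLift (hN : IsOrientedAtlas N) (h : IsBranchedMinimalImmersion g φ) :
    ∃ J : EndSection φ, ∀ x, IsLiftAt g φ J x := by
  choose K hK using fun p => exists_isLiftAt hN h p
  refine ⟨fun x => K x x, fun p => ?_⟩
  refine (hK p).self_of_nhds.congr ?_
  filter_upwards [hK p] with x hx
  exact hx.eq h (hK x).self_of_nhds

theorem isTwistorLift_of_isLiftAt (h : IsBranchedMinimalImmersion g φ)
    (hJ : ∀ x, IsLiftAt g φ J x) : IsTwistorLift g φ J where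
  mem x := (hJ x).eventually.self_of_nhds.1
  continuousOn _ _ _ hz := ((hJ _).contDiffAt h.smooth hz).continuousAt.continuousWithinAt
  adapted x hx := (isCompatibleAt_iff h (hJ x).eventually.self_of_nhds.1 hx).1
    (hJ x).eventually.self_of_nhds.2

theorem IsTwistorLift.eq_of_isLiftAt (h : IsBranchedMinimalImmersion g φ)
    (hJ : IsTwistorLift g φ J) (hJ' : ∀ x, IsLiftAt g φ J' x) : J = J' := by
  funext x
  refine eq_of_eventually_eq x ((hJ.continuousOn x (φ x)).continuousAt
    ((isOpen_patch h.smooth.continuous x (φ x)).mem_nhds (chartAt_mem_patch φ x)))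
    ((hJ' x).continuousAt h.smooth) ?_
  filter_upwards [eventually_not_isBranchPoint h x] with x' hx'
  have h1 := (hJ' x').eventually.self_of_nhds
  exact eq_of_isCompatibleAt h (hJ.mem x') h1.1 hx'
    ((isCompatibleAt_iff h (hJ.mem x') hx').2 (hJ.adapted x' hx')) h1.2

theorem IsTwistorLift.isLiftAt (hN : IsOrientedAtlas N) (h : IsBranchedMinimalImmersion g φ)
    (hJ : IsTwistorLift g φ J) (x : S) : IsLiftAt g φ J x := by
  obtain ⟨J', hJ'⟩ := exists_isLift hN h
  rw [hJ.eq_of_isLiftAt h hJ']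
  exact hJ' x

theorem existsUnique_isTwistorLift (hN : IsOrientedAtlas N) (h : IsBranchedMinimalImmersion g φ) :
    ∃! J : EndSection φ, IsTwistorLift g φ J := by
  obtain ⟨J, hJ⟩ := exists_isLift hN h
  exact ⟨J, isTwistorLift_of_isLiftAt h hJ, fun J' hJ' => hJ'.eq_of_isLiftAt h hJ⟩

/-- The derivative of `K d₁ = d₂`, `K d₂ = -d₁` for the differential `(d₁, d₂)` of a harmonic map. -/
theorem commutator_apply_eq_zero {K P Q A B : E4 →L[ℝ] E4} {d₁ d₂ a b c : E4}
    (h₁ : K d₁ = d₂) (h₂ : K d₂ = -d₁)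
    (hB₁ : B d₁ + K b = c) (hA₂ : A d₂ + K b = -a) (h : a + P d₁ + (c + Q d₂) = 0)
    (hPQ : P d₂ = Q d₁) :
    ((B + (Q * K - K * Q)) - (A + (P * K - K * P)) * K) d₁ = 0 := by
  have h3 : ∀ v, ((B + (Q * K - K * Q)) - (A + (P * K - K * P)) * K) v =
      B v + (Q (K v) - K (Q v)) - (A (K v) + (P (K (K v)) - K (P (K v)))) := fun v => rfl
  rw [h3, h₁, h₂, hPQ, map_neg, eq_sub_of_add_eq hB₁, eq_sub_of_add_eq hA₂, ← h]
  abel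

/-- Apply ∇₂ to J∂₁φ = ∂₂φ and ∇₁ to J∂₂φ = -∂₁φ. The difference is the tension field minus J(∇₂∂₁φ
- ∇₁∂₂φ), and both terms vanish. -/
theorem covDeriv_apply_dMap (h : IsBranchedMinimalImmersion g φ) (hz : z ∈ patch φ x₀ y₀)
    (hd : DifferentiableAt ℝ (localSection φ J x₀ y₀) z)
    (hJ : ∀ᶠ w in 𝓝 z, J (pt x₀ w) ∈ twistorFiber g (φ (pt x₀ w)) ∧ IsCompatibleAt φ J (pt x₀ w)) :
    (covDeriv g φ J x₀ y₀ z Complex.I - covDeriv g φ J x₀ y₀ z 1 * localSection φ J x₀ y₀ z)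
      (dMap φ x₀ y₀ z 1) = 0 := by
  have hφ := h.smooth
  have hp := (isOpen_patch hφ.continuous x₀ y₀).mem_nhds hz
  have hD : ∀ ζ, DifferentiableAt ℝ (fun w => dMap φ x₀ y₀ w ζ) z := fun ζ =>
    ((contDiffOn_dMap hφ x₀ y₀ ζ).contDiffAt hp).differentiableAt (by simp)
  have hev : ∀ᶠ w in 𝓝 z, ∀ ζ, localSection φ J x₀ y₀ w (dMap φ x₀ y₀ w ζ) =
      dMap φ x₀ y₀ w (Complex.I * ζ) := by
    filter_upwards [hJ, hp] with w hw hwp ζ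
    exact hw.2.localSection_dMap hφ hwp ζ
  have hder : ∀ ζ η : ℂ, fderiv ℝ (localSection φ J x₀ y₀) z η (dMap φ x₀ y₀ z ζ) +
      localSection φ J x₀ y₀ z (fderiv ℝ (fun w => dMap φ x₀ y₀ w ζ) z η) =
      fderiv ℝ (fun w => dMap φ x₀ y₀ w (Complex.I * ζ)) z η := by
    intro ζ η
    have h1 : (fun w => localSection φ J x₀ y₀ w (dMap φ x₀ y₀ w ζ)) =ᶠ[𝓝 z]
        fun w => dMap φ x₀ y₀ w (Complex.I * ζ) := by
      filter_upwards [hev] with w hw using hw ζ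
    rw [← h1.fderiv_eq, (hd.hasFDerivAt.clm_apply (hD ζ).hasFDerivAt).fderiv, add_comm]
    rfl
  have hneg : ∀ w, dMap φ x₀ y₀ w (Complex.I * Complex.I) = -dMap φ x₀ y₀ w 1 := by
    intro w
    rw [Complex.I_mul_I]
    exact map_neg (fderiv ℝ (localMap φ x₀ y₀) w) 1
  have k1 := hev.self_of_nhds 1
  have k2 := hev.self_of_nhds Complex.I
  have k3 := hder 1 Complex.I
  have k4 := hder Complex.I 1
  simp only [hneg, mul_one] at k1 k2 k3 k4
  rw [fderiv_fun_neg] at k4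
  rw [fderiv_dMap_comm hφ hz] at k3
  refine commutator_apply_eq_zero (a := fderiv ℝ (fun w => dMap φ x₀ y₀ w 1) z 1) k1 k2 k3 k4 ?_ (connForm_comm g y₀ _ _ _)
  rw [← h.harmonic x₀ y₀ z hz, tension]
  simp only [pullConn]
  abel

/-- Compatible complex structures satisfy the Cauchy–Riemann equations. -/
theorem IsLiftAt.cauchyRiemann (h : IsBranchedMinimalImmersion g φ) (hz : z ∈ patch φ x₀ y₀)
    (hL : IsLiftAt g φ J (pt x₀ z)) :
    covDeriv g φ J x₀ y₀ z Complex.I =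
      covDeriv g φ J x₀ y₀ z 1 * localSection φ J x₀ y₀ z := by
  have hJ := eventually_pt (P := fun x => J x ∈ twistorFiber g (φ x) ∧ IsCompatibleAt φ J x)
    hz.1 hL.eventually
  have hc := hL.contDiffAt h.smooth hz
  obtain ⟨U, e, u, hU, hp, he, hu, hev⟩ := hL
  have hzU : z ∈ patch φ x₀ y₀ ∩ pt x₀ ⁻¹' U := ⟨hz, hp⟩
  -- Since ∂₁φ may vanish at z, the equation is proved on a punctured neighbourhood and extended by
  -- continuity.
  refine (covDeriv_iff_covVec h.smooth hU he hzU hu (hev.mono fun x hx => hx.1)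
    (hev.mono fun x hx => hx.2.1)).2 (covVec_eq_of_punctured h.smooth hU he hzU
    (hu x₀ z hz.1 rfl) ?_)
  have hev' := eventually_pt (P := fun x => J x = fiberSd g (φ x) (e x) (u x) ∧
    dot3 (u x) (u x) = 1 ∧ IsCompatibleAt φ J x) hz.1 hev
  filter_upwards [h.eventually_conformalFactor_ne hz,
    nhdsWithin_le_nhds (eventually_mem_patch h.smooth.continuous hU hzU),
    nhdsWithin_le_nhds hJ.eventually_nhds, nhdsWithin_le_nhds hev'.eventually_nhds,
    nhdsWithin_le_nhds (hc.eventually (by simp)),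
    nhdsWithin_le_nhds ((hu x₀ z hz.1 rfl).eventually (by simp))] with w hw1 hw2 hw3 hw4 hw5 hw6
  have h0 : dMap φ x₀ y₀ w 1 ≠ 0 := by
    intro h0
    refine hw1 ?_
    have : conformalFactor g φ x₀ y₀ w =
      pullForm g φ x₀ y₀ w (dMap φ x₀ y₀ w 1) (dMap φ x₀ y₀ w 1) := rfl
    rw [this, h0, map_zero]
  have h1 := covDeriv_apply_dMap h hw2.1 (hw5.differentiableAt (by simp)) hw3
  rw [covDeriv_sub_eq h.smooth hU he hw2 (hw6.differentiableAt (by simp))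
    (hw4.mono fun x hx => hx.1) (hw4.mono fun x hx => hx.2.1)] at h1
  -- The Cauchy–Riemann defect is self-dual and kills ∂₁φ ≠ 0, so its coefficient vector is zero.
  exact sub_eq_zero.1 (eq_zero_of_sdEnd_apply_eq_zero (isON_chartFrame g hw2.1
    ((isOrientedOrthonormal_iff g _ _).1 (he.orthonormal _ hw2.2)).1) h0 h1)

theorem IsTwistorLift.isHolomorphicOn (hN : IsOrientedAtlas N) (h : IsBranchedMinimalImmersion g φ)
    (hJ : IsTwistorLift g φ J) : IsHolomorphicOn g φ J Set.univ := by
  have hL := hJ.isLiftAt hN h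
  refine (isHolomorphicOn_iff_covDeriv h.smooth.continuous isOpen_univ ⟨fun x _ => hJ.mem x,
    fun x₀ y₀ z hz => ((hL _).contDiffAt h.smooth hz.1).contDiffWithinAt⟩).2
    fun x₀ y₀ z hz => (hL _).cauchyRiemann h hz.1

end Lift

/-- By the wedge convention e₁ ∧ e₂ sends e₁ to -e₂, so it is -E₁ that rotates e₁ to e₂. -/
theorem sdEnd_single_apply {b : Bilin} {f : Fin 4 → E4} (h : IsON b f) :
    sdEnd b f (Pi.single 0 (-1)) (f 0) = f 1 := by
  have h1 : coframe b f (f 0) = bvec 0 := by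
    ext i
    rw [coframe_apply, h i 0]
    simp
  have h2 : matEnd (sdMatrix (Pi.single 0 (-1))) (bvec 0) = bvec 1 := by
    ext i
    rw [matEnd_apply, sdMatrix_mulVec]
    fin_cases i <;> simp
  have h3 : sdEnd b f (Pi.single 0 (-1)) (f 0) =
    frameMap f (matEnd (sdMatrix (Pi.single 0 (-1))) (coframe b f (f 0))) := rfl
  rw [h3, h1, h2, frameMap_apply]
  simp

/-! ### Holomorphic sections as solutions of the system. -/

section System

variable {S : Type*} [TopologicalSpace S] [ChartedSpace ℂ S]
  {N : Type*} [TopologicalSpace N] [ChartedSpace E4 N] [IsManifold (𝓡 4) ∞ N]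
  {φ : S → N} {g : Metric N} {J : EndSection φ}
  {e : ∀ x : S, Fin 4 → TangentSpace (𝓡 4) (φ x)} {U V : Set S}

theorem IsLocalFrame.mono (he : IsLocalFrame g φ U e) (hVU : V ⊆ U) : IsLocalFrame g φ V e :=
  ⟨fun x hx => he.orthonormal x (hVU hx), fun x₀ y₀ i => (he.smooth x₀ y₀ i).mono
    (Set.inter_subset_inter_right _ (Set.preimage_mono hVU))⟩

theorem IsC1SectionOn.mono (hJ : IsC1SectionOn g φ J U) (hVU : V ⊆ U) : IsC1SectionOn g φ J V :=
  ⟨fun x hx => hJ.1 x (hVU hx), fun x₀ y₀ => (hJ.2 x₀ y₀).mono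
    (Set.inter_subset_inter_right _ (Set.preimage_mono hVU))⟩

theorem IsHolomorphicOn.mono (hJ : IsHolomorphicOn g φ J U) (hVU : V ⊆ U) :
    IsHolomorphicOn g φ J V :=
  ⟨hJ.1.mono hVU, fun x₀ y₀ z hz => hJ.2 x₀ y₀ z ⟨hz.1, hVU hz.2⟩⟩

variable [IsManifold 𝓘(ℂ) ω S]

/-- Over the lower hemisphere holomorphy is the elliptic system. -/
theorem isHolomorphicOn_iff_solvesAt (hφ : ContMDiff 𝓘(ℝ, ℂ) (𝓡 4) ∞ φ) (hU : IsOpen U)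
    (he : IsLocalFrame g φ U e) (hV : IsOpen V) (hVU : V ⊆ U) (hJ : IsC1SectionOn g φ J V)
    (hneg : ∀ x ∈ V, frameCoeff g φ e J 0 x < 0) :
    IsHolomorphicOn g φ J V ↔ ∀ x₀ y₀, ∀ z ∈ patch φ x₀ y₀ ∩ pt x₀ ⁻¹' V,
      SolvesAt principalPart lowerOrderPart (frameChristoffel g φ e x₀ y₀ z)
        (unknown g φ e J x₀) z := by
  rw [isHolomorphicOn_iff_covVec hφ hU he hV hVU hJ]
  refine forall_congr' fun x₀ => forall_congr' fun y₀ => forall₂_congr fun z hz => ?_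
  have hdiff : DifferentiableAt ℝ (fun w i => frameCoeff g φ e J i (pt x₀ w)) z :=
    (isC1At_frameCoeff hφ hU he hV hVU hJ hz.2 x₀ z hz.1.1 rfl).differentiableAt (by simp)
  have h1 : ∀ᶠ w in 𝓝 z, dot3 (fun i => frameCoeff g φ e J i (pt x₀ w))
      (fun i => frameCoeff g φ e J i (pt x₀ w)) = 1 := by
    filter_upwards [eventually_mem_patch hφ.continuous hV hz] with w hw
    exact (eq_fiberSd_frameCoeff g (he.orthonormal _ (hVU hw.2)) (hJ.1 _ hw.2)).2
  exact (solvesAt_iff (u := fun w i => frameCoeff g φ e J i (pt x₀ w)) hdiff h1 (hneg _ hz.2)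
    (θ := fun α => frameRot g φ e x₀ y₀ z (dir α)) fun α i =>
      sum_frameChristoffel hφ hU he ⟨hz.1, hVU hz.2⟩ α _ i).symm

/-- Every oriented complex structure is `-E₁` in a suitable oriented orthonormal basis. -/
theorem exists_eq_fiberSd_single {y : N} {K : EndT y} (hK : K ∈ twistorFiber g y) :
    ∃ f : Fin 4 → TangentSpace (𝓡 4) y, IsOrientedOrthonormal g y f ∧
      K = fiberSd g y f (Pi.single 0 (-1)) := by
  obtain ⟨f₀, hf₀⟩ := exists_isOrientedOrthonormal g y
  -- Any unit vector starts a basis adapted to `K`. There `K` and -E₁ have the same value on the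
  -- first vector, hence are equal.
  obtain ⟨f, hon, hdet, -, h01, -⟩ := exists_adapted_isON (fiberForm_symm g y) (fiberForm_pos g y)
    (K := K) hK (hf₀.1 0 0)
  have hf : IsOrientedOrthonormal g y f := ⟨hon, hdet⟩
  refine ⟨f, hf, eq_of_apply_eq hK (fiberSd_mem_twistorFiber g hf (by simp [dot3])) (v := f 0) ?_
    (h01.trans (sdEnd_single_apply hon).symm)⟩
  intro h0
  have := hon 0 0
  rw [h0] at this
  simp at this

/-- Near every point a holomorphic section lies in the lower hemisphere of a frame. -/
theorem exists_isLocalFrame_neg (hN : IsOrientedAtlas N) (hφ : ContMDiff 𝓘(ℝ, ℂ) (𝓡 4) ∞ φ)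
    (hJ : IsHolomorphicOn g φ J Set.univ) (p : S) :
    ∃ (U : Set S) (e : ∀ x : S, Fin 4 → TangentSpace (𝓡 4) (φ x)),
      IsOpen U ∧ p ∈ U ∧ IsLocalFrame g φ U e ∧ J p = -frameSection g φ e 0 p ∧
      (∀ x ∈ U, frameCoeff g φ e J 0 x < 0) ∧
      ∀ x₀ y₀, ∀ z ∈ patch φ x₀ y₀ ∩ pt x₀ ⁻¹' U, SolvesAt principalPart lowerOrderPart
        (frameChristoffel g φ e x₀ y₀ z) (unknown g φ e J x₀) z := by
  obtain ⟨f, hf, hJp⟩ := exists_eq_fiberSd_single (hJ.1.1 p (Set.mem_univ p))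
  obtain ⟨U, e, hU, hp, he, rfl⟩ := exists_isLocalFrame hN g hφ p hf
  have hc := isC1At_frameCoeff hφ hU he hU subset_rfl (hJ.1.mono (Set.subset_univ U)) hp
  have h0 : frameCoeff g φ e J 0 p < 0 := by
    rw [frameCoeff_fiberSd g ((isOrientedOrthonormal_iff g _ _).1 hf).1 hJp]
    simp
  have hev : ∀ᶠ x in 𝓝 p, frameCoeff g φ e J 0 x < 0 := by
    refine eventually_of_pt p ?_
    have h1 := (continuousAt_pi.1 (hc p _ (chartAt_mem_target p) (pt_chartAt p)).continuousAt 0)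
    refine h1.eventually_lt continuousAt_const ?_
    simp only [pt_chartAt]
    exact h0
  obtain ⟨W, hW, hWo, hpW⟩ := mem_nhds_iff.1 hev
  have hUW := he.mono (Set.inter_subset_left (s := U) (t := W))
  refine ⟨U ∩ W, e, hU.inter hWo, ⟨hp, hpW⟩, hUW, ?_, fun x hx => hW hx.2, ?_⟩
  · rw [hJp, fiberSd_eq_sum]
    simp
  · exact (isHolomorphicOn_iff_solvesAt hφ (hU.inter hWo) hUW (hU.inter hWo) subset_rfl
      (hJ.1.mono (Set.subset_univ _)) fun x hx => hW hx.2).1 (hJ.mono (Set.subset_univ _))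

end System

end TwistorLift

end

open TwistorLift in
theorem lemma6
    {S : Type*} [TopologicalSpace S] [T2Space S] [ChartedSpace ℂ S] [IsManifold 𝓘(ℂ) ω S]
    {N : Type*} [TopologicalSpace N] [T2Space N] [ChartedSpace E4 N] [IsManifold (𝓡 4) ∞ N]
    (hN : IsOrientedAtlas N) (g : Metric N)
    (φ : S → N) (hφ : IsBranchedMinimalImmersion g φ) :
    -- the induced section is well defined, and it is a holomorphic map
    (∃! J : EndSection φ, IsTwistorLift g φ J) ∧
    (∀ J : EndSection φ, IsTwistorLift g φ J → IsHolomorphicOn g φ J Set.univ) ∧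
    -- the first order elliptic system
    (∃ (A : Principal) (B : LowerOrder),
      (∀ α, ContDiffOn ℝ ∞ (A α) disc) ∧ ContDiffOn ℝ ∞ B disc ∧ IsElliptic A ∧
      -- smoothness of the coefficients, and equivalence of the system with holomorphy
      (∀ (U : Set S) (e : ∀ x : S, Fin 4 → TangentSpace (𝓡 4) (φ x)),
        IsOpen U → IsLocalFrame g φ U e →
        (∀ x₀ y₀, ContDiffOn ℝ ∞ (frameChristoffel g φ e x₀ y₀)
          (patch φ x₀ y₀ ∩ pt x₀ ⁻¹' U)) ∧
        ∀ (V : Set S) (J : EndSection φ), IsOpen V → V ⊆ U → IsC1SectionOn g φ J V →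
          (∀ x ∈ V, J x = ∑ i, frameCoeff g φ e J i x • frameSection g φ e i x) ∧
          ((∀ x ∈ V, frameCoeff g φ e J 0 x < 0) →
            (IsHolomorphicOn g φ J V ↔
              ∀ x₀ y₀, ∀ z ∈ patch φ x₀ y₀ ∩ pt x₀ ⁻¹' V,
                SolvesAt A B (frameChristoffel g φ e x₀ y₀ z) (unknown g φ e J x₀) z))) ∧
      -- the induced section satisfies the system near every point
      (∀ J : EndSection φ, IsTwistorLift g φ J → ∀ p : S,
        ∃ (U : Set S) (e : ∀ x : S, Fin 4 → TangentSpace (𝓡 4) (φ x)),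
          IsOpen U ∧ p ∈ U ∧ IsLocalFrame g φ U e ∧ J p = -frameSection g φ e 0 p ∧
          (∀ x ∈ U, frameCoeff g φ e J 0 x < 0) ∧
          ∀ x₀ y₀, ∀ z ∈ patch φ x₀ y₀ ∩ pt x₀ ⁻¹' U,
            SolvesAt A B (frameChristoffel g φ e x₀ y₀ z) (unknown g φ e J x₀) z)) ∧
    -- bounded isolated singularities are removable
    (∀ (V : Set S) (p : S) (e : ∀ x : S, Fin 4 → TangentSpace (𝓡 4) (φ x)) (J : EndSection φ)
      (δ : ℝ), IsOpen V → p ∈ V → IsLocalFrame g φ V e → IsHolomorphicOn g φ J (V \ {p}) →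
      0 < δ → (∀ x ∈ V \ {p}, frameCoeff g φ e J 0 x ≤ 1 - δ) →
      ∃ J' : EndSection φ, (∀ x ∈ V \ {p}, J' x = J x) ∧ IsHolomorphicOn g φ J' V) := by
  refine ⟨existsUnique_isTwistorLift hN hφ, fun J hJ => hJ.isHolomorphicOn hN hφ,
    ⟨principalPart, lowerOrderPart, contDiffOn_principalPart, contDiffOn_lowerOrderPart,
      isElliptic_principalPart, fun U e hU he => ⟨fun x₀ y₀ =>
        contDiffOn_frameChristoffel hφ.smooth hU he, fun V J hV hVU hJ => ⟨fun x hx => ?_,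
        isHolomorphicOn_iff_solvesAt hφ.smooth hU he hV hVU hJ⟩⟩,
      fun J hJ p => exists_isLocalFrame_neg hN hφ.smooth (hJ.isHolomorphicOn hN hφ) p⟩,
    fun V p e J δ hV hp he hJ hδ hb => exists_holomorphic_extension hφ.smooth hV hp he hJ hδ hb⟩
  rw [← fiberSd_eq_sum]
  exact (eq_fiberSd_frameCoeff g (he.orthonormal x (hVU hx)) (hJ.1 x hx)).1
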